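/- **Theorem (Uniqueness of Lagrangian coisotropic embedding to first order).** Manifolds are smooth, nonempty, finite-dimensional, Hausdorff, second countable and without boundary. Let $Q$ be a manifold, let $S_{TQ}$ be the canonical vertical endomorphism of $TQ$ (locally $S_{TQ} = dq^j\otimes \partial/\partial v^j$), let $L\in C^\infty(TQ)$, and let $\omega_L=-d\theta_L$ with $\theta_L = S_{TQ}^*(dL)$ (locally $\theta_L=\frac{\partial L}{\partial v^j}dq^j$). Assume that the characteristic distribution $\ker\omega_L$ is the complete lift $\underline K^{C}$ of a smooth distribution $\underline K$ of constant rank on $Q$; that is, for every $v\in T_qQ$ the space $\ker(\omega_L)_v$ is spanned by the values at $v$ of the complete lifts $X^C=X^i\frac{\partial}{\partial q^i}+v^k\frac{\partial X^i}{\partial q^k}\frac{\partial}{\partial v^i}$ and the vertical lifts $X^V=X^i\frac{\partial}{\partial v^i}$ of the smooth sections $X$ of $\underline K$ defined near $q$. For $i=1,2$ let $(\widetilde M_i,\widetilde\omega_i)$ be a symplectic regularization of $(TQ,\omega_L)$: a symplectic manifold with a smooth embedding $\mathfrak i_i\colon TQ\hookrightarrow\widetilde M_i$ such that $\mathfrak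 i_i^*\widetilde\omega_i=\omega_L$ and $\mathfrak i_i(TQ)$ is coisotropic, i.e. at each of its points its tangent space contains its own $\widetilde\omega_i$-orthogonal. Let $\widetilde S_i$ be a tangent structure on $\widetilde M_i$, i.e. a smooth $(1,1)$-tensor field with $\operatorname{Im}\widetilde S_i=\ker\widetilde S_i$ and vanishing Nijenhuis tensor, such that $\widetilde\omega_i$ is Lagrangian for it, i.e. $i_{\widetilde S_i}\widetilde\omega_i=0$, which means $\widetilde\omega_i(\widetilde S_iX,Y)+\widetilde\omega_i(X,\widetilde S_iY)=0$ for all $X,Y$, and such that $\mathfrak i_i$ preserves the tangent structures: $(\mathfrak i_i)_*\circ S_{TQ}=\widetilde S_i\circ(\mathfrak i_i)_*$. Then there are tubular neighbourhoods $U_1\subseteq\widetilde M_1$ of $\mathfrak i_1(TQ)$ and $U_2\subseteq\widetilde M_2$ of $\mathfrak i_2(TQ)$ and a diffeomorphism $\psi\colon U_1\to U_2$ that is the identity on $TQ$, i.e. $\psi\circ\mathfrak i_1=\mathfrak i_2$, and that carries $(\widetilde\omega_1,\widetilde S_1)$ exactly to $(\widetilde\omega_2,\widetilde S_2)$ along $TQ$: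 for every $p\in\mathfrak i_1(TQ)$ and all $\xi,\eta\in T_p\widetilde M_1$, $$(\widetilde\omega_2)_{\psi(p)}(\psi_*\xi,\psi_*\eta)=(\widetilde\omega_1)_p(\xi,\eta),\qquad \psi_*(\widetilde S_1\xi)=\widetilde S_2(\psi_*\xi).$$ Here a tubular neighbourhood of an embedded submanifold $N\subseteq M$ is an open subset $U\supseteq N$ of $M$ for which there are a smooth vector bundle over $N$ and a diffeomorphism onto $U$ from an open, fibrewise star-shaped neighbourhood of the zero section, restricting to the inclusion of $N$ on the zero section. -/

import Mathlib

open Bundle Set Topology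
open scoped Manifold ContDiff

noncomputable section

namespace LagReg

section Forms

variable {E : Type*} [NormedAddCommGroup E] [NormedSpace ℝ E]
  {H : Type*} [TopologicalSpace H]
  {E' : Type*} [NormedAddCommGroup E'] [NormedSpace ℝ E']
  {H' : Type*} [TopologicalSpace H']

/-- A (not necessarily smooth) differential `k`-form on a manifold `M`: an alternating `k`-linear
form on each tangent space. -/
abbrev DiffForm (I : ModelWithCorners ℝ E H) (M : Type*) [TopologicalSpace M] [ChartedSpace H M]
    (k : ℕ) : Type _ :=
  ∀ x : M, (TangentSpace I x) [⋀^Fin k]→L[ℝ] ℝ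

/-- The pullback `f^* σ` of a differential form. -/
def DiffForm.pullback (I : ModelWithCorners ℝ E H) (I' : ModelWithCorners ℝ E' H')
    {M : Type*} [TopologicalSpace M] [ChartedSpace H M]
    {M' : Type*} [TopologicalSpace M'] [ChartedSpace H' M'] {k : ℕ}
    (f : M → M') (σ : DiffForm I' M' k) : DiffForm I M k :=
  fun x => (σ (f x)).compContinuousLinearMap (mfderiv I I' f x)

variable {I : ModelWithCorners ℝ E H} {M : Type*} [TopologicalSpace M] [ChartedSpace H M] {k : ℕ}

/-- The coordinate representation of a form in the preferred chart at `x₀`, i.e. its pullback along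
the inverse chart (meaningful on the target of the chart; for manifolds without boundary). -/
def DiffForm.inChart (σ : DiffForm I M k) (x₀ : M) : E → E [⋀^Fin k]→L[ℝ] ℝ :=
  DiffForm.pullback 𝓘(ℝ, E) I (extChartAt I x₀).symm σ

/-- A form is smooth if its coordinate representations are. -/
def DiffForm.IsSmooth (σ : DiffForm I M k) : Prop :=
  ∀ x₀ : M, ContDiffOn ℝ ∞ (DiffForm.inChart σ x₀) (extChartAt I x₀).target

/-- The exterior derivative, computed at `x₀` in the preferred chart at `x₀`. -/
def DiffForm.d (σ : DiffForm I M k) : DiffForm I M (k + 1) :=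
  fun x₀ => (extDeriv (DiffForm.inChart σ x₀) (extChartAt I x₀ x₀)).compContinuousLinearMap
    (mfderiv I 𝓘(ℝ, E) (extChartAt I x₀) x₀)

/-- Symplectic forms: smooth, closed and nondegenerate 2-forms. -/
structure IsSymplectic (σ : DiffForm I M 2) : Prop where
  smooth : DiffForm.IsSmooth σ
  closed : DiffForm.d σ = 0
  nondegenerate : ∀ (x : M) (ξ : TangentSpace I x), (∀ η, σ x ![ξ, η] = 0) → ξ = 0

/-- The characteristic distribution `ker σ` of a 2-form, as a family of subsets of the tangent
spaces. -/
def characteristic (σ : DiffForm I M 2) (x : M) : Set (TangentSpace I x) :=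
  {ξ | ∀ η, σ x ![ξ, η] = 0}

end Forms

section TangentStructures

variable {E : Type*} [NormedAddCommGroup E] [NormedSpace ℝ E]
  {H : Type*} [TopologicalSpace H] {I : ModelWithCorners ℝ E H}
  {M : Type*} [TopologicalSpace M] [ChartedSpace H M]

/-- The vector field `S X`. -/
def applyField (S : ∀ x : M, TangentSpace I x →L[ℝ] TangentSpace I x)
    (X : ∀ x : M, TangentSpace I x) : ∀ x : M, TangentSpace I x :=
  fun x => S x (X x)

/-- The Nijenhuis tensor
`N_S(X, Y) = [S X, S Y] - S [S X, Y] - S [X, S Y] + S² [X, Y]`. -/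
def nijenhuis (S : ∀ x : M, TangentSpace I x →L[ℝ] TangentSpace I x)
    (X Y : ∀ x : M, TangentSpace I x) (x : M) : TangentSpace I x :=
  VectorField.mlieBracket I (applyField S X) (applyField S Y) x
    - S x (VectorField.mlieBracket I (applyField S X) Y x)
    - S x (VectorField.mlieBracket I X (applyField S Y) x)
    + S x (S x (VectorField.mlieBracket I X Y x))

/-- A tangent structure: a smooth `(1,1)`-tensor field `S` with `Im S = ker S` and vanishing
Nijenhuis tensor. -/
structure IsTangentStructure [IsManifold I 1 M]
    (S : ∀ x : M, TangentSpace I x →L[ℝ] TangentSpace I x) : Prop where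
  smooth : ContMDiff I (I.prod 𝓘(ℝ, E →L[ℝ] E)) ∞
    (fun x => (TotalSpace.mk' (E →L[ℝ] E)
      (E := fun x : M => TangentSpace I x →L[ℝ] TangentSpace I x) x (S x)))
  range_eq_ker : ∀ (x : M) (ξ : TangentSpace I x), (∃ η, S x η = ξ) ↔ S x ξ = 0
  nijenhuis_eq_zero : ∀ X Y : (∀ x : M, TangentSpace I x),
    ContMDiff I I.tangent ∞ (fun x => (⟨x, X x⟩ : TangentBundle I M)) →
    ContMDiff I I.tangent ∞ (fun x => (⟨x, Y x⟩ : TangentBundle I M)) →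
    ∀ x, nijenhuis S X Y x = 0

/-- The condition `i_S σ = 0`, i.e. `σ (S ξ, η) + σ (ξ, S η) = 0`. -/
def IsLagrangianFor (S : ∀ x : M, TangentSpace I x →L[ℝ] TangentSpace I x)
    (σ : DiffForm I M 2) : Prop :=
  ∀ (x : M) (ξ η : TangentSpace I x), σ x ![S x ξ, η] + σ x ![ξ, S x η] = 0

end TangentStructures

section TangentBundle

variable {E : Type*} [NormedAddCommGroup E] [NormedSpace ℝ E]
  {H : Type*} [TopologicalSpace H] {I : ModelWithCorners ℝ E H}
  {Q : Type*} [TopologicalSpace Q] [ChartedSpace H Q] [IsManifold I 1 Q]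

/-- The vertical lift `T_q Q → T_v (TQ)` at `v ∈ T_q Q`: the derivative at `v` of the inclusion of
the fibre `T_q Q` into `TQ`; it sends `w` to the velocity of `t ↦ v + t w`. -/
def verticalLift (v : TangentBundle I Q) :
    TangentSpace I v.proj →L[ℝ] TangentSpace I.tangent v :=
  mfderiv 𝓘(ℝ, E) I.tangent (fun w : E => (⟨v.proj, w⟩ : TangentBundle I Q)) v.2

/-- The canonical vertical endomorphism `S` of `TQ`: `S ξ = (π_* ξ)^V`. -/
def verticalEndo (v : TangentBundle I Q) :
    TangentSpace I.tangent v →L[ℝ] TangentSpace I.tangent v :=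
  (verticalLift v).comp
    (mfderiv I.tangent I (fun u : TangentBundle I Q => u.proj) v)

/-- The Poincaré–Cartan 1-form `θ_L = S^* (dL)`. -/
def poincareCartan (L : TangentBundle I Q → ℝ) : DiffForm I.tangent (TangentBundle I Q) 1 :=
  fun v => ContinuousAlternatingMap.ofSubsingleton ℝ (TangentSpace I.tangent v) ℝ (0 : Fin 1)
    (ContinuousLinearMap.comp (mfderiv I.tangent 𝓘(ℝ, ℝ) L v :
      TangentSpace I.tangent v →L[ℝ] ℝ) (verticalEndo v))

/-- The Lagrangian 2-form `ω_L = - dθ_L`. -/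
def lagrangianForm (L : TangentBundle I Q → ℝ) : DiffForm I.tangent (TangentBundle I Q) 2 :=
  -DiffForm.d (poincareCartan L)

/-- The value at `v ∈ T_q Q` of the complete lift `X^C` of a vector field `X`: the image of
`TX (v) ∈ T_{X(q)} (TQ)` under the canonical flip of `T(TQ)`. Mathlib identifies both `T_{X(q)} (TQ)`
and `T_v (TQ)` with `E × E` by the chart of `TQ` induced by the preferred chart of `Q` at `q`; in it
`TX (v) = (v, DX(q) v)` and the flip is `(q, x; v, a) ↦ (q, v; x, a)`, so that
`X^C = X^i ∂/∂q^i + v^k (∂X^i/∂q^k) ∂/∂v^i`. -/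
def completeLiftField (X : ∀ q : Q, TangentSpace I q) (v : TangentBundle I Q) :
    TangentSpace I.tangent v :=
  let a : E × E := mfderiv I I.tangent (fun q => (⟨q, X q⟩ : TangentBundle I Q)) v.proj v.2
  ((X v.proj, a.2) : E × E)

/-- `X` is a smooth vector field on the open set `U` with values in the distribution `D`. -/
structure IsLocalSection (D : ∀ q : Q, Submodule ℝ (TangentSpace I q)) (U : Set Q)
    (X : ∀ q : Q, TangentSpace I q) : Prop where
  smooth : ContMDiffOn I I.tangent ∞ (fun q => (⟨q, X q⟩ : TangentBundle I Q)) U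
  mem : ∀ q ∈ U, X q ∈ D q

/-- A smooth distribution of constant rank `r`: locally it has a smooth frame with `r` elements. -/
def IsRegularDistribution (r : ℕ) (D : ∀ q : Q, Submodule ℝ (TangentSpace I q)) : Prop :=
  ∀ q₀ : Q, ∃ U : Set Q, IsOpen U ∧ q₀ ∈ U ∧ ∃ X : Fin r → ∀ q : Q, TangentSpace I q,
    (∀ j, IsLocalSection D U (X j)) ∧
    ∀ q ∈ U, LinearIndependent ℝ (fun j => X j q) ∧ Submodule.span ℝ (range fun j => X j q) = D q

/-- The complete lift (tangent distribution) of a distribution `D` on `Q`: at `v ∈ T_q Q` it is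
spanned by the complete and vertical lifts of the smooth sections of `D` defined near `q`. -/
def completeLift (D : ∀ q : Q, Submodule ℝ (TangentSpace I q)) (v : TangentBundle I Q) :
    Submodule ℝ (TangentSpace I.tangent v) :=
  Submodule.span ℝ {ξ | ∃ (U : Set Q) (X : ∀ q : Q, TangentSpace I q),
    IsOpen U ∧ v.proj ∈ U ∧ IsLocalSection D U X ∧
      (ξ = completeLiftField X v ∨ ξ = verticalLift v (X v.proj))}

end TangentBundle

section Embeddings

universe u

variable {E : Type*} [NormedAddCommGroup E] [NormedSpace ℝ E]
  {H : Type*} [TopologicalSpace H]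
  {E' : Type*} [NormedAddCommGroup E'] [NormedSpace ℝ E']
  {H' : Type*} [TopologicalSpace H']

/-- `i : (N, σ₀) → (M, σ)` is a coisotropic embedding into a symplectic manifold: a smooth embedding
with `i^* σ = σ₀` such that the `σ`-orthogonal of each tangent space of `i(N)` is contained in that
tangent space. -/
structure IsCoisotropicEmbedding (I : ModelWithCorners ℝ E H) (I' : ModelWithCorners ℝ E' H')
    {N : Type*} [TopologicalSpace N] [ChartedSpace H N]
    {M : Type*} [TopologicalSpace M] [ChartedSpace H' M]
    (σ₀ : DiffForm I N 2) (σ : DiffForm I' M 2) (i : N → M) : Prop where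
  symplectic : IsSymplectic σ
  embedding : Manifold.IsSmoothEmbedding I I' ∞ i
  pullback_eq : DiffForm.pullback I I' i σ = σ₀
  coisotropic : ∀ (p : N) (ξ : TangentSpace I' (i p)),
    (∀ η : TangentSpace I p, σ (i p) ![ξ, mfderiv I I' i p η] = 0) →
      ∃ ζ : TangentSpace I p, mfderiv I I' i p ζ = ξ

/-- `U` is a tubular neighbourhood of the embedded submanifold `i : N → M`: there are a smooth
vector bundle over `N` (given by smooth transition functions) and a diffeomorphism `Φ` onto `U` from
an open, fibrewise star-shaped neighbourhood of the zero section, which is `i` on the zero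
section. -/
def IsTubularNeighborhood (I : ModelWithCorners ℝ E H) (I' : ModelWithCorners ℝ E' H')
    {N : Type u} [TopologicalSpace N] [ChartedSpace H N]
    {M : Type*} [TopologicalSpace M] [ChartedSpace H' M] (i : N → M) (U : Set M) : Prop :=
  ∃ (k : ℕ) (ι : Type u) (Z : VectorBundleCore ℝ N (EuclideanSpace ℝ (Fin k)) ι),
    Z.IsContMDiff I ∞ ∧
    ∃ Φ : OpenPartialHomeomorph (TotalSpace (EuclideanSpace ℝ (Fin k)) Z.Fiber) M,
      (∀ p : N, (⟨p, (0 : Z.Fiber p)⟩ : TotalSpace (EuclideanSpace ℝ (Fin k)) Z.Fiber) ∈ Φ.source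
        ∧ Φ ⟨p, (0 : Z.Fiber p)⟩ = i p) ∧
      (∀ z ∈ Φ.source, ∀ t ∈ Icc (0 : ℝ) 1,
        (⟨z.proj, t • z.2⟩ : TotalSpace (EuclideanSpace ℝ (Fin k)) Z.Fiber) ∈ Φ.source) ∧
      Φ.target = U ∧
      ContMDiffOn (I.prod 𝓘(ℝ, EuclideanSpace ℝ (Fin k))) I' ∞ Φ Φ.source ∧
      ContMDiffOn I' (I.prod 𝓘(ℝ, EuclideanSpace ℝ (Fin k))) ∞ Φ.symm Φ.target

end Embeddings

section Regularization

variable {E : Type*} [NormedAddCommGroup E] [NormedSpace ℝ E]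
  {Q : Type*} [TopologicalSpace Q] [ChartedSpace E Q] [IsManifold 𝓘(ℝ, E) ∞ Q]
  {F : Type*} [NormedAddCommGroup F] [NormedSpace ℝ F]
  {M : Type*} [TopologicalSpace M] [ChartedSpace F M] [IsManifold 𝓘(ℝ, F) ∞ M]

/-- A symplectic regularization `i : TQ → (M, σ)` of `(TQ, ω_L)` together with a tangent structure
`S` on `M` for which `σ` is Lagrangian and which extends the canonical one of `TQ`:
`i_* ∘ S_{TQ} = S ∘ i_*`. -/
structure IsLagrangianRegularization (L : TangentBundle 𝓘(ℝ, E) Q → ℝ)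
    (i : TangentBundle 𝓘(ℝ, E) Q → M) (σ : DiffForm 𝓘(ℝ, F) M 2)
    (S : ∀ x : M, TangentSpace 𝓘(ℝ, F) x →L[ℝ] TangentSpace 𝓘(ℝ, F) x) : Prop where
  regularization : IsCoisotropicEmbedding 𝓘(ℝ, E).tangent 𝓘(ℝ, F) (lagrangianForm L) σ i
  tangentStructure : IsTangentStructure S
  lagrangian : IsLagrangianFor S σ
  preserves : ∀ (v : TangentBundle 𝓘(ℝ, E) Q) (ξ : TangentSpace 𝓘(ℝ, E).tangent v),
    mfderiv 𝓘(ℝ, E).tangent 𝓘(ℝ, F) i v (verticalEndo v ξ)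
      = S (i v) (mfderiv 𝓘(ℝ, E).tangent 𝓘(ℝ, F) i v ξ)

end Regularization

end LagReg

end

/-! The claim concerns only first derivatives along the zero-order data, so it splits into linear
algebra in the tangent spaces along $N = TQ$, a gluing argument, and the realization of a prescribed
first derivative by a diffeomorphism.

Linear algebra. At a point, let $B : Y \to F$ be the derivative of the embedding, $T$ the vertical
endomorphism of $Y$, and $P \subseteq BY$ the symplectic orthogonal of $BY$. Since $BT = SB$ and $S$
is skew-adjoint, $P$ is stable under $S$; since $\operatorname{Im} T = \ker T$ as well, $P$ is free
over $\mathbb R[S]/(S^2)$ (`exists_eq_of_map_eq_zero`). A frame $\kappa$ of $P$ adapted to $T$ is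
dualized to vectors $c(a)$, and these are corrected by elements of $P$ until the $c(a)$ and $S c(a)$
span an isotropic, $S$-stable complement of $BY$ (`exists_isotropic_frame`). If both embeddings use
the same $\kappa$, the two complements have the same pairings, so $B_1 w + c_1 u \mapsto B_2 w + c_2
u$ is symplectic and intertwines $S_1$ with $S_2$ (`exists_adapted_frame`). Every choice can be made
smoothly near a given point.

Gluing. Two symplectic isomorphisms that extend $B_2 B_1^{-1}$ differ by a map $F_1/B_1Y \to P_2$
subject to a linear symmetry condition, and commuting with the tangent structures is linear too.
Such isomorphisms therefore form an affine space, and a partition of unity may be used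
(`convexComb`).

Realization. The coordinates modulo $B_1Y$ form a cocycle, hence a vector bundle $Z$ that serves as
normal bundle of both embeddings. Successive translations in charts, in place of an exponential map,
give maps $\Phi_i : Z \to \widetilde M_i$ whose derivative along the zero section is $B_i + c_i$
(`exists_tubular_map_pair`). The inverse function theorem and a path-lifting argument
(`exists_isOpen_injOn`) make both of them diffeomorphisms on a common star-shaped neighbourhood of
the zero section, and $\psi = \Phi_2 \circ \Phi_1^{-1}$. -/

noncomputable section

namespace LagReg

/-! ### Linear algebra of a coisotropic subspace compatible with a tangent structure. -/

section LinearAlgebra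

open Module

set_option linter.unusedSectionVars false

variable {Y : Type*} [NormedAddCommGroup Y] [NormedSpace ℝ Y] [FiniteDimensional ℝ Y]
  {F : Type*} [NormedAddCommGroup F] [NormedSpace ℝ F] [FiniteDimensional ℝ F]

/-- The pointwise algebraic data of a Lagrangian coisotropic embedding: an injection `B : Y → F` into
a symplectic vector space with coisotropic image, intertwining `T` with a tangent structure `S`
for which the symplectic form is Lagrangian. -/
structure IsCoisotropicModel (B : Y →L[ℝ] F) (σ : F →L[ℝ] F →L[ℝ] ℝ) (S : F →L[ℝ] F)
    (T : Y →L[ℝ] Y) : Prop where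
  injective : Function.Injective B
  skew : ∀ ξ η, σ ξ η = -σ η ξ
  nondegenerate : ∀ ξ, (∀ η, σ ξ η = 0) → ξ = 0
  coisotropic : ∀ ξ, (∀ w, σ ξ (B w) = 0) → ∃ ζ, B ζ = ξ
  lagrangian : ∀ ξ η, σ (S ξ) η + σ ξ (S η) = 0
  range_eq_ker : ∀ ξ, (∃ η, S η = ξ) ↔ S ξ = 0
  intertwines : ∀ w, B (T w) = S (B w)
  range_eq_ker' : ∀ w, (∃ z, T z = w) ↔ T w = 0

/-- The map `ξ ↦ σ(ξ, B ·)`. -/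
def pairing (B : Y →L[ℝ] F) (σ : F →L[ℝ] F →L[ℝ] ℝ) : F →L[ℝ] (Y →L[ℝ] ℝ) :=
  ((ContinuousLinearMap.compL ℝ Y F ℝ).flip B).comp σ

omit [FiniteDimensional ℝ Y] [FiniteDimensional ℝ F] in
@[simp] lemma pairing_apply (B : Y →L[ℝ] F) (σ : F →L[ℝ] F →L[ℝ] ℝ) (ξ : F) (w : Y) :
    pairing B σ ξ w = σ ξ (B w) := rfl

lemma finrank_continuousDual : finrank ℝ (Y →L[ℝ] ℝ) = finrank ℝ Y := by
  rw [← (LinearMap.toContinuousLinearMap (𝕜 := ℝ) (E := Y) (F' := ℝ)).finrank_eq]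
  exact Subspace.dual_finrank_eq

namespace IsCoisotropicModel

variable {B : Y →L[ℝ] F} {σ : F →L[ℝ] F →L[ℝ] ℝ} {S : F →L[ℝ] F} {T : Y →L[ℝ] Y}

/-- Nondegeneracy makes `σ` an isomorphism onto the dual by a dimension count, and a functional on
`Y` extends to `F` through a left inverse of `B`. -/
lemma pairing_surjective (h : IsCoisotropicModel B σ S T) : Function.Surjective (pairing B σ) := by
  intro φ
  obtain ⟨A, hA⟩ := LinearMap.exists_leftInverse_of_injective (B : Y →ₗ[ℝ] F)
    (LinearMap.ker_eq_bot.2 h.injective)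
  have hinj : Function.Injective (σ : F →ₗ[ℝ] (F →L[ℝ] ℝ)) := by
    rw [← LinearMap.ker_eq_bot, LinearMap.ker_eq_bot']
    intro ξ hξ
    exact h.nondegenerate ξ fun η => by
      have : σ ξ = 0 := hξ
      simp [this]
  have hsurj := (LinearMap.injective_iff_surjective_of_finrank_eq_finrank
    (finrank_continuousDual (Y := F)).symm).1 hinj
  obtain ⟨ξ, hξ⟩ := hsurj (φ.comp (LinearMap.toContinuousLinearMap A))
  refine ⟨ξ, ?_⟩
  ext w
  have h1 : σ ξ = φ.comp (LinearMap.toContinuousLinearMap A) := hξ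
  have h2 : A (B w) = w := LinearMap.congr_fun hA w
  simp [h1, h2]

lemma finrank_eq (h : IsCoisotropicModel B σ S T) :
    finrank ℝ F = finrank ℝ Y + finrank ℝ (LinearMap.ker (pairing B σ : F →ₗ[ℝ] (Y →L[ℝ] ℝ))) := by
  rw [← LinearMap.finrank_range_add_finrank_ker (pairing B σ : F →ₗ[ℝ] (Y →L[ℝ] ℝ)),
    LinearMap.range_eq_top.2 h.pairing_surjective, finrank_top, finrank_continuousDual]

lemma mem_ker_pairing {ξ : F} :
    ξ ∈ LinearMap.ker (pairing B σ : F →ₗ[ℝ] (Y →L[ℝ] ℝ)) ↔ ∀ w, σ ξ (B w) = 0 := by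
  rw [LinearMap.mem_ker]
  constructor
  · intro hξ w
    exact DFunLike.congr_fun hξ w
  · intro hξ
    ext w
    exact hξ w

/-- Skew-adjointness moves `S` onto `B w`, and `S (B w) = B (T w)` is again in the image of `B`. -/
lemma map_ker_pairing (h : IsCoisotropicModel B σ S T) {ξ : F} (hξ : ∀ w, σ ξ (B w) = 0) (w : Y) :
    σ (S ξ) (B w) = 0 := by
  have := h.lagrangian ξ (B w)
  rwa [← h.intertwines, hξ, add_zero] at this

/-- The `σ`-orthogonal of the image of `B` is free over `ℝ[S]`. -/
lemma exists_eq_of_map_eq_zero (h : IsCoisotropicModel B σ S T) {ξ : F}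
    (hξ : ∀ w, σ ξ (B w) = 0) (h0 : S ξ = 0) : ∃ η, (∀ w, σ η (B w) = 0) ∧ S η = ξ := by
  -- A preimage `η₀` of `ξ` under `S` need not be orthogonal to the image of `B`. Its pairing with
  -- that image vanishes on `Im T = ker T`, so it has the form `lam ∘ T`. If `y` represents `lam`,
  -- then `σ (S y) (B w) = -lam (T w)`: adding `S y` cancels the pairing and does not change the
  -- image under `S`.
  obtain ⟨η₀, rfl⟩ := (h.range_eq_ker ξ).2 h0
  have hmem : ((pairing B σ η₀ : Y →L[ℝ] ℝ) : Y →ₗ[ℝ] ℝ) ∈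
      LinearMap.range (T : Y →ₗ[ℝ] Y).dualMap := by
    rw [LinearMap.range_dualMap_eq_dualAnnihilator_ker, Submodule.mem_dualAnnihilator]
    intro w hw
    obtain ⟨z, rfl⟩ := (h.range_eq_ker' w).2 hw
    have := h.lagrangian η₀ (B z)
    rw [hξ, zero_add] at this
    simpa [h.intertwines] using this
  obtain ⟨lam, hlam⟩ := hmem
  obtain ⟨y, hy⟩ := h.pairing_surjective (LinearMap.toContinuousLinearMap lam)
  refine ⟨η₀ + S y, fun w => ?_, ?_⟩
  · have h1 : lam (T w) = σ η₀ (B w) := LinearMap.congr_fun hlam w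
    have h2 : σ y (B (T w)) = lam (T w) := DFunLike.congr_fun hy (T w)
    have h3 := h.lagrangian y (B w)
    rw [← h.intertwines, h2, h1] at h3
    simp only [map_add, _root_.add_apply]
    linarith
  · rw [map_add, (h.range_eq_ker (S y)).1 ⟨y, rfl⟩, add_zero]

lemma ker_pairing_eq_map (h : IsCoisotropicModel B σ S T) :
    LinearMap.ker (pairing B σ : F →ₗ[ℝ] (Y →L[ℝ] ℝ)) =
      (LinearMap.ker ((pairing B σ).comp B : Y →ₗ[ℝ] (Y →L[ℝ] ℝ))).map (B : Y →ₗ[ℝ] F) := by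
  ext ξ
  rw [Submodule.mem_map]
  constructor
  · intro hξ
    obtain ⟨w, rfl⟩ := h.coisotropic ξ (mem_ker_pairing.1 hξ)
    exact ⟨w, hξ, rfl⟩
  · rintro ⟨w, hw, rfl⟩
    exact hw

/-- By coisotropy the orthogonal is the image under `B` of the kernel of the pulled-back form, so
that form alone determines the ambient dimension. -/
lemma finrank_eq_finrank (h : IsCoisotropicModel B σ S T) {F' : Type*} [NormedAddCommGroup F']
    [NormedSpace ℝ F'] [FiniteDimensional ℝ F'] {B' : Y →L[ℝ] F'} {σ' : F' →L[ℝ] F' →L[ℝ] ℝ}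
    {S' : F' →L[ℝ] F'} {T' : Y →L[ℝ] Y} (h' : IsCoisotropicModel B' σ' S' T')
    (hω : ∀ w w', σ (B w) (B w') = σ' (B' w) (B' w')) : finrank ℝ F = finrank ℝ F' := by
  have hc : (pairing B σ).comp B = (pairing B' σ').comp B' := by
    ext w w'
    exact hω w w'
  rw [h.finrank_eq, h'.finrank_eq, h.ker_pairing_eq_map, h'.ker_pairing_eq_map, hc,
    (Submodule.equivMapOfInjective _ h.injective _).finrank_eq.symm,
    (Submodule.equivMapOfInjective _ h'.injective _).finrank_eq.symm]

/-- On the orthogonal `P` the range and kernel of `S` coincide, so a complement `C` of the kernel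
gives `P = C ⊕ S C`, and `r` is the dimension of `C`. -/
lemma exists_frame (h : IsCoisotropicModel B σ S T) :
    ∃ (r : ℕ) (f : EuclideanSpace ℝ (Fin r) →L[ℝ] F), finrank ℝ F = finrank ℝ Y + (r + r) ∧
      (∀ a w, σ (f a) (B w) = 0) ∧ ∀ a b, f a + S (f b) = 0 → a = 0 ∧ b = 0 := by
  set P := LinearMap.ker (pairing B σ : F →ₗ[ℝ] (Y →L[ℝ] ℝ)) with hP
  have hmaps : ∀ x ∈ P, (S : F →ₗ[ℝ] F) x ∈ P := fun x hx =>
    mem_ker_pairing.2 (h.map_ker_pairing (mem_ker_pairing.1 hx))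
  set SP : P →ₗ[ℝ] P := (S : F →ₗ[ℝ] F).restrict hmaps with hSP
  have hrk : LinearMap.range SP = LinearMap.ker SP := by
    ext x
    constructor
    · rintro ⟨y, rfl⟩
      rw [LinearMap.mem_ker]
      ext
      exact (h.range_eq_ker (S y)).1 ⟨y, rfl⟩
    · intro hx
      have h0 : S (x : F) = 0 := congrArg Subtype.val (LinearMap.mem_ker.1 hx)
      obtain ⟨η, hη, hηx⟩ := h.exists_eq_of_map_eq_zero (mem_ker_pairing.1 x.2) h0
      exact ⟨⟨η, mem_ker_pairing.2 hη⟩, Subtype.ext hηx⟩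
  obtain ⟨C, hC⟩ := Submodule.exists_isCompl (LinearMap.ker SP)
  have hd1 := LinearMap.finrank_range_add_finrank_ker SP
  have hd2 := Submodule.finrank_add_eq_of_isCompl hC
  rw [hrk] at hd1
  let e : EuclideanSpace ℝ (Fin (finrank ℝ C)) ≃ₗ[ℝ] C :=
    LinearEquiv.ofFinrankEq _ _ (by simp)
  refine ⟨finrank ℝ C, LinearMap.toContinuousLinearMap (P.subtype ∘ₗ C.subtype ∘ₗ e.toLinearMap),
    ?_, fun a => mem_ker_pairing.1 (e a : P).2, fun a b hab => ?_⟩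
  · have hF := h.finrank_eq
    rw [← hP] at hF
    omega
  · have hab' : (e a : P) + SP (e b) = 0 := Subtype.ext hab
    have h1 : SP (e a) = 0 := by
      have := congrArg SP hab'
      rw [map_add, map_zero] at this
      have h2 : SP (SP (e b)) = 0 := by
        rw [← LinearMap.mem_ker, ← hrk]
        exact ⟨_, rfl⟩
      rwa [h2, add_zero] at this
    have key : ∀ c : C, SP c = 0 → c = 0 := fun c hc =>
      Subtype.ext (Submodule.disjoint_def.1 hC.disjoint c (LinearMap.mem_ker.2 hc) c.2)
    have h2 := key _ h1
    rw [h2] at hab'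
    have h3 := key _ (by simpa using hab')
    exact ⟨by simpa using h2, by simpa using h3⟩

end IsCoisotropicModel

end LinearAlgebra

/-! ### Smooth families of linear maps and their one-sided inverses. -/

section SmoothFamilies

open Module

variable {EN : Type*} [NormedAddCommGroup EN] [NormedSpace ℝ EN] {HN : Type*} [TopologicalSpace HN]
  {I : ModelWithCorners ℝ EN HN} {N : Type*} [TopologicalSpace N] [ChartedSpace HN N]
  {V : Type*} [NormedAddCommGroup V] [NormedSpace ℝ V]
  {W : Type*} [NormedAddCommGroup W] [NormedSpace ℝ W]
  {E' : Type*} [NormedAddCommGroup E'] [NormedSpace ℝ E'] {H' : Type*} [TopologicalSpace H']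
  {J : ModelWithCorners ℝ E' H'} {M : Type*} [TopologicalSpace M] [ChartedSpace H' M]

/-- `f` is smooth on a neighbourhood of `p`. -/
def SmoothNear (I : ModelWithCorners ℝ EN HN) (J : ModelWithCorners ℝ E' H') (f : N → M) (p : N) :
    Prop :=
  ∀ᶠ x in 𝓝 p, ContMDiffAt I J ∞ f x

lemma SmoothNear.contMDiffAt {f : N → M} {p : N} (h : SmoothNear I J f p) :
    ContMDiffAt I J ∞ f p :=
  Filter.Eventually.self_of_nhds h

lemma SmoothNear.congr {f g : N → M} {p : N} (h : SmoothNear I J f p) (hfg : g =ᶠ[𝓝 p] f) :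
    SmoothNear I J g p := by
  filter_upwards [h, hfg.eventually_nhds] with x hx hx'
  exact hx.congr_of_eventuallyEq hx'

lemma contMDiffAt_clm_of_apply [FiniteDimensional ℝ V] {f : N → (V →L[ℝ] W)} {x : N}
    (h : ∀ v, ContMDiffAt I 𝓘(ℝ, W) ∞ (fun x => f x v) x) :
    ContMDiffAt I 𝓘(ℝ, V →L[ℝ] W) ∞ f x := by
  let d := finrank ℝ V
  have hd : d = finrank ℝ (Fin d → ℝ) := (finrank_fin_fun ℝ).symm
  let e₁ := ContinuousLinearEquiv.ofFinrankEq hd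
  let e₂ := (e₁.arrowCongr (1 : W ≃L[ℝ] W)).trans (ContinuousLinearEquiv.piRing (Fin d))
  rw [← Function.id_comp f, ← e₂.symm_comp_self]
  exact e₂.symm.contDiff.contMDiff.contMDiffAt.comp x (contMDiffAt_pi_space.2 fun i => h _)

lemma SmoothNear.clm_apply {f : N → (V →L[ℝ] W)} {g : N → V} {p : N}
    (hf : SmoothNear I 𝓘(ℝ, V →L[ℝ] W) f p) (hg : SmoothNear I 𝓘(ℝ, V) g p) :
    SmoothNear I 𝓘(ℝ, W) (fun x => f x (g x)) p := by
  filter_upwards [hf, hg] with x h1 h2 using h1.clm_apply h2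

lemma SmoothNear.clm_comp {Z : Type*} [NormedAddCommGroup Z] [NormedSpace ℝ Z]
    {f : N → (V →L[ℝ] W)} {g : N → (Z →L[ℝ] V)} {p : N}
    (hf : SmoothNear I 𝓘(ℝ, V →L[ℝ] W) f p) (hg : SmoothNear I 𝓘(ℝ, Z →L[ℝ] V) g p) :
    SmoothNear I 𝓘(ℝ, Z →L[ℝ] W) (fun x => (f x).comp (g x)) p := by
  filter_upwards [hf, hg] with x h1 h2 using h1.clm_comp h2

lemma SmoothNear.add {f g : N → V} {p : N}
    (hf : SmoothNear I 𝓘(ℝ, V) f p) (hg : SmoothNear I 𝓘(ℝ, V) g p) :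
    SmoothNear I 𝓘(ℝ, V) (fun x => f x + g x) p := by
  filter_upwards [hf, hg] with x h1 h2 using h1.add h2

lemma SmoothNear.sub {f g : N → V} {p : N}
    (hf : SmoothNear I 𝓘(ℝ, V) f p) (hg : SmoothNear I 𝓘(ℝ, V) g p) :
    SmoothNear I 𝓘(ℝ, V) (fun x => f x - g x) p := by
  filter_upwards [hf, hg] with x h1 h2 using h1.sub h2

lemma SmoothNear.const {p : N} (v : M) : SmoothNear I J (fun _ : N => v) p :=
  Filter.Eventually.of_forall fun _ => contMDiffAt_const

lemma SmoothNear.clm_of_apply [FiniteDimensional ℝ V] {f : N → (V →L[ℝ] W)} {p : N}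
    (h : ∀ v, SmoothNear I 𝓘(ℝ, W) (fun x => f x v) p) :
    SmoothNear I 𝓘(ℝ, V →L[ℝ] W) f p := by
  let b := Module.finBasis ℝ V
  have h' : ∀ᶠ x in 𝓝 p, ∀ i, ContMDiffAt I 𝓘(ℝ, W) ∞ (fun x => f x (b i)) x :=
    Filter.eventually_all.2 fun i => h (b i)
  filter_upwards [h'] with x hx
  refine contMDiffAt_clm_of_apply fun v => ?_
  have : (fun x => f x v) = fun x => ∑ i, b.repr v i • f x (b i) := by
    ext x
    simp_rw [← map_smul, ← map_sum, b.sum_repr]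
  rw [this]
  exact ContMDiffAt.sum fun i _ => (contMDiffAt_const (I' := 𝓘(ℝ, ℝ))).smul (hx i)

lemma SmoothNear.ringInverse [CompleteSpace V] {C : N → (V →L[ℝ] V)} {p : N}
    (hC : SmoothNear I 𝓘(ℝ, V →L[ℝ] V) C p) (h1 : IsUnit (C p)) :
    SmoothNear I 𝓘(ℝ, V →L[ℝ] V) (fun x => Ring.inverse (C x)) p ∧ ∀ᶠ x in 𝓝 p, IsUnit (C x) := by
  have hu : ∀ᶠ x in 𝓝 p, IsUnit (C x) :=
    hC.contMDiffAt.continuousAt.eventually (Units.isOpen.mem_nhds h1)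
  refine ⟨?_, hu⟩
  filter_upwards [hC, hu] with x hx ⟨u, hu⟩
  have := contDiffAt_ringInverse (n := ∞) ℝ u
  rw [hu] at this
  exact this.contMDiffAt.comp x hx

/-- A right inverse `R₁` of `A p` is kept fixed; `A x ∘ R₁` stays invertible near `p`, and its
inverse corrects `R₁` at the other points. -/
lemma SmoothNear.exists_rightInverse [FiniteDimensional ℝ W] {A : N → (V →L[ℝ] W)}
    {p : N} (hA : SmoothNear I 𝓘(ℝ, V →L[ℝ] W) A p) (hs : Function.Surjective (A p)) :
    ∃ R : N → (W →L[ℝ] V), SmoothNear I 𝓘(ℝ, W →L[ℝ] V) R p ∧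
      ∀ᶠ x in 𝓝 p, ∀ w, A x (R x w) = w := by
  obtain ⟨R₀, hR₀⟩ := LinearMap.exists_rightInverse_of_surjective (A p : V →ₗ[ℝ] W)
    (LinearMap.range_eq_top.2 hs)
  let R₁ : W →L[ℝ] V := LinearMap.toContinuousLinearMap R₀
  have : CompleteSpace W := FiniteDimensional.complete ℝ W
  have hC : SmoothNear I 𝓘(ℝ, W →L[ℝ] W) (fun x => (A x).comp R₁) p := hA.clm_comp (.const R₁)
  have h1 : IsUnit ((A p).comp R₁) := by
    have : (A p).comp R₁ = 1 := by
      ext w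
      exact LinearMap.congr_fun hR₀ w
    rw [this]
    exact isUnit_one
  obtain ⟨hi, hu⟩ := hC.ringInverse h1
  refine ⟨fun x => R₁.comp (Ring.inverse ((A x).comp R₁)), (SmoothNear.const R₁).clm_comp hi, ?_⟩
  filter_upwards [hu] with x hx w
  exact DFunLike.congr_fun (Ring.mul_inverse_cancel _ hx) w

lemma SmoothNear.exists_leftInverse [FiniteDimensional ℝ V] [FiniteDimensional ℝ W]
    {A : N → (V →L[ℝ] W)}
    {p : N} (hA : SmoothNear I 𝓘(ℝ, V →L[ℝ] W) A p) (hs : Function.Injective (A p)) :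
    ∃ R : N → (W →L[ℝ] V), SmoothNear I 𝓘(ℝ, W →L[ℝ] V) R p ∧
      ∀ᶠ x in 𝓝 p, ∀ v, R x (A x v) = v := by
  obtain ⟨R₀, hR₀⟩ := LinearMap.exists_leftInverse_of_injective (A p : V →ₗ[ℝ] W)
    (LinearMap.ker_eq_bot.2 hs)
  let R₁ : W →L[ℝ] V := LinearMap.toContinuousLinearMap R₀
  have : CompleteSpace V := FiniteDimensional.complete ℝ V
  have hC : SmoothNear I 𝓘(ℝ, V →L[ℝ] V) (fun x => R₁.comp (A x)) p :=
    (SmoothNear.const R₁).clm_comp hA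
  have h1 : IsUnit (R₁.comp (A p)) := by
    have : R₁.comp (A p) = 1 := by
      ext w
      exact LinearMap.congr_fun hR₀ w
    rw [this]
    exact isUnit_one
  obtain ⟨hi, hu⟩ := hC.ringInverse h1
  refine ⟨fun x => (Ring.inverse (R₁.comp (A x))).comp R₁, hi.clm_comp (.const R₁), ?_⟩
  filter_upwards [hu] with x hx w
  exact DFunLike.congr_fun (Ring.inverse_mul_cancel _ hx) w

end SmoothFamilies

/-! ### Smooth local frames: the characteristic distribution and isotropic complements. -/

section LocalFrames

open Module

set_option linter.unusedSectionVars false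

variable {EN : Type*} [NormedAddCommGroup EN] [NormedSpace ℝ EN] {HN : Type*} [TopologicalSpace HN]
  {I : ModelWithCorners ℝ EN HN} {N : Type*} [TopologicalSpace N] [ChartedSpace HN N]
  {Y : Type*} [NormedAddCommGroup Y] [NormedSpace ℝ Y] [FiniteDimensional ℝ Y]
  {F : Type*} [NormedAddCommGroup F] [NormedSpace ℝ F] [FiniteDimensional ℝ F]
  {F' : Type*} [NormedAddCommGroup F'] [NormedSpace ℝ F'] [FiniteDimensional ℝ F']
  {G : Type*} [NormedAddCommGroup G] [NormedSpace ℝ G] [FiniteDimensional ℝ G]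

lemma IsCoisotropicModel.self_eq_zero {B : Y →L[ℝ] F} {σ : F →L[ℝ] F →L[ℝ] ℝ} {S : F →L[ℝ] F}
    {T : Y →L[ℝ] Y} (h : IsCoisotropicModel B σ S T) (ξ : F) : S (S ξ) = 0 :=
  (h.range_eq_ker _).1 ⟨ξ, rfl⟩

lemma IsCoisotropicModel.skew_self {B : Y →L[ℝ] F} {σ : F →L[ℝ] F →L[ℝ] ℝ} {S : F →L[ℝ] F}
    {T : Y →L[ℝ] Y} (h : IsCoisotropicModel B σ S T) (ξ η : F) : σ (S ξ) η = σ (S η) ξ := by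
  have := h.lagrangian ξ η
  rw [h.skew ξ (S η)] at this
  linarith

/-- Smooth frames of the characteristic distribution of the form `σ(B ·, B ·)`, adapted to `T`. -/
lemma exists_characteristic_frame {p : N} {B : N → (Y →L[ℝ] F)} {σ : N → (F →L[ℝ] F →L[ℝ] ℝ)}
    {S : N → (F →L[ℝ] F)} {T : N → (Y →L[ℝ] Y)}
    (hB : SmoothNear I 𝓘(ℝ, Y →L[ℝ] F) B p)
    (hσ : SmoothNear I 𝓘(ℝ, F →L[ℝ] F →L[ℝ] ℝ) σ p)
    (hS : SmoothNear I 𝓘(ℝ, F →L[ℝ] F) S p)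
    (h : ∀ᶠ x in 𝓝 p, IsCoisotropicModel (B x) (σ x) (S x) (T x)) :
    ∃ (r : ℕ) (κ : N → (EuclideanSpace ℝ (Fin r) × EuclideanSpace ℝ (Fin r) →L[ℝ] Y))
      (Λ : N → (Y →L[ℝ] EuclideanSpace ℝ (Fin r) × EuclideanSpace ℝ (Fin r))),
      finrank ℝ F = finrank ℝ Y + (r + r) ∧
      SmoothNear I 𝓘(ℝ, EuclideanSpace ℝ (Fin r) × EuclideanSpace ℝ (Fin r) →L[ℝ] Y) κ p ∧
      SmoothNear I 𝓘(ℝ, Y →L[ℝ] EuclideanSpace ℝ (Fin r) × EuclideanSpace ℝ (Fin r)) Λ p ∧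
      (∀ᶠ x in 𝓝 p, ∀ u, Λ x (κ x u) = u) ∧
      (∀ᶠ x in 𝓝 p, ∀ u w, σ x (B x (κ x u)) (B x w) = 0) ∧
      (∀ᶠ x in 𝓝 p, ∀ a b, T x (κ x (a, b)) = κ x (0, a)) := by
  have hp := h.self_of_nhds
  obtain ⟨r, f, hr, hf, hfi⟩ := hp.exists_frame
  obtain ⟨L, hL, hLB⟩ := hB.exists_leftInverse hp.injective
  have hpair : SmoothNear I 𝓘(ℝ, F →L[ℝ] (Y →L[ℝ] ℝ)) (fun x => pairing (B x) (σ x)) p :=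
    SmoothNear.clm_of_apply fun ξ => SmoothNear.clm_of_apply fun w =>
      (hσ.clm_apply (.const ξ)).clm_apply (hB.clm_apply (.const w))
  obtain ⟨R, hR, hRB⟩ := hpair.exists_rightInverse hp.pairing_surjective
  -- Away from `p` the vectors `f a` leave the orthogonal, and subtracting a solution of the pairing
  -- equation puts them back. At `p` the correction is zero, so independence there is inherited from
  -- `f`.
  let ξ : N → (EuclideanSpace ℝ (Fin r) →L[ℝ] F) := fun x =>
    f - (R x).comp ((pairing (B x) (σ x)).comp f)
  have hξ : SmoothNear I 𝓘(ℝ, EuclideanSpace ℝ (Fin r) →L[ℝ] F) ξ p :=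
    (SmoothNear.const f).sub (hR.clm_comp (hpair.clm_comp (.const f)))
  have hξP : ∀ᶠ x in 𝓝 p, ∀ a w, σ x (ξ x a) (B x w) = 0 := by
    filter_upwards [hRB] with x hx a w
    rw [← pairing_apply]
    simp [ξ, hx]
  let κ₀ : N → (EuclideanSpace ℝ (Fin r) →L[ℝ] Y) := fun x => (L x).comp (ξ x)
  have hκ₀ : SmoothNear I 𝓘(ℝ, EuclideanSpace ℝ (Fin r) →L[ℝ] Y) κ₀ p := hL.clm_comp hξ
  have hBκ₀ : ∀ᶠ x in 𝓝 p, ∀ a, B x (κ₀ x a) = ξ x a := by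
    filter_upwards [h, hξP, hLB] with x hx hx1 hx2 a
    obtain ⟨ζ, hζ⟩ := hx.coisotropic _ (hx1 a)
    simp only [κ₀, ContinuousLinearMap.comp_apply]
    rw [← hζ, hx2]
  -- This writes `T` as the smooth expression `L ∘ S ∘ B`, which is how it enters the definition of
  -- `κ`.
  have hTL : ∀ᶠ x in 𝓝 p, ∀ w, L x (S x (B x w)) = T x w := by
    filter_upwards [h, hLB] with x hx hx2 w
    rw [← hx.intertwines, hx2]
  let κ : N → (EuclideanSpace ℝ (Fin r) × EuclideanSpace ℝ (Fin r) →L[ℝ] Y) := fun x =>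
    (κ₀ x).comp (ContinuousLinearMap.fst ℝ _ _) +
      ((L x).comp ((S x).comp ((B x).comp (κ₀ x)))).comp (ContinuousLinearMap.snd ℝ _ _)
  have hκ : SmoothNear I 𝓘(ℝ, EuclideanSpace ℝ (Fin r) × EuclideanSpace ℝ (Fin r) →L[ℝ] Y) κ p :=
    (hκ₀.clm_comp (.const _)).add
      ((hL.clm_comp (hS.clm_comp (hB.clm_comp hκ₀))).clm_comp (.const _))
  have hκapply : ∀ᶠ x in 𝓝 p, ∀ a b, κ x (a, b) = κ₀ x a + T x (κ₀ x b) := by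
    filter_upwards [hTL] with x hx a b
    simp [κ, hx]
  have hBκ : ∀ᶠ x in 𝓝 p, ∀ a b, B x (κ x (a, b)) = ξ x a + S x (ξ x b) := by
    filter_upwards [hκapply, h, hBκ₀] with x hx hx1 hx2 a b
    rw [hx, map_add, hx1.intertwines, hx2, hx2]
  have hκi : Function.Injective (κ p) := by
    rw [injective_iff_map_eq_zero]
    rintro ⟨a, b⟩ hab
    have h1 := hBκ.self_of_nhds a b
    have hξp : ∀ c, ξ p c = f c := fun c => by
      have : pairing (B p) (σ p) (f c) = 0 := by
        ext w
        exact hf c w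
      simp [ξ, this]
    rw [hab, map_zero, hξp, hξp] at h1
    obtain ⟨rfl, rfl⟩ := hfi a b h1.symm
    rfl
  obtain ⟨Λ, hΛ, hΛκ⟩ := hκ.exists_leftInverse hκi
  refine ⟨r, κ, Λ, hr, hκ, hΛ, hΛκ, ?_, ?_⟩
  · filter_upwards [hBκ, hξP, h] with x hx hx1 hx2
    rintro ⟨a, b⟩ w
    rw [hx, map_add, _root_.add_apply, hx1, hx2.map_ker_pairing (hx1 b), add_zero]
  · filter_upwards [hκapply, h] with x hx hx2 a b
    have h0 : T x (T x (κ₀ x b)) = 0 := (hx2.range_eq_ker' _).1 ⟨_, rfl⟩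
    rw [hx, hx, map_add, h0, map_zero, add_zero, zero_add]

/-- Vector fields `c a` along `B` spanning, together with `S (c a)`, an isotropic complement of the
range of `B`, with prescribed pairing with the range of `B`. -/
lemma exists_isotropic_frame {r : ℕ} {p : N} {B : N → (Y →L[ℝ] F)}
    {σ : N → (F →L[ℝ] F →L[ℝ] ℝ)} {S : N → (F →L[ℝ] F)} {T : N → (Y →L[ℝ] Y)}
    (hB : SmoothNear I 𝓘(ℝ, Y →L[ℝ] F) B p)
    (hσ : SmoothNear I 𝓘(ℝ, F →L[ℝ] F →L[ℝ] ℝ) σ p)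
    (hS : SmoothNear I 𝓘(ℝ, F →L[ℝ] F) S p)
    (h : ∀ᶠ x in 𝓝 p, IsCoisotropicModel (B x) (σ x) (S x) (T x))
    {κ : N → (EuclideanSpace ℝ (Fin r) × EuclideanSpace ℝ (Fin r) →L[ℝ] Y)}
    {Λ : N → (Y →L[ℝ] EuclideanSpace ℝ (Fin r) × EuclideanSpace ℝ (Fin r))}
    (hκ : SmoothNear I 𝓘(ℝ, EuclideanSpace ℝ (Fin r) × EuclideanSpace ℝ (Fin r) →L[ℝ] Y) κ p)
    (hΛ : SmoothNear I 𝓘(ℝ, Y →L[ℝ] EuclideanSpace ℝ (Fin r) × EuclideanSpace ℝ (Fin r)) Λ p)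
    (hΛκ : ∀ᶠ x in 𝓝 p, ∀ u, Λ x (κ x u) = u)
    (hκσ : ∀ᶠ x in 𝓝 p, ∀ u w, σ x (B x (κ x u)) (B x w) = 0)
    (hTκ : ∀ᶠ x in 𝓝 p, ∀ a b, T x (κ x (a, b)) = κ x (0, a)) :
    ∃ c : N → (EuclideanSpace ℝ (Fin r) →L[ℝ] F),
      SmoothNear I 𝓘(ℝ, EuclideanSpace ℝ (Fin r) →L[ℝ] F) c p ∧
      ∀ᶠ x in 𝓝 p, (∀ a w, σ x (c x a) (B x w) = inner ℝ a (Λ x w).2) ∧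
        (∀ a a', σ x (c x a) (c x a') = 0) ∧ ∀ a a', σ x (c x a) (S x (c x a')) = 0 := by
  have hp := h.self_of_nhds
  have hpair : SmoothNear I 𝓘(ℝ, F →L[ℝ] (Y →L[ℝ] ℝ)) (fun x => pairing (B x) (σ x)) p :=
    SmoothNear.clm_of_apply fun ξ => SmoothNear.clm_of_apply fun w =>
      (hσ.clm_apply (.const ξ)).clm_apply (hB.clm_apply (.const w))
  obtain ⟨R, hR, hRB⟩ := hpair.exists_rightInverse hp.pairing_surjective
  -- The functional `μ x a` reads the second coordinate in the frame `κ`, so the vectors `c' a` are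
  -- dual to `κ (0, ·)`, the half of the frame in the image of `T`.
  let μ : N → (EuclideanSpace ℝ (Fin r) →L[ℝ] (Y →L[ℝ] ℝ)) := fun x =>
    ((ContinuousLinearMap.compL ℝ Y (EuclideanSpace ℝ (Fin r)) ℝ).flip
      ((ContinuousLinearMap.snd ℝ _ _).comp (Λ x))).comp (innerSL ℝ)
  have hμ : SmoothNear I 𝓘(ℝ, EuclideanSpace ℝ (Fin r) →L[ℝ] (Y →L[ℝ] ℝ)) μ p :=
    SmoothNear.clm_of_apply fun a => SmoothNear.clm_of_apply fun w =>
      (SmoothNear.const (innerSL ℝ a)).clm_apply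
        ((SmoothNear.const (ContinuousLinearMap.snd ℝ (EuclideanSpace ℝ (Fin r))
          (EuclideanSpace ℝ (Fin r)))).clm_apply (hΛ.clm_apply (.const w)))
  let c' : N → (EuclideanSpace ℝ (Fin r) →L[ℝ] F) := fun x => (R x).comp (μ x)
  have hc' : SmoothNear I 𝓘(ℝ, EuclideanSpace ℝ (Fin r) →L[ℝ] F) c' p := hR.clm_comp hμ
  have hc'B : ∀ᶠ x in 𝓝 p, ∀ a w, σ x (c' x a) (B x w) = inner ℝ a (Λ x w).2 := by
    filter_upwards [hRB] with x hx a w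
    rw [← pairing_apply]
    simp [c', hx, μ]
  obtain ⟨ρ, hρ⟩ : ∃ ρ : (EuclideanSpace ℝ (Fin r) →L[ℝ] ℝ) →L[ℝ] EuclideanSpace ℝ (Fin r),
      ∀ φ a, inner ℝ a (ρ φ) = φ a := by
    refine ⟨LinearMap.toContinuousLinearMap
      { toFun := (InnerProductSpace.toDual ℝ (EuclideanSpace ℝ (Fin r))).symm
        map_add' := map_add _
        map_smul' := fun t φ => by simp }, fun φ a => ?_⟩
    rw [real_inner_comm]
    exact InnerProductSpace.toDual_symm_apply
  let s : N → (EuclideanSpace ℝ (Fin r) →L[ℝ] EuclideanSpace ℝ (Fin r) →L[ℝ] ℝ) := fun x =>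
    pairing (c' x) ((σ x)) |>.comp (c' x)
  let m : N → (EuclideanSpace ℝ (Fin r) →L[ℝ] EuclideanSpace ℝ (Fin r) →L[ℝ] ℝ) := fun x =>
    pairing ((S x).comp (c' x)) ((σ x)) |>.comp (c' x)
  have hs : SmoothNear I 𝓘(ℝ, EuclideanSpace ℝ (Fin r) →L[ℝ] EuclideanSpace ℝ (Fin r) →L[ℝ] ℝ)
      s p := SmoothNear.clm_of_apply fun a => SmoothNear.clm_of_apply fun a' =>
    (hσ.clm_apply (hc'.clm_apply (.const a))).clm_apply (hc'.clm_apply (.const a'))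
  have hm : SmoothNear I 𝓘(ℝ, EuclideanSpace ℝ (Fin r) →L[ℝ] EuclideanSpace ℝ (Fin r) →L[ℝ] ℝ)
      m p := SmoothNear.clm_of_apply fun a => SmoothNear.clm_of_apply fun a' =>
    (hσ.clm_apply (hc'.clm_apply (.const a))).clm_apply
      (hS.clm_apply (hc'.clm_apply (.const a')))
  -- The correction `B (κ (A a))` lies in the orthogonal, so it keeps the pairing with the image of
  -- `B`. It enters `s` and `m` once per argument, and the two contributions are equal because `s`
  -- is skew and `m` is symmetric; hence the factors `1 / 2`. The second component of `A` removes
  -- `s`. The first removes `m`, since `S` carries `κ (a, b)` to `κ (0, a)`.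
  let A : N → (EuclideanSpace ℝ (Fin r) →L[ℝ]
      EuclideanSpace ℝ (Fin r) × EuclideanSpace ℝ (Fin r)) := fun x =>
    ((ContinuousLinearMap.inl ℝ _ _).comp ((-(1 / 2 : ℝ)) • ρ)).comp (m x) +
      ((ContinuousLinearMap.inr ℝ _ _).comp ((1 / 2 : ℝ) • ρ)).comp (s x)
  have hA : SmoothNear I 𝓘(ℝ, EuclideanSpace ℝ (Fin r) →L[ℝ]
      EuclideanSpace ℝ (Fin r) × EuclideanSpace ℝ (Fin r)) A p :=
    ((SmoothNear.const _).clm_comp hm).add ((SmoothNear.const _).clm_comp hs)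
  have hA1 : ∀ x a a', inner ℝ a' (A x a).1 = -(1 / 2 : ℝ) * σ x (c' x a) (S x (c' x a')) := by
    intro x a a'
    simp [A, inner_smul_right, hρ, m]
  have hA2 : ∀ x a a', inner ℝ a' (A x a).2 = (1 / 2 : ℝ) * σ x (c' x a) (c' x a') := by
    intro x a a'
    simp [A, inner_smul_right, hρ, s]
  refine ⟨fun x => c' x + (B x).comp ((κ x).comp (A x)), hc'.add (hB.clm_comp (hκ.clm_comp hA)), ?_⟩
  filter_upwards [h, hΛκ, hκσ, hTκ, hc'B] with x hx hx1 hx2 hx3 hx4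
  have hKc : ∀ u a, σ x (B x (κ x u)) (c' x a) = -inner ℝ a u.2 := fun u a => by
    rw [hx.skew, hx4, hx1]
  have hSK : ∀ u, S x (B x (κ x u)) = B x (κ x (0, u.1)) := fun u => by
    rw [← hx.intertwines, ← hx3 u.1 u.2]
  refine ⟨fun a w => ?_, fun a a' => ?_, fun a a' => ?_⟩
  · simp [hx2, hx4]
  · simp only [_root_.add_apply, ContinuousLinearMap.comp_apply, map_add, hx2, hx4, hx1, hKc, hA2]
    rw [hx.skew (c' x a') (c' x a)]
    ring
  · have h1 : σ x (B x (κ x (A x a))) (S x (c' x a')) = inner ℝ a' (A x a).1 := by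
      have := hx.lagrangian (B x (κ x (A x a))) (c' x a')
      rw [hSK, hKc] at this
      linarith
    have h2 : σ x (c' x a') (S x (c' x a)) = σ x (c' x a) (S x (c' x a')) := by
      have e1 := hx.lagrangian (c' x a') (c' x a)
      rw [hx.skew_self (c' x a') (c' x a)] at e1
      have e2 := hx.lagrangian (c' x a) (c' x a')
      linarith
    simp only [_root_.add_apply, ContinuousLinearMap.comp_apply, map_add, hSK, hx2, hx4, hx1, h1,
      hA1, h2]
    ring

/-- Complementary frames `c₁`, `c₂` of two coisotropic models over the same base, corresponding to
each other under an isomorphism of the ambient spaces, together with the coordinates `Θ` modulo the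
range of `B₁`. -/
structure IsAdaptedFrame (B₁ : Y →L[ℝ] F) (σ₁ : F →L[ℝ] F →L[ℝ] ℝ) (S₁ : F →L[ℝ] F)
    (B₂ : Y →L[ℝ] F') (σ₂ : F' →L[ℝ] F' →L[ℝ] ℝ) (S₂ : F' →L[ℝ] F')
    (c₁ : G →L[ℝ] F) (c₂ : G →L[ℝ] F') (Θ : F →L[ℝ] G) : Prop where
  coord_frame : ∀ u, Θ (c₁ u) = u
  coord_eq_zero : ∀ ξ, Θ ξ = 0 ↔ ∃ w, B₁ w = ξ
  pairing_eq : ∀ u w, σ₁ (c₁ u) (B₁ w) = σ₂ (c₂ u) (B₂ w)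
  form_eq : ∀ u u', σ₁ (c₁ u) (c₁ u') = σ₂ (c₂ u) (c₂ u')
  endo_eq : ∀ u, ∃ u', S₁ (c₁ u) = c₁ u' ∧ S₂ (c₂ u) = c₂ u'

/-- Both frames come from the same `κ` and `Λ`. Their pairings with the images of `B₁` and `B₂` are
then one and the same expression in `Λ` and `T`, and the remaining entries vanish on both sides by
isotropy. -/
theorem exists_adapted_frame {p : N}
    {B₁ : N → (Y →L[ℝ] F)} {σ₁ : N → (F →L[ℝ] F →L[ℝ] ℝ)} {S₁ : N → (F →L[ℝ] F)}
    {B₂ : N → (Y →L[ℝ] F')} {σ₂ : N → (F' →L[ℝ] F' →L[ℝ] ℝ)} {S₂ : N → (F' →L[ℝ] F')}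
    {T : N → (Y →L[ℝ] Y)}
    (hB₁ : SmoothNear I 𝓘(ℝ, Y →L[ℝ] F) B₁ p)
    (hσ₁ : SmoothNear I 𝓘(ℝ, F →L[ℝ] F →L[ℝ] ℝ) σ₁ p)
    (hS₁ : SmoothNear I 𝓘(ℝ, F →L[ℝ] F) S₁ p)
    (h₁ : ∀ᶠ x in 𝓝 p, IsCoisotropicModel (B₁ x) (σ₁ x) (S₁ x) (T x))
    (hB₂ : SmoothNear I 𝓘(ℝ, Y →L[ℝ] F') B₂ p)
    (hσ₂ : SmoothNear I 𝓘(ℝ, F' →L[ℝ] F' →L[ℝ] ℝ) σ₂ p)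
    (hS₂ : SmoothNear I 𝓘(ℝ, F' →L[ℝ] F') S₂ p)
    (h₂ : ∀ᶠ x in 𝓝 p, IsCoisotropicModel (B₂ x) (σ₂ x) (S₂ x) (T x))
    (hω : ∀ᶠ x in 𝓝 p, ∀ w w', σ₁ x (B₁ x w) (B₁ x w') = σ₂ x (B₂ x w) (B₂ x w'))
    (hG : finrank ℝ F = finrank ℝ Y + finrank ℝ G) :
    ∃ (c₁ : N → (G →L[ℝ] F)) (c₂ : N → (G →L[ℝ] F')) (Θ : N → (F →L[ℝ] G)),
      SmoothNear I 𝓘(ℝ, G →L[ℝ] F) c₁ p ∧ SmoothNear I 𝓘(ℝ, G →L[ℝ] F') c₂ p ∧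
      SmoothNear I 𝓘(ℝ, F →L[ℝ] G) Θ p ∧
      ∀ᶠ x in 𝓝 p, IsAdaptedFrame (B₁ x) (σ₁ x) (S₁ x) (B₂ x) (σ₂ x) (S₂ x)
        (c₁ x) (c₂ x) (Θ x) := by
  obtain ⟨r, κ, Λ, hr, hκ, hΛ, hΛκ, hκσ, hTκ⟩ := exists_characteristic_frame hB₁ hσ₁ hS₁ h₁
  have hκσ₂ : ∀ᶠ x in 𝓝 p, ∀ u w, σ₂ x (B₂ x (κ x u)) (B₂ x w) = 0 := by
    filter_upwards [hκσ, hω] with x hx hx1 u w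
    rw [← hx1, hx]
  obtain ⟨c₁, hc₁, hc₁'⟩ := exists_isotropic_frame hB₁ hσ₁ hS₁ h₁ hκ hΛ hΛκ hκσ hTκ
  obtain ⟨c₂, hc₂, hc₂'⟩ := exists_isotropic_frame hB₂ hσ₂ hS₂ h₂ hκ hΛ hΛκ hκσ₂ hTκ
  let e : G ≃L[ℝ] EuclideanSpace ℝ (Fin r) × EuclideanSpace ℝ (Fin r) :=
    ContinuousLinearEquiv.ofFinrankEq (by rw [finrank_prod, finrank_euclideanSpace_fin]; omega)
  let e' : G →L[ℝ] EuclideanSpace ℝ (Fin r) × EuclideanSpace ℝ (Fin r) := e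
  let πa : G →L[ℝ] EuclideanSpace ℝ (Fin r) := (ContinuousLinearMap.fst ℝ _ _).comp e'
  let πb : G →L[ℝ] EuclideanSpace ℝ (Fin r) := (ContinuousLinearMap.snd ℝ _ _).comp e'
  let C₁ : N → (G →L[ℝ] F) := fun x => (c₁ x).comp πa + (S₁ x).comp ((c₁ x).comp πb)
  let C₂ : N → (G →L[ℝ] F') := fun x => (c₂ x).comp πa + (S₂ x).comp ((c₂ x).comp πb)
  have hC₁ : SmoothNear I 𝓘(ℝ, G →L[ℝ] F) C₁ p :=
    (hc₁.clm_comp (.const _)).add (hS₁.clm_comp (hc₁.clm_comp (.const _)))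
  have hC₂ : SmoothNear I 𝓘(ℝ, G →L[ℝ] F') C₂ p :=
    (hc₂.clm_comp (.const _)).add (hS₂.clm_comp (hc₂.clm_comp (.const _)))
  have hCB₁ : ∀ᶠ x in 𝓝 p, ∀ u w, σ₁ x (C₁ x u) (B₁ x w) =
      inner ℝ (πa u) (Λ x w).2 - inner ℝ (πb u) (Λ x (T x w)).2 := by
    filter_upwards [hc₁', h₁] with x hx hx1 u w
    have := hx1.lagrangian (c₁ x (πb u)) (B₁ x w)
    rw [← hx1.intertwines, hx.1] at this
    simp only [C₁, _root_.add_apply, ContinuousLinearMap.comp_apply, map_add, hx.1]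
    linarith
  have hCB₂ : ∀ᶠ x in 𝓝 p, ∀ u w, σ₂ x (C₂ x u) (B₂ x w) =
      inner ℝ (πa u) (Λ x w).2 - inner ℝ (πb u) (Λ x (T x w)).2 := by
    filter_upwards [hc₂', h₂] with x hx hx1 u w
    have := hx1.lagrangian (c₂ x (πb u)) (B₂ x w)
    rw [← hx1.intertwines, hx.1] at this
    simp only [C₂, _root_.add_apply, ContinuousLinearMap.comp_apply, map_add, hx.1]
    linarith
  have hCC₁ : ∀ᶠ x in 𝓝 p, ∀ u u', σ₁ x (C₁ x u) (C₁ x u') = 0 := by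
    filter_upwards [hc₁', h₁] with x hx hx1 u u'
    have e1 := hx1.lagrangian (c₁ x (πb u)) (c₁ x (πa u'))
    have e2 := hx1.lagrangian (c₁ x (πb u)) (S₁ x (c₁ x (πb u')))
    rw [hx1.self_eq_zero, map_zero, add_zero] at e2
    rw [hx.2.2, add_zero] at e1
    simp [C₁, hx.2.1, hx.2.2, e1, e2]
  have hCC₂ : ∀ᶠ x in 𝓝 p, ∀ u u', σ₂ x (C₂ x u) (C₂ x u') = 0 := by
    filter_upwards [hc₂', h₂] with x hx hx1 u u'
    have e1 := hx1.lagrangian (c₂ x (πb u)) (c₂ x (πa u'))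
    have e2 := hx1.lagrangian (c₂ x (πb u)) (S₂ x (c₂ x (πb u')))
    rw [hx1.self_eq_zero, map_zero, add_zero] at e2
    rw [hx.2.2, add_zero] at e1
    simp [C₂, hx.2.1, hx.2.2, e1, e2]
  -- `D` is the splitting of `F` into the image of `B₁` and the complement; `Θ` will be the second
  -- component of its inverse.
  let D : N → (Y × G →L[ℝ] F) := fun x =>
    (B₁ x).comp (ContinuousLinearMap.fst ℝ Y G) + (C₁ x).comp (ContinuousLinearMap.snd ℝ Y G)
  have hD : SmoothNear I 𝓘(ℝ, Y × G →L[ℝ] F) D p :=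
    (hB₁.clm_comp (.const _)).add (hC₁.clm_comp (.const _))
  have hDdim : finrank ℝ (Y × G) = finrank ℝ F := by rw [finrank_prod, hG]
  have hDs : Function.Surjective (D p) := by
    refine (LinearMap.injective_iff_surjective_of_finrank_eq_finrank
      (f := (D p : Y × G →ₗ[ℝ] F)) hDdim).1 ?_
    rw [← LinearMap.ker_eq_bot, LinearMap.ker_eq_bot']
    rintro ⟨w, u⟩ hwu
    have h0 : B₁ p w + C₁ p u = 0 := hwu
    -- Pairing the relation with `B₁ (κ (a, b))`, which is orthogonal to `B₁ w`, leaves only the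
    -- coordinates of `u`.
    have h1 : ∀ a b, inner ℝ (πa u) b - inner ℝ (πb u) a = 0 := by
      intro a b
      rw [← hκσ.self_of_nhds (a, b) w, h₁.self_of_nhds.skew,
        eq_neg_of_add_eq_zero_left h0]
      have := hCB₁.self_of_nhds u (κ p (a, b))
      rw [hTκ.self_of_nhds, hΛκ.self_of_nhds, hΛκ.self_of_nhds] at this
      rw [map_neg, _root_.neg_apply, neg_neg, this]
    have ha : πa u = 0 := by
      have := h1 0 (πa u)
      rwa [inner_zero_right, sub_zero, inner_self_eq_zero] at this
    have hb : πb u = 0 := by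
      have := h1 (πb u) 0
      rwa [inner_zero_right, zero_sub, neg_eq_zero, inner_self_eq_zero] at this
    have hu : u = 0 := e.injective (by rw [map_zero]; exact Prod.ext ha hb)
    rw [hu, map_zero, add_zero] at h0
    have hw : w = 0 := h₁.self_of_nhds.injective (by rw [h0, map_zero])
    rw [hu, hw]
    rfl
  obtain ⟨R, hR, hRD⟩ := hD.exists_rightInverse hDs
  refine ⟨C₁, C₂, fun x => (ContinuousLinearMap.snd ℝ Y G).comp (R x), hC₁, hC₂,
    (SmoothNear.const _).clm_comp hR, ?_⟩
  filter_upwards [h₁, h₂, hCB₁, hCB₂, hCC₁, hCC₂, hRD] with x hx₁ hx₂ hb₁ hb₂ hf₁ hf₂ hR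
  have hinj : Function.Injective (D x) :=
    (LinearMap.injective_iff_surjective_of_finrank_eq_finrank
      (f := (D x : Y × G →ₗ[ℝ] F)) hDdim).2 fun ξ => ⟨R x ξ, hR ξ⟩
  have hRD' : ∀ z, R x (D x z) = z := fun z => hinj (hR _)
  have hDx : ∀ w u, D x (w, u) = B₁ x w + C₁ x u := fun w u => rfl
  -- Since `S² = 0`, the endomorphism acts on the coordinates of both complements by `(a, b) ↦ (0,
  -- a)`; this gives the last witness.
  refine ⟨fun u => ?_, fun ξ => ⟨fun h0 => ⟨(R x ξ).1, ?_⟩, ?_⟩, fun u w => ?_, fun u u' => ?_,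
    fun u => ⟨e.symm (0, πa u), ?_, ?_⟩⟩
  · have := hRD' (0, u)
    rw [hDx, map_zero, zero_add] at this
    simp [this]
  · have h1 := hR ξ
    rw [← Prod.mk.eta (p := R x ξ), hDx] at h1
    have h2 : (R x ξ).2 = 0 := h0
    rwa [h2, map_zero, add_zero] at h1
  · rintro ⟨w, rfl⟩
    have := hRD' (w, 0)
    rw [hDx, map_zero, add_zero] at this
    simp [this]
  · rw [hb₁, hb₂]
  · rw [hf₁, hf₂]
  · simp [C₁, πa, πb, e', hx₁.self_eq_zero]
  · simp [C₂, πa, πb, e', hx₂.self_eq_zero]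

end LocalFrames

/-! ### Passage between tangent spaces and chart coordinates. -/

section Coordinates

open Module

set_option linter.unusedSectionVars false

variable {Y : Type*} [NormedAddCommGroup Y] [NormedSpace ℝ Y]
  {F : Type*} [NormedAddCommGroup F] [NormedSpace ℝ F]
  {F' : Type*} [NormedAddCommGroup F'] [NormedSpace ℝ F']
  {G : Type*} [NormedAddCommGroup G] [NormedSpace ℝ G]

lemma update_pair_zero {V : Type*} (a c x : V) : Function.update ![a, c] 0 x = ![x, c] := by
  ext i
  fin_cases i <;> rfl

lemma update_pair_one {V : Type*} (a c x : V) : Function.update ![a, c] 1 x = ![a, x] := by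
  ext i
  fin_cases i <;> rfl

/-- An alternating 2-form as a continuous bilinear map. -/
def bilin [FiniteDimensional ℝ F] (α : F [⋀^Fin 2]→L[ℝ] ℝ) : F →L[ℝ] F →L[ℝ] ℝ :=
  LinearMap.toContinuousLinearMap
    ((LinearMap.toContinuousLinearMap : (F →ₗ[ℝ] ℝ) ≃ₗ[ℝ] _).toLinearMap ∘ₗ
    LinearMap.mk₂ ℝ (fun ξ η => α ![ξ, η])
      (fun a b c => by
        simpa only [update_pair_zero] using α.map_update_add ![a, c] 0 a b)
      (fun a b c => by
        simpa only [update_pair_zero] using α.map_update_smul ![b, c] 0 a b)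
      (fun a b c => by
        simpa only [update_pair_one] using α.map_update_add ![a, c] 1 b c)
      (fun a b c => by
        simpa only [update_pair_one] using α.map_update_smul ![b, c] 1 a c))

lemma bilin_skew [FiniteDimensional ℝ F] (α : F [⋀^Fin 2]→L[ℝ] ℝ) (a b : F) :
    bilin α a b = -bilin α b a := by
  have h := α.map_swap ![b, a] (i := 0) (j := 1) (by decide)
  have h' : ![b, a] ∘ Equiv.swap (0 : Fin 2) 1 = ![a, b] := by
    ext i
    fin_cases i <;> rfl
  rw [h'] at h
  exact h

/-- Used to read the model in trivializations of the tangent bundles, where nearby points share the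
same vector spaces and smooth dependence makes sense. -/
lemma IsCoisotropicModel.conj {B : Y →L[ℝ] F} {σ : F →L[ℝ] F →L[ℝ] ℝ} {S : F →L[ℝ] F}
    {T : Y →L[ℝ] Y} (h : IsCoisotropicModel B σ S T) {P P' : F →L[ℝ] F} {Q Q' : Y →L[ℝ] Y}
    (hP : ∀ ξ, P (P' ξ) = ξ) (hP' : ∀ ξ, P' (P ξ) = ξ) (hQ : ∀ ξ, Q (Q' ξ) = ξ)
    (hQ' : ∀ ξ, Q' (Q ξ) = ξ) :
    IsCoisotropicModel (P.comp (B.comp Q')) ((pairing P' σ).comp P') (P.comp (S.comp P'))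
      (Q.comp (T.comp Q')) where
  injective w w' hw := by
    have h1 := h.injective (Function.LeftInverse.injective hP' hw)
    exact Function.LeftInverse.injective hQ h1
  skew ξ η := h.skew _ _
  nondegenerate ξ hξ := by
    have h0 : P' ξ = 0 := h.nondegenerate _ fun η => by
      have := hξ (P η)
      simpa [hP'] using this
    rw [← hP ξ, h0, map_zero]
  coisotropic ξ hξ := by
    obtain ⟨ζ, hζ⟩ := h.coisotropic (P' ξ) fun w => by
      have := hξ (Q w)
      simpa [hP', hQ'] using this
    exact ⟨Q ζ, by simp [hQ', hζ, hP]⟩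
  lagrangian ξ η := by simpa [hP'] using h.lagrangian (P' ξ) (P' η)
  range_eq_ker ξ := by
    constructor
    · rintro ⟨η, rfl⟩
      simp [hP', (h.range_eq_ker _).1 ⟨_, rfl⟩]
    · intro h0
      have h1 : S (P' ξ) = 0 := by
        have := congrArg P' h0
        simpa [hP'] using this
      obtain ⟨η, hη⟩ := (h.range_eq_ker _).2 h1
      exact ⟨P η, by simp [hP', hη, hP]⟩
  intertwines w := by simp [hQ', hP', h.intertwines]
  range_eq_ker' ξ := by
    constructor
    · rintro ⟨η, rfl⟩
      simp [hQ', (h.range_eq_ker' _).1 ⟨_, rfl⟩]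
    · intro h0
      have h1 : T (Q' ξ) = 0 := by
        have := congrArg Q' h0
        simpa [hQ'] using this
      obtain ⟨η, hη⟩ := (h.range_eq_ker' _).2 h1
      exact ⟨Q η, by simp [hQ', hη, hQ]⟩

lemma IsAdaptedFrame.of_conj {B₁ : Y →L[ℝ] F} {σ₁ : F →L[ℝ] F →L[ℝ] ℝ} {S₁ : F →L[ℝ] F}
    {B₂ : Y →L[ℝ] F'} {σ₂ : F' →L[ℝ] F' →L[ℝ] ℝ} {S₂ : F' →L[ℝ] F'}
    {c₁ : G →L[ℝ] F} {c₂ : G →L[ℝ] F'} {Θ : F →L[ℝ] G}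
    {P₁ P₁' : F →L[ℝ] F} {P₂ P₂' : F' →L[ℝ] F'} {Q Q' : Y →L[ℝ] Y}
    (h : IsAdaptedFrame (P₁.comp (B₁.comp Q')) ((pairing P₁' σ₁).comp P₁') (P₁.comp (S₁.comp P₁'))
      (P₂.comp (B₂.comp Q')) ((pairing P₂' σ₂).comp P₂') (P₂.comp (S₂.comp P₂')) c₁ c₂ Θ)
    (hP₁ : ∀ ξ, P₁ (P₁' ξ) = ξ) (hP₁' : ∀ ξ, P₁' (P₁ ξ) = ξ)
    (hP₂' : ∀ ξ, P₂' (P₂ ξ) = ξ) (hQ' : ∀ ξ, Q' (Q ξ) = ξ) :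
    IsAdaptedFrame B₁ σ₁ S₁ B₂ σ₂ S₂ (P₁'.comp c₁) (P₂'.comp c₂) (Θ.comp P₁) where
  coord_frame u := by simp [hP₁, h.coord_frame]
  coord_eq_zero ξ := by
    rw [ContinuousLinearMap.comp_apply, h.coord_eq_zero]
    constructor
    · rintro ⟨w, hw⟩
      exact ⟨Q' w, Function.LeftInverse.injective hP₁' hw⟩
    · rintro ⟨w, rfl⟩
      exact ⟨Q w, by simp [hQ']⟩
  pairing_eq u w := by simpa [hP₁', hP₂', hQ'] using h.pairing_eq u (Q w)
  form_eq u u' := h.form_eq u u'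
  endo_eq u := by
    obtain ⟨u', h1, h2⟩ := h.endo_eq u
    refine ⟨u', ?_, ?_⟩
    · simp [← h1, hP₁']
    · simp [← h2, hP₂']

variable {H : Type*} [TopologicalSpace H] {I : ModelWithCorners ℝ Y H} {N : Type*}
  [TopologicalSpace N] [ChartedSpace H N] [IsManifold I ∞ N]
  {M : Type*} [TopologicalSpace M] [ChartedSpace F M] [IsManifold 𝓘(ℝ, F) ∞ M]
  {M' : Type*} [TopologicalSpace M'] [ChartedSpace F' M'] [IsManifold 𝓘(ℝ, F') ∞ M']

/-- The derivative of `i` at `x`, with the tangent spaces identified with the model spaces. -/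
def tderiv (I : ModelWithCorners ℝ Y H) (F : Type*) [NormedAddCommGroup F] [NormedSpace ℝ F]
    {M : Type*} [TopologicalSpace M] [ChartedSpace F M] (i : N → M) (x : N) : Y →L[ℝ] F :=
  mfderiv I 𝓘(ℝ, F) i x

/-- The derivative at `x` of the chart centred at `q`, with the tangent spaces identified with the
model spaces. -/
def toChart (I : ModelWithCorners ℝ Y H) [IsManifold I ∞ N] (q x : N) : Y →L[ℝ] Y :=
  (trivializationAt Y (TangentSpace I) q).continuousLinearMapAt ℝ x

/-- The inverse of `toChart`. -/
def fromChart (I : ModelWithCorners ℝ Y H) [IsManifold I ∞ N] (q x : N) : Y →L[ℝ] Y :=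
  (trivializationAt Y (TangentSpace I) q).symmL ℝ x

lemma toChart_fromChart {q x : N} (hx : x ∈ (chartAt H q).source) (v : Y) :
    toChart I q x (fromChart I q x v) = v :=
  (trivializationAt Y (TangentSpace I) q).continuousLinearMapAt_symmL
    (by simpa using hx) v

lemma fromChart_toChart {q x : N} (hx : x ∈ (chartAt H q).source) (v : Y) :
    fromChart I q x (toChart I q x v) = v :=
  (trivializationAt Y (TangentSpace I) q).symmL_continuousLinearMapAt
    (by simpa using hx) v

lemma contMDiffOn_endo_coord {S : ∀ x : M, TangentSpace 𝓘(ℝ, F) x →L[ℝ] TangentSpace 𝓘(ℝ, F) x}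
    (hS : ContMDiff 𝓘(ℝ, F) (𝓘(ℝ, F).prod 𝓘(ℝ, F →L[ℝ] F)) ∞
      (fun x => (TotalSpace.mk' (F →L[ℝ] F)
        (E := fun x : M => TangentSpace 𝓘(ℝ, F) x →L[ℝ] TangentSpace 𝓘(ℝ, F) x) x (S x))))
    (q : M) :
    ContMDiffOn 𝓘(ℝ, F) 𝓘(ℝ, F →L[ℝ] F) ∞ (fun m => (toChart 𝓘(ℝ, F) q m).comp
      ((S m : F →L[ℝ] F).comp (fromChart 𝓘(ℝ, F) q m))) (chartAt F q).source := by
  have := ((trivializationAt (F →L[ℝ] F)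
    (fun x : M => TangentSpace 𝓘(ℝ, F) x →L[ℝ] TangentSpace 𝓘(ℝ, F) x) q).contMDiffOn_iff
      (IM := 𝓘(ℝ, F)) (n := ∞) (s := (chartAt F q).source) (f := (fun x =>
        (TotalSpace.mk' (F →L[ℝ] F) (E := fun x : M =>
          TangentSpace 𝓘(ℝ, F) x →L[ℝ] TangentSpace 𝓘(ℝ, F) x) x (S x)))) ?_).1 hS.contMDiffOn
  · exact this.2
  · intro x hx
    rw [Trivialization.mem_source, hom_trivializationAt_baseSet]
    simpa using hx

/-- `fromChart` is the derivative of the inverse chart, so the expression is `DiffForm.inChart σ q`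
composed with the chart. -/
lemma contMDiffAt_form_coord [FiniteDimensional ℝ F] {σ : DiffForm 𝓘(ℝ, F) M 2}
    (hσ : DiffForm.IsSmooth σ) {q m : M} (hm : m ∈ (chartAt F q).source) :
    ContMDiffAt 𝓘(ℝ, F) 𝓘(ℝ, F →L[ℝ] F →L[ℝ] ℝ) ∞ (fun m =>
      (pairing (fromChart 𝓘(ℝ, F) q m) (bilin (F := F) (σ m))).comp (fromChart 𝓘(ℝ, F) q m)) m := by
  have hm' : m ∈ (extChartAt 𝓘(ℝ, F) q).source := by rwa [extChartAt_source]
  have h1 : ContMDiffAt 𝓘(ℝ, F) 𝓘(ℝ, F [⋀^Fin 2]→L[ℝ] ℝ) ∞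
      (fun m => DiffForm.inChart σ q (extChartAt 𝓘(ℝ, F) q m)) m := by
    have h2 : ContDiffAt ℝ ∞ (DiffForm.inChart σ q) (extChartAt 𝓘(ℝ, F) q m) :=
      (hσ q).contDiffAt ((isOpen_extChartAt_target q).mem_nhds
        ((extChartAt 𝓘(ℝ, F) q).map_source hm'))
    exact h2.contMDiffAt.comp m (contMDiffAt_extChartAt' hm)
  refine contMDiffAt_clm_of_apply fun ξ => contMDiffAt_clm_of_apply fun η => ?_
  have h3 : ContMDiffAt 𝓘(ℝ, F) 𝓘(ℝ, ℝ) ∞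
      (fun m => DiffForm.inChart σ q (extChartAt 𝓘(ℝ, F) q m) ![ξ, η]) m :=
    ((ContinuousAlternatingMap.apply ℝ F ℝ ![ξ, η]).contDiff.contMDiff).contMDiffAt.comp m h1
  refine h3.congr_of_eventuallyEq ?_
  filter_upwards [(chartAt F q).open_source.mem_nhds hm] with y hy
  have hy' : y ∈ (extChartAt 𝓘(ℝ, F) q).source := by rwa [extChartAt_source]
  have h4 : fromChart 𝓘(ℝ, F) q y = tderiv 𝓘(ℝ, F) F (extChartAt 𝓘(ℝ, F) q).symm
      (extChartAt 𝓘(ℝ, F) q y) := by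
    have := TangentBundle.symmL_trivializationAt (I := 𝓘(ℝ, F)) (x₀ := q) (x := y) hy
    rw [modelWithCornersSelf_coe, range_id, mfderivWithin_univ] at this
    exact this
  have h5 : (extChartAt 𝓘(ℝ, F) q).symm (extChartAt 𝓘(ℝ, F) q y) = y :=
    (extChartAt 𝓘(ℝ, F) q).left_inv hy'
  have h6 : DiffForm.inChart σ q (extChartAt 𝓘(ℝ, F) q y) ![ξ, η] =
      bilin (F := F) (σ ((extChartAt 𝓘(ℝ, F) q).symm (extChartAt 𝓘(ℝ, F) q y)))
        (fromChart 𝓘(ℝ, F) q y ξ) (fromChart 𝓘(ℝ, F) q y η) := by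
    rw [h4]
    refine congrArg (σ _) ?_
    ext j
    fin_cases j <;> rfl
  rw [h6, h5]
  rfl

/-- For fixed `w` this is the fibre coordinate of the tangent map of `i` along the local section
with constant coordinate `w`. -/
lemma contMDiffAt_tderiv_coord [FiniteDimensional ℝ Y] {i : N → M} (hi : ContMDiff I 𝓘(ℝ, F) ∞ i)
    {p x : N} {q : M} (hx : x ∈ (chartAt H p).source) (hix : i x ∈ (chartAt F q).source) :
    ContMDiffAt I 𝓘(ℝ, Y →L[ℝ] F) ∞ (fun x =>
      (toChart 𝓘(ℝ, F) q (i x)).comp ((tderiv I F i x).comp (fromChart I p x))) x := by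
  refine contMDiffAt_clm_of_apply fun w => ?_
  set eN := trivializationAt Y (TangentSpace I) p with heN
  set eM := trivializationAt F (TangentSpace 𝓘(ℝ, F)) q with heM
  have hxN : x ∈ eN.baseSet := by simpa [heN] using hx
  have hxM : i x ∈ eM.baseSet := by simpa [heM] using hix
  have h1 : ContMDiffAt I I.tangent ∞ (fun x => eN.toOpenPartialHomeomorph.symm (x, w)) x := by
    have ht : (x, w) ∈ eN.target := eN.mem_target.2 hxN
    have := (eN.contMDiffOn_symm (n := ∞) (IB := I)).contMDiffAt (eN.open_target.mem_nhds ht)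
    exact this.comp x (contMDiffAt_id.prodMk contMDiffAt_const)
  have h2 : ContMDiffAt I 𝓘(ℝ, F).tangent ∞
      (fun x => tangentMap I 𝓘(ℝ, F) i (eN.toOpenPartialHomeomorph.symm (x, w))) x :=
    (hi.contMDiff_tangentMap (m := ∞) (by simp)).contMDiffAt.comp x h1
  have hs : ∀ y ∈ eN.baseSet, eN.toOpenPartialHomeomorph.symm (y, w) =
      (⟨y, fromChart I p y w⟩ : TangentBundle I N) := fun y hy => by
    rw [← eN.mk_symm hy w, ← eN.symmL_apply (R := ℝ) hy w]
    rfl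
  have h3 : ContMDiffAt I 𝓘(ℝ, F) ∞
      (fun x => (eM (tangentMap I 𝓘(ℝ, F) i (eN.toOpenPartialHomeomorph.symm (x, w)))).2) x := by
    refine ((eM.contMDiffAt_iff ?_).1 h2).2
    rw [hs x hxN, eM.mem_source]
    exact hxM
  refine h3.congr_of_eventuallyEq ?_
  have hcont : ContinuousAt i x := hi.continuous.continuousAt
  filter_upwards [eN.open_baseSet.mem_nhds hxN,
    hcont.preimage_mem_nhds (eM.open_baseSet.mem_nhds hxM)] with y hy hy'
  rw [hs y hy]
  exact congrFun (eM.coe_linearMapAt_of_mem (R := ℝ) hy') _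

lemma contMDiffAt_toChart_comp_fromChart [FiniteDimensional ℝ Y] {q q' x : N}
    (hq : x ∈ (chartAt H q).source) (hq' : x ∈ (chartAt H q').source) :
    ContMDiffAt I 𝓘(ℝ, Y →L[ℝ] Y) ∞
      (fun x => (toChart I q x).comp (fromChart I q' x)) x := by
  set e := trivializationAt Y (TangentSpace I) q with he
  set e' := trivializationAt Y (TangentSpace I) q' with he'
  have hx : x ∈ e.baseSet := by simpa [he] using hq
  have hx' : x ∈ e'.baseSet := by simpa [he'] using hq'
  refine (contMDiffAt_coordChangeL (n := ∞) (IB := I) hx' hx).congr_of_eventuallyEq ?_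
  filter_upwards [e.open_baseSet.mem_nhds hx, e'.open_baseSet.mem_nhds hx'] with y hy hy'
  ext v
  refine Eq.trans ?_ (e'.coordChangeL_apply e ⟨hy', hy⟩ v).symm
  rw [← e'.symmL_apply (R := ℝ) hy' v]
  exact congrFun (e.coe_linearMapAt_of_mem (R := ℝ) hy) _

/-- A smooth map `i` which is pointwise a Lagrangian coisotropic embedding. -/
structure IsCoisotropicImmersion [FiniteDimensional ℝ F] (I : ModelWithCorners ℝ Y H)
    (T : N → (Y →L[ℝ] Y)) (i : N → M) (σ : DiffForm 𝓘(ℝ, F) M 2)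
    (S : ∀ x : M, TangentSpace 𝓘(ℝ, F) x →L[ℝ] TangentSpace 𝓘(ℝ, F) x) : Prop where
  smooth : ContMDiff I 𝓘(ℝ, F) ∞ i
  smooth_form : DiffForm.IsSmooth σ
  smooth_endo : ContMDiff 𝓘(ℝ, F) (𝓘(ℝ, F).prod 𝓘(ℝ, F →L[ℝ] F)) ∞
      (fun x => (TotalSpace.mk' (F →L[ℝ] F)
        (E := fun x : M => TangentSpace 𝓘(ℝ, F) x →L[ℝ] TangentSpace 𝓘(ℝ, F) x) x (S x)))
  model : ∀ x, IsCoisotropicModel (tderiv I F i x) (bilin (F := F) (σ (i x))) (S (i x)) (T x)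

variable [FiniteDimensional ℝ Y] [FiniteDimensional ℝ F] [FiniteDimensional ℝ F']
  [FiniteDimensional ℝ G]

lemma IsCoisotropicImmersion.eventually_mem_source {T : N → (Y →L[ℝ] Y)} {i : N → M}
    {σ : DiffForm 𝓘(ℝ, F) M 2}
    {S : ∀ x : M, TangentSpace 𝓘(ℝ, F) x →L[ℝ] TangentSpace 𝓘(ℝ, F) x}
    (h : IsCoisotropicImmersion I T i σ S) (p : N) :
    ∀ᶠ x in 𝓝 p, i x ∈ (chartAt F (i p)).source :=
  h.smooth.continuous.continuousAt.eventually (chart_source_mem_nhds F (i p))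

lemma IsCoisotropicImmersion.coordinates {T : N → (Y →L[ℝ] Y)} {i : N → M}
    {σ : DiffForm 𝓘(ℝ, F) M 2}
    {S : ∀ x : M, TangentSpace 𝓘(ℝ, F) x →L[ℝ] TangentSpace 𝓘(ℝ, F) x}
    (h : IsCoisotropicImmersion I T i σ S) (p : N) :
    SmoothNear I 𝓘(ℝ, Y →L[ℝ] F) (fun x => (toChart 𝓘(ℝ, F) (i p) (i x)).comp
      ((tderiv I F i x).comp (fromChart I p x))) p ∧
    SmoothNear I 𝓘(ℝ, F →L[ℝ] F →L[ℝ] ℝ) (fun x =>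
      (pairing (fromChart 𝓘(ℝ, F) (i p) (i x)) (bilin (F := F) (σ (i x)))).comp
        (fromChart 𝓘(ℝ, F) (i p) (i x))) p ∧
    SmoothNear I 𝓘(ℝ, F →L[ℝ] F) (fun x => (toChart 𝓘(ℝ, F) (i p) (i x)).comp
      ((S (i x) : F →L[ℝ] F).comp (fromChart 𝓘(ℝ, F) (i p) (i x)))) p ∧
    ∀ᶠ x in 𝓝 p, IsCoisotropicModel
      ((toChart 𝓘(ℝ, F) (i p) (i x)).comp ((tderiv I F i x).comp (fromChart I p x)))
      ((pairing (fromChart 𝓘(ℝ, F) (i p) (i x)) (bilin (F := F) (σ (i x)))).comp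
        (fromChart 𝓘(ℝ, F) (i p) (i x)))
      ((toChart 𝓘(ℝ, F) (i p) (i x)).comp
        ((S (i x) : F →L[ℝ] F).comp (fromChart 𝓘(ℝ, F) (i p) (i x))))
      ((toChart I p x).comp ((T x).comp (fromChart I p x))) := by
  have hsN := chart_source_mem_nhds H p
  have hsM := h.eventually_mem_source p
  refine ⟨?_, ?_, ?_, ?_⟩
  · filter_upwards [hsN, hsM] with x hx hx'
    exact contMDiffAt_tderiv_coord h.smooth hx hx'
  · filter_upwards [hsM] with x hx'
    exact (contMDiffAt_form_coord h.smooth_form hx').comp x h.smooth.contMDiffAt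
  · filter_upwards [hsM] with x hx'
    exact ((contMDiffOn_endo_coord h.smooth_endo (i p)).contMDiffAt
      ((chartAt F (i p)).open_source.mem_nhds hx')).comp x h.smooth.contMDiffAt
  · filter_upwards [hsN, hsM] with x hx hx'
    exact (h.model x).conj (toChart_fromChart hx') (fromChart_toChart hx') (toChart_fromChart hx)
      (fromChart_toChart hx)

/-- The frames are constructed in trivializations and conjugated back. The functions `c₁`, `c₂`, `Θ`
stay in coordinates, because smoothness is stated there. -/
theorem exists_local_adapted_frame {T : N → (Y →L[ℝ] Y)} {i₁ : N → M}
    {σ₁ : DiffForm 𝓘(ℝ, F) M 2}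
    {S₁ : ∀ x : M, TangentSpace 𝓘(ℝ, F) x →L[ℝ] TangentSpace 𝓘(ℝ, F) x}
    (h₁ : IsCoisotropicImmersion I T i₁ σ₁ S₁) {i₂ : N → M'}
    {σ₂ : DiffForm 𝓘(ℝ, F') M' 2}
    {S₂ : ∀ x : M', TangentSpace 𝓘(ℝ, F') x →L[ℝ] TangentSpace 𝓘(ℝ, F') x}
    (h₂ : IsCoisotropicImmersion I T i₂ σ₂ S₂)
    (hω : ∀ x w w', bilin (F := F) (σ₁ (i₁ x)) (tderiv I F i₁ x w) (tderiv I F i₁ x w') =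
      bilin (F := F') (σ₂ (i₂ x)) (tderiv I F' i₂ x w) (tderiv I F' i₂ x w'))
    (hG : finrank ℝ F = finrank ℝ Y + finrank ℝ G) (p : N) :
    ∃ (c₁ : N → (G →L[ℝ] F)) (c₂ : N → (G →L[ℝ] F')) (Θ : N → (F →L[ℝ] G)),
      SmoothNear I 𝓘(ℝ, G →L[ℝ] F) c₁ p ∧ SmoothNear I 𝓘(ℝ, G →L[ℝ] F') c₂ p ∧
      SmoothNear I 𝓘(ℝ, F →L[ℝ] G) Θ p ∧
      ∀ᶠ x in 𝓝 p, IsAdaptedFrame (tderiv I F i₁ x) (bilin (F := F) (σ₁ (i₁ x))) (S₁ (i₁ x))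
        (tderiv I F' i₂ x) (bilin (F := F') (σ₂ (i₂ x))) (S₂ (i₂ x))
        ((fromChart 𝓘(ℝ, F) (i₁ p) (i₁ x)).comp (c₁ x))
        ((fromChart 𝓘(ℝ, F') (i₂ p) (i₂ x)).comp (c₂ x))
        ((Θ x).comp (toChart 𝓘(ℝ, F) (i₁ p) (i₁ x))) := by
  obtain ⟨hB₁, hσ₁, hS₁, hm₁⟩ := h₁.coordinates p
  obtain ⟨hB₂, hσ₂, hS₂, hm₂⟩ := h₂.coordinates p
  have hsN := chart_source_mem_nhds H p
  have hsM₁ := h₁.eventually_mem_source p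
  have hsM₂ := h₂.eventually_mem_source p
  obtain ⟨c₁, c₂, Θ, hc₁, hc₂, hΘ, hfr⟩ := exists_adapted_frame (G := G) hB₁ hσ₁ hS₁ hm₁ hB₂ hσ₂
    hS₂ hm₂ (by
      filter_upwards [hsM₁, hsM₂] with x hx₁ hx₂ w w'
      simpa [fromChart_toChart hx₁, fromChart_toChart hx₂] using
        hω x (fromChart I p x w) (fromChart I p x w')) hG
  refine ⟨c₁, c₂, Θ, hc₁, hc₂, hΘ, ?_⟩
  filter_upwards [hfr, hsN, hsM₁, hsM₂] with x hx hxN hx₁ hx₂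
  exact hx.of_conj (toChart_fromChart hx₁) (fromChart_toChart hx₁) (fromChart_toChart hx₂)
    (fromChart_toChart hxN)

end Coordinates

/-! ### Translations in charts as a substitute for the exponential map. -/

section ChartAddition

set_option linter.unusedSectionVars false

variable {EX : Type*} [NormedAddCommGroup EX] [NormedSpace ℝ EX] {HX : Type*} [TopologicalSpace HX]
  {IX : ModelWithCorners ℝ EX HX} {X : Type*} [TopologicalSpace X] [ChartedSpace HX X]
  {F : Type*} [NormedAddCommGroup F] [NormedSpace ℝ F]
  {M : Type*} [TopologicalSpace M] [ChartedSpace F M] [IsManifold 𝓘(ℝ, F) ∞ M]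
  {F' : Type*} [NormedAddCommGroup F'] [NormedSpace ℝ F']
  {M' : Type*} [TopologicalSpace M'] [ChartedSpace F' M'] [IsManifold 𝓘(ℝ, F') ∞ M']

lemma SmoothNear.mdifferentiableAt {f : X → M} {z : X} (h : SmoothNear IX 𝓘(ℝ, F) f z) :
    MDifferentiableAt IX 𝓘(ℝ, F) f z :=
  h.contMDiffAt.mdifferentiableAt (by simp)

lemma tderiv_comp {f : X → M} {g : M → M'} {z : X}
    (hg : MDifferentiableAt 𝓘(ℝ, F) 𝓘(ℝ, F') g (f z)) (hf : MDifferentiableAt IX 𝓘(ℝ, F) f z) :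
    tderiv IX F' (fun x => g (f x)) z = (tderiv 𝓘(ℝ, F) F' g (f z)).comp (tderiv IX F f z) :=
  mfderiv_comp z hg hf

lemma tderiv_congr {f g : X → M} {z : X} (h : f =ᶠ[𝓝 z] g) : tderiv IX F f z = tderiv IX F g z :=
  h.mfderiv_eq

lemma tderiv_add {f g : X → F} {z : X} (hf : MDifferentiableAt IX 𝓘(ℝ, F) f z)
    (hg : MDifferentiableAt IX 𝓘(ℝ, F) g z) :
    tderiv IX F (fun x => f x + g x) z = tderiv IX F f z + tderiv IX F g z :=
  (hf.hasMFDerivAt.add hg.hasMFDerivAt).mfderiv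

lemma tderiv_const (m : M) (z : X) : tderiv IX F (fun _ => m) z = 0 :=
  mfderiv_const

lemma tderiv_extChartAt {q m : M} (hm : m ∈ (chartAt F q).source) :
    tderiv 𝓘(ℝ, F) F (extChartAt 𝓘(ℝ, F) q) m = toChart 𝓘(ℝ, F) q m :=
  (TangentBundle.continuousLinearMapAt_trivializationAt (I := 𝓘(ℝ, F)) (x₀ := q) (x := m) hm).symm

lemma tderiv_extChartAt_symm {q m : M} (hm : m ∈ (chartAt F q).source) :
    tderiv 𝓘(ℝ, F) F (extChartAt 𝓘(ℝ, F) q).symm (extChartAt 𝓘(ℝ, F) q m) =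
      fromChart 𝓘(ℝ, F) q m := by
  have := TangentBundle.symmL_trivializationAt (I := 𝓘(ℝ, F)) (x₀ := q) (x := m) hm
  rw [modelWithCornersSelf_coe, range_id, mfderivWithin_univ] at this
  exact this.symm

open Classical in
/-- Translation of `m` by `v` in the chart centred at `q`. -/
def chartAdd (q m : M) (v : F) : M :=
  if m ∈ (chartAt F q).source then
    (extChartAt 𝓘(ℝ, F) q).symm (extChartAt 𝓘(ℝ, F) q m + v) else m

-- The default value outside the chart makes this hold at every point, so zero translations drop out
-- of an iteration with no condition on chart domains.
@[simp] lemma chartAdd_zero (q m : M) : chartAdd q m (0 : F) = m := by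
  unfold chartAdd
  split_ifs with h
  · rw [add_zero, (extChartAt 𝓘(ℝ, F) q).left_inv (by rwa [extChartAt_source])]
  · rfl

/-- Because `δ z = 0`, the chart and its inverse are differentiated at corresponding points: they
cancel on the derivative of `f`, and only `fromChart` remains on that of `δ`. -/
lemma smoothNear_chartAdd {f : X → M} {δ : X → F} {q : M} {z : X}
    (hf : SmoothNear IX 𝓘(ℝ, F) f z) (hδ : SmoothNear IX 𝓘(ℝ, F) δ z)
    (hz : f z ∈ (chartAt F q).source) (h0 : δ z = 0) :
    SmoothNear IX 𝓘(ℝ, F) (fun x => chartAdd q (f x) (δ x)) z ∧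
    tderiv IX F (fun x => chartAdd q (f x) (δ x)) z =
      tderiv IX F f z + (fromChart 𝓘(ℝ, F) q (f z)).comp (tderiv IX F δ z) := by
  set φ := extChartAt 𝓘(ℝ, F) q with hφ
  have hz' : f z ∈ φ.source := by rwa [hφ, extChartAt_source]
  have hsrc : ∀ᶠ x in 𝓝 z, f x ∈ (chartAt F q).source :=
    hf.contMDiffAt.continuousAt.eventually ((chartAt F q).open_source.mem_nhds hz)
  have heq : (fun x => chartAdd q (f x) (δ x)) =ᶠ[𝓝 z] fun x => φ.symm (φ (f x) + δ x) := by
    filter_upwards [hsrc] with x hx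
    rw [chartAdd, if_pos hx]
  have hsum : SmoothNear IX 𝓘(ℝ, F) (fun x => φ (f x) + δ x) z := by
    filter_upwards [hf, hδ, hsrc] with x h1 h2 h3
    exact ((contMDiffAt_extChartAt' h3).comp x h1).add h2
  have hval : φ (f z) + δ z = φ (f z) := by rw [h0, add_zero]
  have htgt : ∀ᶠ x in 𝓝 z, φ (f x) + δ x ∈ φ.target := by
    refine hsum.contMDiffAt.continuousAt.eventually ((isOpen_extChartAt_target q).mem_nhds ?_)
    change φ (f z) + δ z ∈ φ.target
    rw [hval]
    exact φ.map_source hz'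
  have hsymm : ∀ y ∈ φ.target, ContMDiffAt 𝓘(ℝ, F) 𝓘(ℝ, F) ∞ φ.symm y := fun y hy =>
    (contMDiffOn_extChartAt_symm q).contMDiffAt ((isOpen_extChartAt_target q).mem_nhds hy)
  refine ⟨SmoothNear.congr ?_ heq, ?_⟩
  · filter_upwards [hsum, htgt] with x h1 h2
    exact (hsymm _ h2).comp x h1
  · have hd : MDifferentiableAt IX 𝓘(ℝ, F) (fun x => φ (f x)) z :=
      ((contMDiffAt_extChartAt' hz).comp z hf.contMDiffAt).mdifferentiableAt (n := ∞) (by simp)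
    rw [tderiv_congr heq, tderiv_comp (f := fun x => φ (f x) + δ x)
      ((hsymm _ htgt.self_of_nhds).mdifferentiableAt (by simp)) hsum.mdifferentiableAt,
      tderiv_add hd hδ.mdifferentiableAt, hval, hφ, tderiv_extChartAt_symm hz,
      tderiv_comp ((contMDiffAt_extChartAt' hz).mdifferentiableAt (n := ∞) (by simp))
        hf.mdifferentiableAt, tderiv_extChartAt hz]
    ext v
    simp [fromChart_toChart hz]

/-- Successive translations of `b z` by `δ 0 z`, …, `δ (n - 1) z` in the charts centred at
`q 0`, …, `q (n - 1)`. -/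
def chartAddIter (b : X → M) (q : ℕ → M) (δ : ℕ → X → F) : ℕ → X → M
  | 0 => b
  | n + 1 => fun z => chartAdd (q n) (chartAddIter b q δ n z) (δ n z)

lemma chartAddIter_succ (b : X → M) (q : ℕ → M) (δ : ℕ → X → F) (n : ℕ) (z : X) :
    chartAddIter b q δ (n + 1) z = chartAdd (q n) (chartAddIter b q δ n z) (δ n z) := rfl

lemma chartAddIter_eq (b : X → M) (q : ℕ → M) {δ : ℕ → X → F} {z : X} {n : ℕ}
    (h : ∀ a ≥ n, δ a z = 0) {m : ℕ} (hm : n ≤ m) :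
    chartAddIter b q δ m z = chartAddIter b q δ n z := by
  induction m, hm using Nat.le_induction with
  | base => rfl
  | succ m hm ih => rw [chartAddIter_succ, h m hm, chartAdd_zero, ih]

/-- Every `δ a` vanishes at `z`, so the base point does not move and the first-order effects add up.
The second alternative covers the indices for which the chart or the smoothness of `δ a` is not
available near `z`. -/
lemma chartAddIter_spec {b : X → M} {q : ℕ → M} {δ : ℕ → X → F} {z : X}
    (hb : SmoothNear IX 𝓘(ℝ, F) b z)
    (h : ∀ a, (b z ∈ (chartAt F (q a)).source ∧ SmoothNear IX 𝓘(ℝ, F) (δ a) z ∧ δ a z = 0) ∨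
      δ a =ᶠ[𝓝 z] 0) (n : ℕ) :
    chartAddIter b q δ n z = b z ∧ SmoothNear IX 𝓘(ℝ, F) (chartAddIter b q δ n) z ∧
    tderiv IX F (chartAddIter b q δ n) z = tderiv IX F b z +
      ∑ a ∈ Finset.range n, (fromChart 𝓘(ℝ, F) (q a) (b z)).comp (tderiv IX F (δ a) z) := by
  induction n with
  | zero => exact ⟨rfl, hb, by simp [chartAddIter]⟩
  | succ n ih =>
    obtain ⟨h1, h2, h3⟩ := ih
    rcases h n with ⟨hs, hδ, h0⟩ | h0
    · obtain ⟨h4, h5⟩ := smoothNear_chartAdd h2 hδ (by rwa [h1]) h0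
      refine ⟨by rw [chartAddIter_succ, h0, chartAdd_zero, h1], h4, ?_⟩
      rw [Finset.sum_range_succ, ← add_assoc, ← h3]
      rw [h1] at h5
      exact h5
    · have heq : chartAddIter b q δ (n + 1) =ᶠ[𝓝 z] chartAddIter b q δ n := by
        filter_upwards [h0] with x hx
        rw [chartAddIter_succ, hx, Pi.zero_apply, chartAdd_zero]
      have hd : tderiv IX F (δ n) z = 0 := by
        rw [tderiv_congr h0]
        exact tderiv_const 0 z
      exact ⟨heq.self_of_nhds.trans h1, h2.congr heq, by
        rw [tderiv_congr heq, h3, Finset.sum_range_succ, hd, ContinuousLinearMap.comp_zero,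
          add_zero]⟩

open Classical in
/-- The eventual value of the successive translations `chartAddIter`. -/
def chartAddLimit (b : X → M) (q : ℕ → M) (δ : ℕ → X → F) (z : X) : M :=
  if h : ∃ n, ∀ a ≥ n, δ a z = 0 then chartAddIter b q δ h.choose z else b z

lemma chartAddLimit_eq (b : X → M) (q : ℕ → M) {δ : ℕ → X → F} {z : X} {n : ℕ}
    (h : ∀ a ≥ n, δ a z = 0) : chartAddLimit b q δ z = chartAddIter b q δ n z := by
  have hex : ∃ n, ∀ a ≥ n, δ a z = 0 := ⟨n, h⟩
  rw [chartAddLimit, dif_pos hex]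
  rcases le_total n hex.choose with hn | hn
  · exact chartAddIter_eq b q h hn
  · exact (chartAddIter_eq b q hex.choose_spec hn).symm

lemma chartAddLimit_spec {b : X → M} {q : ℕ → M} {δ : ℕ → X → F} {z : X} {n : ℕ}
    (hb : SmoothNear IX 𝓘(ℝ, F) b z)
    (h : ∀ a, (b z ∈ (chartAt F (q a)).source ∧ SmoothNear IX 𝓘(ℝ, F) (δ a) z ∧ δ a z = 0) ∨
      δ a =ᶠ[𝓝 z] 0) (hn : ∀ᶠ x in 𝓝 z, ∀ a ≥ n, δ a x = 0) :
    chartAddLimit b q δ z = b z ∧ SmoothNear IX 𝓘(ℝ, F) (chartAddLimit b q δ) z ∧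
    tderiv IX F (chartAddLimit b q δ) z = tderiv IX F b z +
      ∑ a ∈ Finset.range n, (fromChart 𝓘(ℝ, F) (q a) (b z)).comp (tderiv IX F (δ a) z) := by
  have heq : chartAddLimit b q δ =ᶠ[𝓝 z] chartAddIter b q δ n := by
    filter_upwards [hn] with x hx using chartAddLimit_eq b q hx
  obtain ⟨h1, h2, h3⟩ := chartAddIter_spec hb h n
  exact ⟨heq.self_of_nhds.trans h1, h2.congr heq, by rw [tderiv_congr heq, h3]⟩

end ChartAddition

/-! ### Convexity of adapted frames and the isomorphism they define. -/

section AdaptedFrames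

open Module

set_option linter.unusedSectionVars false

variable {Y : Type*} [NormedAddCommGroup Y] [NormedSpace ℝ Y] [FiniteDimensional ℝ Y]
  {F : Type*} [NormedAddCommGroup F] [NormedSpace ℝ F] [FiniteDimensional ℝ F]
  {F' : Type*} [NormedAddCommGroup F'] [NormedSpace ℝ F'] [FiniteDimensional ℝ F']
  {G : Type*} [NormedAddCommGroup G] [NormedSpace ℝ G] [FiniteDimensional ℝ G]
  {B₁ : Y →L[ℝ] F} {σ₁ : F →L[ℝ] F →L[ℝ] ℝ} {S₁ : F →L[ℝ] F}
  {B₂ : Y →L[ℝ] F'} {σ₂ : F' →L[ℝ] F' →L[ℝ] ℝ} {S₂ : F' →L[ℝ] F'} {T : Y →L[ℝ] Y}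

namespace IsAdaptedFrame

/-- `c₁ ∘ Θ` is the identity modulo the image of `B₁`, on which `Θ'` vanishes. This is the cocycle
identity of the normal bundle. -/
lemma coord_change {c₁ c₁' : G →L[ℝ] F} {c₂ c₂' : G →L[ℝ] F'} {Θ Θ' : F →L[ℝ] G}
    (h : IsAdaptedFrame B₁ σ₁ S₁ B₂ σ₂ S₂ c₁ c₂ Θ)
    (h' : IsAdaptedFrame B₁ σ₁ S₁ B₂ σ₂ S₂ c₁' c₂' Θ') (ξ : F) :
    Θ' (c₁ (Θ ξ)) = Θ' ξ := by
  have h0 : Θ (c₁ (Θ ξ) - ξ) = 0 := by rw [map_sub, h.coord_frame, sub_self]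
  have h1 := (h'.coord_eq_zero _).2 ((h.coord_eq_zero _).1 h0)
  rwa [map_sub, sub_eq_zero] at h1

/-- Comparison of two adapted frames with the same coordinates. -/
lemma exists_difference (h₁ : IsCoisotropicModel B₁ σ₁ S₁ T) (h₂ : IsCoisotropicModel B₂ σ₂ S₂ T)
    (hω : ∀ w w', σ₁ (B₁ w) (B₁ w') = σ₂ (B₂ w) (B₂ w'))
    {c₁ c₁' : G →L[ℝ] F} {c₂ c₂' : G →L[ℝ] F'} {Θ Θ' : F →L[ℝ] G}
    (h : IsAdaptedFrame B₁ σ₁ S₁ B₂ σ₂ S₂ c₁ c₂ Θ)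
    (h' : IsAdaptedFrame B₁ σ₁ S₁ B₂ σ₂ S₂ c₁' c₂' Θ') :
    ∃ w κ : G → Y, (∀ u, c₁' (Θ' (c₁ u)) = c₁ u + B₁ (w u)) ∧
      (∀ u, c₂' (Θ' (c₁ u)) = c₂ u + B₂ (w u) + B₂ (κ u)) ∧
      (∀ u v, σ₂ (B₂ (κ u)) (B₂ v) = 0) ∧
      ∀ u u', σ₂ (c₂ u) (B₂ (κ u')) = σ₂ (c₂ u') (B₂ (κ u)) := by
  -- In the same coordinates the two frames agree modulo the image of `B₁`, which defines `w`. The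
  -- discrepancy left in the second space is orthogonal to the image of `B₂`, because the pairings
  -- agree, and so lies in that image by coisotropy; this defines `κ`.
  have hw : ∀ u, ∃ w, B₁ w = c₁' (Θ' (c₁ u)) - c₁ u := fun u => by
    refine (h'.coord_eq_zero _).1 ?_
    rw [map_sub, h'.coord_frame, sub_self]
  choose w hw using hw
  have hκ₀ : ∀ u v, σ₂ (c₂' (Θ' (c₁ u)) - c₂ u - B₂ (w u)) (B₂ v) = 0 := fun u v => by
    have : σ₁ (B₁ (w u)) (B₁ v) = σ₁ (c₁' (Θ' (c₁ u)) - c₁ u) (B₁ v) := by rw [hw]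
    rw [map_sub, _root_.sub_apply, h'.pairing_eq, h.pairing_eq, hω] at this
    simp [this]
  have hκ : ∀ u, ∃ κ, B₂ κ = c₂' (Θ' (c₁ u)) - c₂ u - B₂ (w u) := fun u =>
    h₂.coisotropic _ (hκ₀ u)
  choose κ hκ using hκ
  have e1 : ∀ u, c₁' (Θ' (c₁ u)) = c₁ u + B₁ (w u) := fun u => by rw [hw]; abel
  have e2 : ∀ u, c₂' (Θ' (c₁ u)) = c₂ u + B₂ (w u) + B₂ (κ u) := fun u => by rw [hκ]; abel
  have e3 : ∀ u v, σ₂ (B₂ (κ u)) (B₂ v) = 0 := fun u v => by rw [hκ, hκ₀]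
  refine ⟨w, κ, e1, e2, e3, fun u u' => ?_⟩
  have e4 : ∀ u v, σ₂ (B₂ v) (B₂ (κ u)) = 0 := fun u v => by rw [h₂.skew, e3, neg_zero]
  -- Expanding both sides, the terms in `w` alone match, and what survives is the symmetry of `σ₂
  -- (c₂ u) (B₂ (κ u'))`.
  have := h'.form_eq (Θ' (c₁ u)) (Θ' (c₁ u'))
  rw [e1, e1, e2, e2] at this
  simp only [map_add, _root_.add_apply, e3, e4, h.form_eq, h.pairing_eq, hω] at this
  rw [h₁.skew (B₁ (w u)) (c₁ u'), h₂.skew (B₂ (w u)) (c₂ u'), h₂.skew (B₂ (κ u)) (c₂ u'),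
    h.pairing_eq] at this
  linarith

/-- Adapted frames are stable under convex combinations. -/
theorem convexComb (h₁ : IsCoisotropicModel B₁ σ₁ S₁ T) (h₂ : IsCoisotropicModel B₂ σ₂ S₂ T)
    (hω : ∀ w w', σ₁ (B₁ w) (B₁ w') = σ₂ (B₂ w) (B₂ w'))
    {c₁ : G →L[ℝ] F} {c₂ : G →L[ℝ] F'} {Θ : F →L[ℝ] G}
    (h : IsAdaptedFrame B₁ σ₁ S₁ B₂ σ₂ S₂ c₁ c₂ Θ)
    {ι : Type*} (s : Finset ι) (ρ : ι → ℝ) (hρ : ∑ a ∈ s, ρ a = 1)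
    {C₁ : ι → (G →L[ℝ] F)} {C₂ : ι → (G →L[ℝ] F')} {Θ' : ι → (F →L[ℝ] G)}
    (h' : ∀ a ∈ s, ρ a ≠ 0 → IsAdaptedFrame B₁ σ₁ S₁ B₂ σ₂ S₂ (C₁ a) (C₂ a) (Θ' a)) :
    IsAdaptedFrame B₁ σ₁ S₁ B₂ σ₂ S₂ (∑ a ∈ s, ρ a • (C₁ a).comp ((Θ' a).comp c₁))
      (∑ a ∈ s, ρ a • (C₂ a).comp ((Θ' a).comp c₁)) Θ := by
  classical
  -- The conditions on `κ` are linear and `w` is unconstrained, so both can be averaged. The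
  -- quadratic terms either match by `hω` or vanish by orthogonality. Indices of weight zero receive
  -- zero differences.
  have hdiff : ∀ a, ∃ w κ : G → Y, (a ∈ s → ρ a ≠ 0 →
      (∀ u, C₁ a (Θ' a (c₁ u)) = c₁ u + B₁ (w u)) ∧
      (∀ u, C₂ a (Θ' a (c₁ u)) = c₂ u + B₂ (w u) + B₂ (κ u))) ∧
      (∀ u v, σ₂ (B₂ (κ u)) (B₂ v) = 0) ∧
      ∀ u u', σ₂ (c₂ u) (B₂ (κ u')) = σ₂ (c₂ u') (B₂ (κ u)) := by
    intro a
    by_cases ha : a ∈ s ∧ ρ a ≠ 0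
    · obtain ⟨w, κ, e1, e2, e3, e4⟩ := exists_difference h₁ h₂ hω h (h' a ha.1 ha.2)
      exact ⟨w, κ, fun _ _ => ⟨e1, e2⟩, e3, e4⟩
    · exact ⟨0, 0, fun h1 h2 => absurd ⟨h1, h2⟩ ha, by simp, by simp⟩
  choose w κ hwκ hκ hsym using hdiff
  have hsum : ∀ v : F, ∑ a ∈ s, ρ a • v = v := fun v => by rw [← Finset.sum_smul, hρ, one_smul]
  have hsum' : ∀ v : F', ∑ a ∈ s, ρ a • v = v := fun v => by
    rw [← Finset.sum_smul, hρ, one_smul]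
  have e1 : ∀ u, (∑ a ∈ s, ρ a • (C₁ a).comp ((Θ' a).comp c₁)) u =
      c₁ u + B₁ (∑ a ∈ s, ρ a • w a u) := fun u => by
    conv_rhs => rw [← hsum (c₁ u), map_sum, ← Finset.sum_add_distrib]
    rw [_root_.sum_apply]
    refine Finset.sum_congr rfl fun a ha => ?_
    rcases eq_or_ne (ρ a) 0 with h0 | h0
    · simp [h0]
    · simp [(hwκ a ha h0).1]
  have e2 : ∀ u, (∑ a ∈ s, ρ a • (C₂ a).comp ((Θ' a).comp c₁)) u =
      c₂ u + B₂ (∑ a ∈ s, ρ a • w a u) + B₂ (∑ a ∈ s, ρ a • κ a u) := fun u => by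
    conv_rhs => rw [← hsum' (c₂ u), map_sum, map_sum, ← Finset.sum_add_distrib,
      ← Finset.sum_add_distrib]
    rw [_root_.sum_apply]
    refine Finset.sum_congr rfl fun a ha => ?_
    rcases eq_or_ne (ρ a) 0 with h0 | h0
    · simp [h0]
    · simp [(hwκ a ha h0).2]
  have e3 : ∀ u v, σ₂ (B₂ (∑ a ∈ s, ρ a • κ a u)) (B₂ v) = 0 := fun u v => by
    simp [map_sum, _root_.sum_apply, hκ]
  have e4 : ∀ u v, σ₂ (B₂ v) (B₂ (∑ a ∈ s, ρ a • κ a u)) = 0 := fun u v => by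
    rw [h₂.skew, e3, neg_zero]
  have e5 : ∀ u u', σ₂ (c₂ u) (B₂ (∑ a ∈ s, ρ a • κ a u')) =
      σ₂ (c₂ u') (B₂ (∑ a ∈ s, ρ a • κ a u)) := fun u u' => by
    simp only [map_sum, map_smul]
    exact Finset.sum_congr rfl fun a _ => by rw [hsym]
  refine ⟨fun u => ?_, h.coord_eq_zero, fun u v => ?_, fun u u' => ?_, fun u => ?_⟩
  · rw [e1, map_add, h.coord_frame, (h.coord_eq_zero _).2 ⟨_, rfl⟩, add_zero]
  · rw [e1, e2]
    simp only [map_add, _root_.add_apply, e3, h.pairing_eq, hω, add_zero]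
  · rw [e1, e1, e2, e2]
    simp only [map_add, _root_.add_apply, e3, e4, h.form_eq, h.pairing_eq, hω]
    rw [h₁.skew (B₁ _) (c₁ u'), h₂.skew (B₂ (∑ a ∈ s, ρ a • w a u)) (c₂ u'),
      h₂.skew (B₂ (∑ a ∈ s, ρ a • κ a u)) (c₂ u'), h.pairing_eq, e5 u u']
    ring
  · obtain ⟨v, hv₁, hv₂⟩ := h.endo_eq u
    have key : ∀ a ∈ s, ρ a ≠ 0 → S₁ (C₁ a (Θ' a (c₁ u))) = C₁ a (Θ' a (c₁ v)) ∧
        S₂ (C₂ a (Θ' a (c₁ u))) = C₂ a (Θ' a (c₁ v)) := by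
      intro a ha h0
      obtain ⟨v', hv₁', hv₂'⟩ := (h' a ha h0).endo_eq (Θ' a (c₁ u))
      -- All frames induce the same action of `S₁` modulo the image of `B₁`, so after the change of
      -- coordinates the same `v` serves every index.
      have hv' : v' = Θ' a (c₁ v) := by
        rw [← (h' a ha h0).coord_frame v', ← hv₁', (hwκ a ha h0).1, map_add, hv₁,
          ← h₁.intertwines, map_add, ((h' a ha h0).coord_eq_zero _).2 ⟨_, rfl⟩, add_zero]
      rw [hv₁', hv₂', hv']
      exact ⟨rfl, rfl⟩
    refine ⟨v, ?_, ?_⟩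
    · rw [_root_.sum_apply, _root_.sum_apply, map_sum]
      refine Finset.sum_congr rfl fun a ha => ?_
      rcases eq_or_ne (ρ a) 0 with h0 | h0
      · simp [h0]
      · simp [(key a ha h0).1]
    · rw [_root_.sum_apply, _root_.sum_apply, map_sum]
      refine Finset.sum_congr rfl fun a ha => ?_
      rcases eq_or_ne (ρ a) 0 with h0 | h0
      · simp [h0]
      · simp [(key a ha h0).2]

lemma injective₁ (h₁ : IsCoisotropicModel B₁ σ₁ S₁ T)
    {c₁ : G →L[ℝ] F} {c₂ : G →L[ℝ] F'} {Θ : F →L[ℝ] G}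
    (h : IsAdaptedFrame B₁ σ₁ S₁ B₂ σ₂ S₂ c₁ c₂ Θ) {w : Y} {u : G} (h0 : B₁ w + c₁ u = 0) :
    w = 0 ∧ u = 0 := by
  have hu : u = 0 := by
    have := congrArg Θ h0
    rwa [map_add, (h.coord_eq_zero _).2 ⟨_, rfl⟩, h.coord_frame, zero_add, map_zero] at this
  rw [hu, map_zero, add_zero] at h0
  exact ⟨h₁.injective (by rw [h0, map_zero]), hu⟩

/-- `Θ` lives on the first space, so the relation is transferred there: `B₁ w + c₁ u` has the same
pairings as `B₂ w + c₂ u = 0`, hence lies in the image of `B₁` by coisotropy. -/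
lemma injective₂ (h₁ : IsCoisotropicModel B₁ σ₁ S₁ T) (h₂ : IsCoisotropicModel B₂ σ₂ S₂ T)
    (hω : ∀ w w', σ₁ (B₁ w) (B₁ w') = σ₂ (B₂ w) (B₂ w'))
    {c₁ : G →L[ℝ] F} {c₂ : G →L[ℝ] F'} {Θ : F →L[ℝ] G}
    (h : IsAdaptedFrame B₁ σ₁ S₁ B₂ σ₂ S₂ c₁ c₂ Θ) {w : Y} {u : G} (h0 : B₂ w + c₂ u = 0) :
    w = 0 ∧ u = 0 := by
  have hu : u = 0 := by
    obtain ⟨ζ, hζ⟩ := h₁.coisotropic (B₁ w + c₁ u) fun v => by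
      rw [map_add, _root_.add_apply, h.pairing_eq, hω, ← _root_.add_apply, ← map_add, h0]
      simp
    have := (h.coord_eq_zero _).2 ⟨ζ, hζ⟩
    rwa [map_add, (h.coord_eq_zero _).2 ⟨_, rfl⟩, h.coord_frame, zero_add] at this
  rw [hu, map_zero, add_zero] at h0
  exact ⟨h₂.injective (by rw [h0, map_zero]), hu⟩

lemma form_match (h₁ : IsCoisotropicModel B₁ σ₁ S₁ T) (h₂ : IsCoisotropicModel B₂ σ₂ S₂ T)
    (hω : ∀ w w', σ₁ (B₁ w) (B₁ w') = σ₂ (B₂ w) (B₂ w'))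
    {c₁ : G →L[ℝ] F} {c₂ : G →L[ℝ] F'} {Θ : F →L[ℝ] G}
    (h : IsAdaptedFrame B₁ σ₁ S₁ B₂ σ₂ S₂ c₁ c₂ Θ) (w w' : Y) (u u' : G) :
    σ₁ (B₁ w + c₁ u) (B₁ w' + c₁ u') = σ₂ (B₂ w + c₂ u) (B₂ w' + c₂ u') := by
  simp only [map_add, _root_.add_apply, hω, h.pairing_eq, h.form_eq]
  rw [h₁.skew (B₁ w) (c₁ u'), h₂.skew (B₂ w) (c₂ u'), h.pairing_eq]

lemma endo_match (h₁ : IsCoisotropicModel B₁ σ₁ S₁ T) (h₂ : IsCoisotropicModel B₂ σ₂ S₂ T)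
    {c₁ : G →L[ℝ] F} {c₂ : G →L[ℝ] F'} {Θ : F →L[ℝ] G}
    (h : IsAdaptedFrame B₁ σ₁ S₁ B₂ σ₂ S₂ c₁ c₂ Θ) (w : Y) (u : G) :
    ∃ w' u', S₁ (B₁ w + c₁ u) = B₁ w' + c₁ u' ∧ S₂ (B₂ w + c₂ u) = B₂ w' + c₂ u' := by
  obtain ⟨u', e1, e2⟩ := h.endo_eq u
  exact ⟨T w, u', by rw [map_add, e1, h₁.intertwines], by rw [map_add, e2, h₂.intertwines]⟩

end IsAdaptedFrame

end AdaptedFrames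

/-! ### Maps from a vector bundle with prescribed first derivative along the zero section. -/

section TubularMap

open Module

set_option linter.unusedSectionVars false

variable {Y : Type*} [NormedAddCommGroup Y] [NormedSpace ℝ Y]
  {H : Type*} [TopologicalSpace H] {I : ModelWithCorners ℝ Y H} {N : Type*}
  [TopologicalSpace N] [ChartedSpace H N] [IsManifold I ∞ N]
  {F : Type*} [NormedAddCommGroup F] [NormedSpace ℝ F]
  {M : Type*} [TopologicalSpace M] [ChartedSpace F M] [IsManifold 𝓘(ℝ, F) ∞ M]
  {G : Type*} [NormedAddCommGroup G] [NormedSpace ℝ G]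
  {EX : Type*} [NormedAddCommGroup EX] [NormedSpace ℝ EX] {HX : Type*} [TopologicalSpace HX]
  {IX : ModelWithCorners ℝ EX HX} {X : Type*} [TopologicalSpace X] [ChartedSpace HX X]
  {ι : Type*} {Z : VectorBundleCore ℝ N G ι}

lemma SmoothNear.comp {E' : Type*} [NormedAddCommGroup E'] [NormedSpace ℝ E'] {H' : Type*}
    [TopologicalSpace H'] {J : ModelWithCorners ℝ E' H'} {M' : Type*} [TopologicalSpace M']
    [ChartedSpace H' M'] {g : N → M'} {f : X → N} {z : X} (hg : SmoothNear I J g (f z))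
    (hf : SmoothNear IX I f z) : SmoothNear IX J (fun x => g (f x)) z := by
  filter_upwards [hf, hf.contMDiffAt.continuousAt.eventually hg] with x h1 h2
  exact ContMDiffAt.comp x h2 h1

/-- In the product rule the term that differentiates `m` is evaluated on `u z = 0`. -/
lemma tderiv_clm_apply {m : X → (G →L[ℝ] F)} {u : X → G} {z : X}
    (hm : MDifferentiableAt IX 𝓘(ℝ, G →L[ℝ] F) m z) (hu : MDifferentiableAt IX 𝓘(ℝ, G) u z)
    (h0 : u z = 0) : tderiv IX F (fun x => m x (u x)) z = (m z).comp (tderiv IX G u z) := by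
  have hb : HasFDerivAt (fun p : (G →L[ℝ] F) × G => p.1 p.2)
      (isBoundedBilinearMap_apply.deriv (m z, u z)) (m z, u z) :=
    isBoundedBilinearMap_apply.hasFDerivAt (m z, u z)
  have hp : HasMFDerivAt IX 𝓘(ℝ, (G →L[ℝ] F) × G) (fun x => (m x, u x)) z
      ((tderiv IX (G →L[ℝ] F) m z).prod (tderiv IX G u z)) :=
    ⟨hm.hasMFDerivAt.1.prodMk hu.hasMFDerivAt.1, hm.hasMFDerivAt.2.prodMk hu.hasMFDerivAt.2⟩
  have hc := HasMFDerivAt.comp z (g := fun p : (G →L[ℝ] F) × G => p.1 p.2) hb.hasMFDerivAt hp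
  refine hc.mfderiv.trans ?_
  ext v
  change m z (tderiv IX G u z v) + tderiv IX (G →L[ℝ] F) m z v (u z) = m z (tderiv IX G u z v)
  rw [h0, map_zero, add_zero]

lemma smoothNear_proj (z : TotalSpace G Z.Fiber) :
    SmoothNear (I.prod 𝓘(ℝ, G)) I (fun z : TotalSpace G Z.Fiber => z.proj) z :=
  Filter.Eventually.of_forall fun _ => contMDiffAt_proj Z.Fiber

lemma smoothNear_localTriv [Z.IsContMDiff I ∞] (a : ι) {z : TotalSpace G Z.Fiber}
    (hz : z.proj ∈ Z.baseSet a) :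
    SmoothNear (I.prod 𝓘(ℝ, G)) 𝓘(ℝ, G) (fun z => (Z.localTriv a z).2) z := by
  have hopen : IsOpen (Z.localTriv a).source := (Z.localTriv a).open_source
  have : MemTrivializationAtlas (Z.localTriv a) := ⟨⟨a, rfl⟩⟩
  filter_upwards [hopen.mem_nhds ((Z.mem_localTriv_source a z).2 hz)] with y hy
  exact contMDiffAt_snd.comp y (((Z.localTriv a).contMDiffOn (IB := I) (n := ∞)).contMDiffAt
    (hopen.mem_nhds hy))

/-- The derivative of the bundle projection at the zero vector over `x`. -/
def zeroProj (I : ModelWithCorners ℝ Y H) (Z : VectorBundleCore ℝ N G ι) (x : N) :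
    Y × G →L[ℝ] Y :=
  mfderiv (I.prod 𝓘(ℝ, G)) I (fun z : TotalSpace G Z.Fiber => z.proj) (zeroSection G Z.Fiber x)

/-- The vertical component of tangent vectors at the zero vector over `x`. -/
def zeroVert (I : ModelWithCorners ℝ Y H) (Z : VectorBundleCore ℝ N G ι) (x : N) :
    Y × G →L[ℝ] G :=
  tderiv (I.prod 𝓘(ℝ, G)) G (fun z : TotalSpace G Z.Fiber => (Z.localTriv (Z.indexAt x) z).2)
    (zeroSection G Z.Fiber x)

/-- The derivative of the transition function in base directions acts on the fibre coordinate, which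
is zero here. -/
lemma tderiv_localTriv_zero [Z.IsContMDiff I ∞] {a : ι} {x : N} (hx : x ∈ Z.baseSet a) :
    tderiv (I.prod 𝓘(ℝ, G)) G (fun z : TotalSpace G Z.Fiber => (Z.localTriv a z).2)
      (zeroSection G Z.Fiber x) = (Z.coordChange (Z.indexAt x) a x).comp (zeroVert I Z x) := by
  have hx' : x ∈ Z.baseSet (Z.indexAt x) := Z.mem_baseSet_at x
  have hopen : IsOpen (Z.baseSet (Z.indexAt x) ∩ Z.baseSet a) :=
    (Z.isOpen_baseSet _).inter (Z.isOpen_baseSet _)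
  have heq : (fun z : TotalSpace G Z.Fiber => (Z.localTriv a z).2) =ᶠ[𝓝 (zeroSection G Z.Fiber x)]
      fun z => Z.coordChange (Z.indexAt x) a z.proj ((Z.localTriv (Z.indexAt x) z).2) := by
    have hc := Z.continuous_proj.continuousAt (x := zeroSection G Z.Fiber x)
    filter_upwards [hc.preimage_mem_nhds (hopen.mem_nhds ⟨hx', hx⟩)] with z hz
    exact (Z.coordChange_comp _ _ _ _ ⟨⟨Z.mem_baseSet_at _, hz.1⟩, hz.2⟩ _).symm
  rw [tderiv_congr heq]
  have hm : MDifferentiableAt (I.prod 𝓘(ℝ, G)) 𝓘(ℝ, G →L[ℝ] G)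
      (fun z : TotalSpace G Z.Fiber => Z.coordChange (Z.indexAt x) a z.proj)
      (zeroSection G Z.Fiber x) :=
    (((Z.contMDiffOn_coordChange (n := ∞) I (Z.indexAt x) a).contMDiffAt
      (hopen.mem_nhds ⟨hx', hx⟩)).comp (zeroSection G Z.Fiber x)
        (contMDiffAt_proj Z.Fiber)).mdifferentiableAt (by simp)
  have h0 : (Z.localTriv (Z.indexAt x) (zeroSection G Z.Fiber x)).2 = 0 := map_zero _
  exact tderiv_clm_apply hm
    (smoothNear_localTriv (I := I) (Z.indexAt x) (z := zeroSection G Z.Fiber x)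
      hx').mdifferentiableAt h0

/-- A map from the total space of a vector bundle to `M` with prescribed values and first derivatives
along the zero section. -/
theorem exists_tubular_map [Z.IsContMDiff I ∞] {i : N → M} (hi : ContMDiff I 𝓘(ℝ, F) ∞ i)
    (ρ : SmoothPartitionOfUnity ℕ I N univ) (idx : ℕ → ι) (q : ℕ → M) (c : ℕ → N → (G →L[ℝ] F))
    (hidx : ∀ a, ∀ x ∈ tsupport (ρ a), x ∈ Z.baseSet (idx a))
    (hq : ∀ a, ∀ x ∈ tsupport (ρ a), i x ∈ (chartAt F (q a)).source)
    (hc : ∀ a, ∀ x ∈ tsupport (ρ a), SmoothNear I 𝓘(ℝ, G →L[ℝ] F) (c a) x) :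
    ∃ Φ : TotalSpace G Z.Fiber → M, ∀ x, Φ (zeroSection G Z.Fiber x) = i x ∧
      SmoothNear (I.prod 𝓘(ℝ, G)) 𝓘(ℝ, F) Φ (zeroSection G Z.Fiber x) ∧
      ∃ n, (∀ a ≥ n, ρ a x = 0) ∧ tderiv (I.prod 𝓘(ℝ, G)) F Φ (zeroSection G Z.Fiber x) =
        (tderiv I F i x).comp (zeroProj I Z x) +
        (∑ a ∈ Finset.range n, ρ a x • ((fromChart 𝓘(ℝ, F) (q a) (i x)).comp (c a x)).comp
          (Z.coordChange (Z.indexAt x) (idx a) x)).comp (zeroVert I Z x) := by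
  -- The cutoff `ρ a` makes `δ a` vanish near points outside its support, where `c a` need not be
  -- smooth; linearity in the fibre makes it vanish on the zero section.
  let δ : ℕ → TotalSpace G Z.Fiber → F := fun a z =>
    (ρ a z.proj • c a z.proj) ((Z.localTriv (idx a) z).2)
  let b : TotalSpace G Z.Fiber → M := fun z => i z.proj
  refine ⟨chartAddLimit b q δ, fun x => ?_⟩
  set z₀ := zeroSection G Z.Fiber x with hz₀
  have hcont : ContinuousAt (fun z : TotalSpace G Z.Fiber => z.proj) z₀ :=
    Z.continuous_proj.continuousAt
  have hb : SmoothNear (I.prod 𝓘(ℝ, G)) 𝓘(ℝ, F) b z₀ :=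
    SmoothNear.comp (g := i) (Filter.Eventually.of_forall fun y => hi y) (smoothNear_proj z₀)
  have hm : ∀ a, x ∈ tsupport (ρ a) → SmoothNear (I.prod 𝓘(ℝ, G)) 𝓘(ℝ, G →L[ℝ] F)
      (fun z : TotalSpace G Z.Fiber => ρ a z.proj • c a z.proj) z₀ := by
    intro a ha
    have h1 : SmoothNear I 𝓘(ℝ, G →L[ℝ] F) (fun y => ρ a y • c a y) x := by
      filter_upwards [hc a x ha] with y hy
      exact (ρ a).contMDiff.contMDiffAt.smul hy
    exact SmoothNear.comp (f := fun z : TotalSpace G Z.Fiber => z.proj) (z := z₀) h1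
      (smoothNear_proj z₀)
  have h0 : ∀ a, (Z.localTriv (idx a) z₀).2 = 0 := fun a => map_zero _
  have hnear : ∀ a, x ∉ tsupport (ρ a) → δ a =ᶠ[𝓝 z₀] 0 := by
    intro a ha
    filter_upwards [hcont.eventually (notMem_tsupport_iff_eventuallyEq.1 ha)] with z hz
    have hz' : ρ a z.proj = 0 := hz
    simp [δ, hz']
  obtain ⟨n, hn⟩ : ∃ n, ∀ a ∈ ρ.fintsupport x, a < n :=
    ⟨(ρ.fintsupport x).sup id + 1, fun a ha => Nat.lt_succ_of_le (Finset.le_sup (f := id) ha)⟩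
  have hfin : ∀ᶠ y in 𝓝 x, ∀ a ≥ n, ρ a y = 0 := by
    filter_upwards [ρ.eventually_finsupport_subset x] with y hy a ha
    by_contra hne
    exact absurd (hn a (hy ((ρ.mem_finsupport y).2 hne))) (by omega)
  have hδ : ∀ᶠ z in 𝓝 z₀, ∀ a ≥ n, δ a z = 0 := by
    filter_upwards [hcont.eventually hfin] with z hz a ha
    simp [δ, hz a ha]
  obtain ⟨h1, h2, h3⟩ := chartAddLimit_spec (q := q) (δ := δ) hb (fun a => by
    by_cases ha : x ∈ tsupport (ρ a)
    · exact Or.inl ⟨hq a x ha, (hm a ha).clm_apply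
        (smoothNear_localTriv (idx a) (z := z₀) (hidx a x ha)), by simp only [δ, h0, map_zero]⟩
    · exact Or.inr (hnear a ha)) hδ
  refine ⟨h1, h2, n, hfin.self_of_nhds, ?_⟩
  have hbd : tderiv (I.prod 𝓘(ℝ, G)) F b z₀ = (tderiv I F i x).comp (zeroProj I Z x) :=
    mfderiv_comp (I' := I) z₀ (hi.mdifferentiableAt (by simp))
      ((smoothNear_proj z₀).contMDiffAt.mdifferentiableAt (by simp))
  rw [h3, hbd]
  congr 1
  rw [ContinuousLinearMap.finsetSum_comp]
  refine Finset.sum_congr rfl fun a _ => ?_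
  by_cases ha : x ∈ tsupport (ρ a)
  · have hd : tderiv (I.prod 𝓘(ℝ, G)) F (δ a) z₀ = (ρ a x • c a x).comp
        ((Z.coordChange (Z.indexAt x) (idx a) x).comp (zeroVert I Z x)) := by
      rw [← tderiv_localTriv_zero (hidx a x ha)]
      exact tderiv_clm_apply ((hm a ha).contMDiffAt.mdifferentiableAt (by simp))
        (smoothNear_localTriv (idx a) (z := z₀) (hidx a x ha)).mdifferentiableAt (h0 a)
    rw [hd]
    refine ContinuousLinearMap.ext fun v => ?_
    simp only [ContinuousLinearMap.comp_apply, _root_.smul_apply, map_smul]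
    rfl
  · have hd : tderiv (I.prod 𝓘(ℝ, G)) F (δ a) z₀ = 0 := by
      rw [tderiv_congr (hnear a ha)]
      exact tderiv_const 0 z₀
    have hr : ρ a x = 0 := image_eq_zero_of_notMem_tsupport ha
    rw [hd, hr]
    simp

/-- The derivative of the zero section realizes `(w, 0)` and that of the fibre inclusion realizes
`(0, u)`; their sum is the required vector. -/
lemma exists_zeroProj_zeroVert [Z.IsContMDiff I ∞] (x : N) (w : Y) (u : G) :
    ∃ ζ, zeroProj I Z x ζ = w ∧ zeroVert I Z x ζ = u := by
  set z₀ := zeroSection G Z.Fiber x with hz₀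
  have hpd : MDifferentiableAt (I.prod 𝓘(ℝ, G)) I (fun z : TotalSpace G Z.Fiber => z.proj) z₀ :=
    (smoothNear_proj z₀).contMDiffAt.mdifferentiableAt (by simp)
  have hvd : MDifferentiableAt (I.prod 𝓘(ℝ, G)) 𝓘(ℝ, G)
      (fun z : TotalSpace G Z.Fiber => (Z.localTriv (Z.indexAt x) z).2) z₀ :=
    (smoothNear_localTriv (I := I) (Z.indexAt x) (z := z₀)
      (Z.mem_baseSet_at x)).mdifferentiableAt
  have hsd : MDifferentiableAt I (I.prod 𝓘(ℝ, G)) (zeroSection G Z.Fiber) x :=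
    (contMDiff_zeroSection ℝ Z.Fiber (n := ∞) x).mdifferentiableAt (by simp)
  have hfd : MDifferentiableAt 𝓘(ℝ, G) (I.prod 𝓘(ℝ, G))
      (fun g : G => (⟨x, g⟩ : TotalSpace G Z.Fiber)) 0 := by
    refine ContMDiffAt.mdifferentiableAt (n := ∞) (contMDiffAt_totalSpace.2 ⟨contMDiffAt_const, ?_⟩)
      (by simp)
    refine contMDiffAt_id.congr_of_eventuallyEq (Filter.Eventually.of_forall fun g => ?_)
    exact congrArg Prod.snd (Z.localTrivAt_apply_mk x g)
  let ζ₁ : Y × G := mfderiv I (I.prod 𝓘(ℝ, G)) (zeroSection G Z.Fiber) x w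
  let ζ₂ : Y × G := mfderiv 𝓘(ℝ, G) (I.prod 𝓘(ℝ, G))
    (fun g : G => (⟨x, g⟩ : TotalSpace G Z.Fiber)) 0 u
  have e1 : zeroProj I Z x ζ₁ = w := by
    have h := mfderiv_comp x hpd hsd
    exact (DFunLike.congr_fun h w).symm.trans (DFunLike.congr_fun (mfderiv_id (I := I) (x := x)) w)
  have e2 : zeroVert I Z x ζ₁ = 0 := by
    have h := mfderiv_comp x hvd hsd
    have heq : (fun z : TotalSpace G Z.Fiber => (Z.localTriv (Z.indexAt x) z).2) ∘
        zeroSection G Z.Fiber = fun _ => 0 := by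
      funext y
      exact map_zero _
    rw [heq, mfderiv_const] at h
    exact (DFunLike.congr_fun h w).symm
  have e3 : zeroProj I Z x ζ₂ = 0 := by
    have h := mfderiv_comp (0 : G) hpd hfd
    have heq : (fun z : TotalSpace G Z.Fiber => z.proj) ∘
        (fun g : G => (⟨x, g⟩ : TotalSpace G Z.Fiber)) = fun _ => x := rfl
    rw [heq, mfderiv_const] at h
    exact (DFunLike.congr_fun h u).symm
  have e4 : zeroVert I Z x ζ₂ = u := by
    have h := mfderiv_comp (0 : G) hvd hfd
    have heq : (fun z : TotalSpace G Z.Fiber => (Z.localTriv (Z.indexAt x) z).2) ∘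
        (fun g : G => (⟨x, g⟩ : TotalSpace G Z.Fiber)) = id := by
      funext g
      exact congrArg Prod.snd (Z.localTrivAt_apply_mk x g)
    rw [heq] at h
    exact (DFunLike.congr_fun h u).symm.trans
      (DFunLike.congr_fun (mfderiv_id (I := 𝓘(ℝ, G)) (x := (0 : G))) u)
  exact ⟨ζ₁ + ζ₂, by rw [map_add, e1, e3, add_zero], by rw [map_add, e2, e4, zero_add]⟩

end TubularMap

/-! ### The common normal bundle and the pair of tubular maps. -/

section AdaptedAtlas

open Module

set_option linter.unusedSectionVars false

variable {Y : Type*} [NormedAddCommGroup Y] [NormedSpace ℝ Y]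
  {H : Type*} [TopologicalSpace H] {I : ModelWithCorners ℝ Y H} {N : Type*}
  [TopologicalSpace N] [ChartedSpace H N] [IsManifold I ∞ N]
  {F : Type*} [NormedAddCommGroup F] [NormedSpace ℝ F]
  {M : Type*} [TopologicalSpace M] [ChartedSpace F M] [IsManifold 𝓘(ℝ, F) ∞ M]
  {F' : Type*} [NormedAddCommGroup F'] [NormedSpace ℝ F']
  {M' : Type*} [TopologicalSpace M'] [ChartedSpace F' M'] [IsManifold 𝓘(ℝ, F') ∞ M']
  {G : Type*} [NormedAddCommGroup G] [NormedSpace ℝ G]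
  [FiniteDimensional ℝ Y] [FiniteDimensional ℝ F] [FiniteDimensional ℝ F']
  [FiniteDimensional ℝ G]

lemma sum_range_smul_of_le {V : Type*} [AddCommGroup V] [Module ℝ V] {f : ℕ → V} {ρ : ℕ → ℝ}
    {m n : ℕ} (hmn : m ≤ n) (h : ∀ a ≥ m, ρ a = 0) :
    ∑ a ∈ Finset.range m, ρ a • f a = ∑ a ∈ Finset.range n, ρ a • f a :=
  Finset.sum_subset (Finset.range_mono hmn) fun a _ ha => by
    rw [h a (by simpa using ha), zero_smul]

/-- Both normal bundles are identified with one vector bundle, and there are maps from its total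
space to `M` and `M'` whose first derivatives along the zero section form an adapted frame. -/
theorem exists_tubular_map_pair [T2Space N] [SigmaCompactSpace N] [Nonempty N]
    {T : N → (Y →L[ℝ] Y)} {i₁ : N → M} {σ₁ : DiffForm 𝓘(ℝ, F) M 2}
    {S₁ : ∀ x : M, TangentSpace 𝓘(ℝ, F) x →L[ℝ] TangentSpace 𝓘(ℝ, F) x}
    (h₁ : IsCoisotropicImmersion I T i₁ σ₁ S₁) {i₂ : N → M'} {σ₂ : DiffForm 𝓘(ℝ, F') M' 2}
    {S₂ : ∀ x : M', TangentSpace 𝓘(ℝ, F') x →L[ℝ] TangentSpace 𝓘(ℝ, F') x}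
    (h₂ : IsCoisotropicImmersion I T i₂ σ₂ S₂)
    (hω : ∀ x w w', bilin (F := F) (σ₁ (i₁ x)) (tderiv I F i₁ x w) (tderiv I F i₁ x w') =
      bilin (F := F') (σ₂ (i₂ x)) (tderiv I F' i₂ x w) (tderiv I F' i₂ x w'))
    (hG : finrank ℝ F = finrank ℝ Y + finrank ℝ G) :
    ∃ Z : VectorBundleCore ℝ N G N, Z.IsContMDiff I ∞ ∧
      ∃ (Φ₁ : TotalSpace G Z.Fiber → M) (Φ₂ : TotalSpace G Z.Fiber → M'), ∀ x,
        Φ₁ (zeroSection G Z.Fiber x) = i₁ x ∧ Φ₂ (zeroSection G Z.Fiber x) = i₂ x ∧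
        SmoothNear (I.prod 𝓘(ℝ, G)) 𝓘(ℝ, F) Φ₁ (zeroSection G Z.Fiber x) ∧
        SmoothNear (I.prod 𝓘(ℝ, G)) 𝓘(ℝ, F') Φ₂ (zeroSection G Z.Fiber x) ∧
        ∃ j₁ j₂ Θ, IsAdaptedFrame (tderiv I F i₁ x) (bilin (F := F) (σ₁ (i₁ x))) (S₁ (i₁ x))
          (tderiv I F' i₂ x) (bilin (F := F') (σ₂ (i₂ x))) (S₂ (i₂ x)) j₁ j₂ Θ ∧
          tderiv (I.prod 𝓘(ℝ, G)) F Φ₁ (zeroSection G Z.Fiber x) =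
            (tderiv I F i₁ x).comp (zeroProj I Z x) + j₁.comp (zeroVert I Z x) ∧
          tderiv (I.prod 𝓘(ℝ, G)) F' Φ₂ (zeroSection G Z.Fiber x) =
            (tderiv I F' i₂ x).comp (zeroProj I Z x) + j₂.comp (zeroVert I Z x) := by
  choose c₁ c₂ Θ hc₁ hc₂ hΘ hfr using exists_local_adapted_frame (G := G) h₁ h₂ hω hG
  have hU : ∀ p, ∃ U : Set N, IsOpen U ∧ p ∈ U ∧ ∀ x ∈ U,
      SmoothNear I 𝓘(ℝ, G →L[ℝ] F) (c₁ p) x ∧ SmoothNear I 𝓘(ℝ, G →L[ℝ] F') (c₂ p) x ∧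
      SmoothNear I 𝓘(ℝ, F →L[ℝ] G) (Θ p) x ∧ i₁ x ∈ (chartAt F (i₁ p)).source ∧
      i₂ x ∈ (chartAt F' (i₂ p)).source ∧
      IsAdaptedFrame (tderiv I F i₁ x) (bilin (F := F) (σ₁ (i₁ x))) (S₁ (i₁ x))
        (tderiv I F' i₂ x) (bilin (F := F') (σ₂ (i₂ x))) (S₂ (i₂ x))
        ((fromChart 𝓘(ℝ, F) (i₁ p) (i₁ x)).comp (c₁ p x))
        ((fromChart 𝓘(ℝ, F') (i₂ p) (i₂ x)).comp (c₂ p x))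
        ((Θ p x).comp (toChart 𝓘(ℝ, F) (i₁ p) (i₁ x))) := by
    intro p
    obtain ⟨U, hUs, hUo, hpU⟩ := eventually_nhds_iff.1 <|
      (hc₁ p).eventually_nhds.and <| (hc₂ p).eventually_nhds.and <| (hΘ p).eventually_nhds.and <|
      (h₁.eventually_mem_source p).and <| (h₂.eventually_mem_source p).and (hfr p)
    exact ⟨U, hUo, hpU, hUs⟩
  choose U hUo hpU hc₁ hc₂ hΘ hs₁ hs₂ hfr using hU
  -- These are the transition functions of the normal bundle of `i₁`. The same cocycle serves `i₂`,
  -- since `c₂ p` is parametrized by the same coordinates as `c₁ p`.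
  let cc : N → N → N → (G →L[ℝ] G) := fun p p' x =>
    ((Θ p' x).comp (toChart 𝓘(ℝ, F) (i₁ p') (i₁ x))).comp
      ((fromChart 𝓘(ℝ, F) (i₁ p) (i₁ x)).comp (c₁ p x))
  have hcc : ∀ p p', ContMDiffOn I 𝓘(ℝ, G →L[ℝ] G) ∞ (cc p p') (U p ∩ U p') := by
    intro p p' x hx
    have ht := (contMDiffAt_toChart_comp_fromChart (I := 𝓘(ℝ, F)) (hs₁ p' x hx.2)
      (hs₁ p x hx.1)).comp x h₁.smooth.contMDiffAt
    exact (((hΘ p' x hx.2).contMDiffAt.clm_comp ht).clm_comp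
      (hc₁ p x hx.1).contMDiffAt).contMDiffWithinAt
  let Z : VectorBundleCore ℝ N G N :=
    { baseSet := U
      isOpen_baseSet := hUo
      indexAt := id
      mem_baseSet_at := hpU
      coordChange := cc
      coordChange_self := fun p x hx v => (hfr p x hx).coord_frame v
      continuousOn_coordChange := fun p p' => (hcc p p').continuousOn
      coordChange_comp := fun p p' p'' x hx v =>
        (hfr p' x hx.1.2).coord_change (hfr p'' x hx.2) _ }
  have hZ : Z.IsContMDiff I ∞ := ⟨hcc⟩
  refine ⟨Z, hZ, ?_⟩
  -- A countable cover allows a partition of unity indexed by `ℕ`, the order in which the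
  -- translations are performed.
  obtain ⟨s, hsc, hsu⟩ := countable_cover_nhds_of_sigmaCompact
    fun p => (hUo p).mem_nhds (hpU p)
  have hsn : s.Nonempty := by
    obtain ⟨x⟩ := ‹Nonempty N›
    obtain ⟨p, hp, -⟩ := mem_iUnion₂.1 (hsu.symm ▸ mem_univ x)
    exact ⟨p, hp⟩
  obtain ⟨pt, rfl⟩ := hsc.exists_eq_range hsn
  obtain ⟨ρ, hρ⟩ := SmoothPartitionOfUnity.exists_isSubordinate I isClosed_univ
    (fun a => U (pt a)) (fun a => hUo _) (by rw [← hsu, biUnion_range])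
  obtain ⟨Φ₁, hΦ₁⟩ := exists_tubular_map (Z := Z) h₁.smooth ρ pt (fun a => i₁ (pt a))
    (fun a => c₁ (pt a)) hρ (fun a x hx => hs₁ _ x (hρ a hx)) (fun a x hx => hc₁ _ x (hρ a hx))
  obtain ⟨Φ₂, hΦ₂⟩ := exists_tubular_map (Z := Z) h₂.smooth ρ pt (fun a => i₂ (pt a))
    (fun a => c₂ (pt a)) hρ (fun a x hx => hs₂ _ x (hρ a hx)) (fun a x hx => hc₂ _ x (hρ a hx))
  refine ⟨Φ₁, Φ₂, fun x => ?_⟩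
  obtain ⟨v₁, m₁, n₁, z₁, d₁⟩ := hΦ₁ x
  obtain ⟨v₂, m₂, n₂, z₂, d₂⟩ := hΦ₂ x
  refine ⟨v₁, v₂, m₁, m₂, ?_⟩
  have hsum : ∑ a ∈ Finset.range (max n₁ n₂), ρ a x = 1 := by
    refine ρ.sum_finsupport' x (mem_univ x) fun a ha => ?_
    rw [Finset.mem_range]
    by_contra hle
    exact (ρ.mem_finsupport x).1 ha (z₁ a ((le_max_left _ _).trans (not_lt.1 hle)))
  -- `Z.indexAt x` is `x` itself, so with the frame centred at `x` as reference, the coordinate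
  -- changes in the derivatives of `Φ₁` and `Φ₂` are exactly the maps `Θ' ∘ c₁` of `convexComb`.
  have hF := (hfr x x (hpU x)).convexComb (h₁.model x) (h₂.model x) (hω x)
    (Finset.range (max n₁ n₂)) (fun a => ρ a x) hsum (fun a _ ha => hfr (pt a) x
      (hρ a (subset_tsupport _ ha)))
  refine ⟨_, _, _, hF, ?_, ?_⟩
  · rw [d₁, sum_range_smul_of_le (le_max_left n₁ n₂) z₁]
    rfl
  · rw [d₂, sum_range_smul_of_le (le_max_right n₁ n₂) z₂]
    rfl

end AdaptedAtlas

/-! ### The inverse function theorem on manifolds. -/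

section InverseFunction

open Module

variable {EX : Type*} [NormedAddCommGroup EX] [NormedSpace ℝ EX] {HX : Type*} [TopologicalSpace HX]
  {IX : ModelWithCorners ℝ EX HX} {X : Type*} [TopologicalSpace X] [ChartedSpace HX X]
  {F : Type*} [NormedAddCommGroup F] [NormedSpace ℝ F]
  {M : Type*} [TopologicalSpace M] [ChartedSpace F M]

/-- `f` restricts to a diffeomorphism `e` between open subsets. -/
structure IsDiffeoOn (IX : ModelWithCorners ℝ EX HX) (F : Type*) [NormedAddCommGroup F]
    [NormedSpace ℝ F] {M : Type*} [TopologicalSpace M] [ChartedSpace F M] (f : X → M)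
    (e : OpenPartialHomeomorph X M) : Prop where
  eqOn : EqOn f e e.source
  smooth : ContMDiffOn IX 𝓘(ℝ, F) ∞ e e.source
  smooth_symm : ContMDiffOn 𝓘(ℝ, F) IX ∞ e.symm e.target

/-- The inverse function theorem for maps between manifolds without boundary. -/
theorem SmoothNear.exists_isDiffeoOn [IX.Boundaryless] [IsManifold IX ∞ X]
    [IsManifold 𝓘(ℝ, F) ∞ M] [CompleteSpace EX] {f : X → M} {z : X}
    (hf : SmoothNear IX 𝓘(ℝ, F) f z) {L : EX ≃L[ℝ] F} (hL : tderiv IX F f z = L) :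
    ∃ e : OpenPartialHomeomorph X M, z ∈ e.source ∧ IsDiffeoOn IX F f e := by
  set φ := extChartAt IX z with hφ
  set χ := extChartAt 𝓘(ℝ, F) (f z) with hχ
  set a := φ z with ha
  set g : EX → F := χ ∘ f ∘ φ.symm with hg
  have hφo : IsOpen φ.target := isOpen_extChartAt_target z
  have haφ : a ∈ φ.target := mem_extChartAt_target z
  have hφa : φ.symm a = z := extChartAt_to_inv z
  have hcont : ContinuousAt φ.symm a := continuousAt_extChartAt_symm z
  have hev : ∀ᶠ y in 𝓝 a, ContMDiffAt IX 𝓘(ℝ, F) ∞ f (φ.symm y) ∧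
      f (φ.symm y) ∈ (chartAt F (f z)).source := by
    refine hcont.eventually (p := fun x => ContMDiffAt IX 𝓘(ℝ, F) ∞ f x ∧
      f x ∈ (chartAt F (f z)).source) ?_
    rw [hφa]
    exact hf.and (hf.contMDiffAt.continuousAt.eventually (chart_source_mem_nhds F (f z)))
  have hgs : ∀ᶠ y in 𝓝 a, ContDiffAt ℝ ∞ g y := by
    filter_upwards [hev, hφo.mem_nhds haφ] with y hy hyt
    refine contMDiffAt_iff_contDiffAt.1 ?_
    exact (contMDiffAt_extChartAt' (I := 𝓘(ℝ, F)) hy.2).comp y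
      (hy.1.comp y ((contMDiffOn_extChartAt_symm z).contMDiffAt (hφo.mem_nhds hyt)))
  have hga : ContDiffAt ℝ ∞ g a := hgs.self_of_nhds
  have hgd : HasFDerivAt g (L : EX →L[ℝ] F) a := by
    have h : HasFDerivWithinAt g (tderiv IX F f z) (range IX) a :=
      (hf.contMDiffAt.mdifferentiableAt (by simp)).hasMFDerivAt.2
    rw [IX.range_eq_univ, hasFDerivWithinAt_univ] at h
    rw [← hL]
    exact h
  have hder : ∀ᶠ y in 𝓝 a, fderiv ℝ g y ∈ range ((↑) : (EX ≃L[ℝ] F) → EX →L[ℝ] F) := by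
    have hc : ContinuousAt (fderiv ℝ g) a := (hga.fderiv_right (m := 0) (by simp)).continuousAt
    refine hc.eventually ?_
    rw [hgd.fderiv]
    exact ContinuousLinearEquiv.nhds L
  set R := hga.toOpenPartialHomeomorph g hgd (by simp) with hR
  have hRg : (R : EX → F) = g := rfl
  have haR : a ∈ R.source := hga.mem_toOpenPartialHomeomorph_source hgd (by simp)
  -- The inverse has to be smooth on its whole domain, so the source is cut down to points where `g`
  -- is smooth with invertible derivative.
  obtain ⟨W, hW, hWo, haW⟩ := eventually_nhds_iff.1 (hev.and (hgs.and hder))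
  set R' := R.restrOpen W hWo with hR'
  set cX := (chartAt HX z).trans IX.toHomeomorph.toOpenPartialHomeomorph with hcX
  set e := (cX.trans R').trans (chartAt F (f z)).symm with he
  have hsrc : ∀ x, x ∈ e.source ↔ x ∈ (chartAt HX z).source ∧ φ x ∈ R.source ∧ φ x ∈ W ∧
      g (φ x) ∈ (chartAt F (f z)).target := by
    intro x
    simp [he, hcX, hR', hφ, hRg, extChartAt, and_assoc]
  have hgφ : ∀ x ∈ (chartAt HX z).source, g (φ x) = chartAt F (f z) (f x) := fun x hx => by
    simp only [hg, Function.comp_apply, hφ]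
    rw [(extChartAt IX z).left_inv (by rwa [extChartAt_source])]
    rfl
  have heq : EqOn f e e.source := by
    intro x hx
    obtain ⟨h1, -, h3, -⟩ := (hsrc x).1 hx
    have h4 := (hW _ h3).1.2
    rw [hφ, (extChartAt IX z).left_inv (by rwa [extChartAt_source])] at h4
    have h5 : e x = (chartAt F (f z)).symm (g (φ x)) := rfl
    rw [h5, hgφ x h1, (chartAt F (f z)).left_inv h4]
  refine ⟨e, ?_, heq, ?_, ?_⟩
  · refine (hsrc z).2 ⟨mem_chart_source HX z, haR, haW, ?_⟩
    rw [hgφ z (mem_chart_source HX z)]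
    exact mem_chart_target F (f z)
  · intro x hx
    obtain ⟨h1, -, h3, -⟩ := (hsrc x).1 hx
    have h4 := (hW _ h3).1.1
    rw [hφ, (extChartAt IX z).left_inv (by rwa [extChartAt_source])] at h4
    exact (h4.congr_of_eventuallyEq (Filter.eventuallyEq_of_mem (e.open_source.mem_nhds hx)
      heq.symm)).contMDiffWithinAt
  · intro y hy
    set x := e.symm y with hx
    have hxs : x ∈ e.source := e.map_target hy
    have hy1 : y ∈ (chartAt F (f z)).source := by
      have := hy.1
      simpa using this
    have hy2 : χ y ∈ R'.target := by
      have := hy.2.1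
      simpa [hχ, extChartAt] using this
    set b := R.symm (χ y) with hb
    have hbR : b ∈ R'.source := R'.map_target hy2
    have hbφ : b ∈ φ.target := by
      rw [hφ, extChartAt_target, IX.range_eq_univ, inter_univ]
      have h3 := hy.2.2
      simp only [hcX, mfld_simps] at h3
      exact h3
    have hbW := hW b hbR.2
    have hχs : ContMDiffAt 𝓘(ℝ, F) 𝓘(ℝ, F) ∞ χ y := contMDiffAt_extChartAt' hy1
    obtain ⟨L', hL'⟩ := hbW.2.2
    have hRs : ContDiffAt ℝ ∞ R.symm (χ y) :=
      R.contDiffAt_symm (f₀' := L') hy2.1 (by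
        rw [hL', hRg]
        exact (hbW.2.1.differentiableAt (by simp)).hasFDerivAt) hbW.2.1
    have hφs : ContMDiffAt 𝓘(ℝ, EX) IX ∞ φ.symm b :=
      (contMDiffOn_extChartAt_symm z).contMDiffAt (hφo.mem_nhds hbφ)
    exact (hφs.comp y (hRs.contMDiffAt.comp y hχs)).contMDiffWithinAt

end InverseFunction

/-! ### Injectivity near a subspace onto which the space contracts. -/

section Contraction

variable {X N M : Type*} [TopologicalSpace X] [TopologicalSpace N]

/-- A map that is a local homeomorphism near a subspace `s(N)` onto which `X` contracts, and a
topological embedding of that subspace, is injective on a neighbourhood of it which is stable under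
the contraction. -/
theorem exists_isOpen_injOn [TopologicalSpace M] [TopologicalSpace.MetrizableSpace M] [T2Space X]
    {s : N → X} (hs : Continuous s)
    {pr : X → N} {h : ℝ → X → X} (hc : Continuous fun p : ℝ × X => h p.1 p.2)
    (h0 : ∀ z, h 0 z = s (pr z)) (h1 : ∀ z, h 1 z = z) (hhs : ∀ t x, h t (s x) = s x)
    (hh : ∀ t t' z, h t (h t' z) = h (t * t') z) {f : X → M} (hf : IsEmbedding fun x => f (s x))
    {e : N → OpenPartialHomeomorph X M} (hse : ∀ x, s x ∈ (e x).source)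
    (he : ∀ x, EqOn f (e x) (e x).source) :
    ∃ O : Set X, IsOpen O ∧ (∀ x, s x ∈ O) ∧ (∀ z ∈ O, ∀ t ∈ Icc (0 : ℝ) 1, h t z ∈ O) ∧
      InjOn f O ∧ ∀ z ∈ O, ∃ x, z ∈ (e x).source := by
  let _ := TopologicalSpace.metrizableSpaceMetric M
  -- Since `f ∘ s` is an embedding, whether `s y` lies in the source of `e x` can be tested on `f (s
  -- y)` by an open set of `M`.
  have hG : ∀ x, ∃ U : Set M, IsOpen U ∧ (fun y => f (s y)) ⁻¹' U = s ⁻¹' (e x).source := fun x =>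
    hf.isInducing.isOpen_iff.1 ((e x).open_source.preimage hs)
  choose U hUo hU using hG
  have hfs : ∀ x, f (s x) ∈ (e x).target ∩ U x := fun x => by
    refine ⟨?_, ?_⟩
    · rw [he x (hse x)]
      exact (e x).map_source (hse x)
    · have : x ∈ (fun y => f (s y)) ⁻¹' U x := by
        rw [hU x]
        exact hse x
      exact this
  -- The factor `3` leaves room for the triangle inequality below, with two distances less than `r
  -- x'` and one less than `r x`.
  have hr : ∀ x, ∃ r > 0, Metric.ball (f (s x)) (3 * r) ⊆ (e x).target ∩ U x := fun x => by
    obtain ⟨ε, hε, hb⟩ := Metric.isOpen_iff.1 ((e x).open_target.inter (hUo x)) _ (hfs x)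
    exact ⟨ε / 3, by positivity, by rwa [mul_div_cancel₀ _ (by norm_num)]⟩
  choose r hr hb using hr
  let D : N → Set X := fun x => (e x).source ∩ e x ⁻¹' Metric.ball (f (s x)) (r x)
  have hDo : ∀ x, IsOpen (D x) := fun x => (e x).isOpen_inter_preimage Metric.isOpen_ball
  -- Points whose whole contraction path stays in `D x`; compactness of the parameter interval makes
  -- this set open.
  let O : N → Set X := fun x => {z | ∀ t ∈ Icc (0 : ℝ) 1, h t z ∈ D x}
  have hOo : ∀ x, IsOpen (O x) := fun x => by
    rw [isOpen_iff_eventually]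
    intro z hz
    refine isCompact_Icc.eventually_forall_of_forall_eventually fun t ht => ?_
    have hc' : Continuous fun p : X × ℝ => h p.2 p.1 := hc.comp continuous_swap
    exact (hc'.tendsto (z, t)).eventually ((hDo x).mem_nhds (hz t ht))
  have hOD : ∀ x, ∀ z ∈ O x, z ∈ D x := fun x z hz => by
    simpa [h1] using hz 1 (by simp)
  -- The image under `f` of the contraction path of `z'` stays in the target of `e x`, so it lifts
  -- through `e x`. The lift agrees with the path at `t = 0` by the choice of `U x`, and the set of
  -- agreement is clopen. Hence `z'` lies in the source of `e x`, where `f` is injective.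
  have key : ∀ x x' z z', z ∈ O x → z' ∈ O x' → f z = f z' → r x' ≤ r x → z = z' := by
    intro x x' z z' hz hz' hzz hle
    have hcz : Continuous fun t : unitInterval => h t z' :=
      hc.comp (continuous_subtype_val.prodMk continuous_const)
    have hfc : ∀ t : unitInterval, f (h t z') = e x' (h t z') := fun t => he x' (hz' t t.2).1
    have hd : ∀ t : unitInterval, f (h t z') ∈ Metric.ball (f (s x)) (3 * r x) := fun t => by
      have d1 : dist (f (h t z')) (f (s x')) < r x' := by
        rw [hfc t]
        exact (hz' t t.2).2
      have d2 : dist (f z') (f (s x')) < r x' := by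
        have := hOD x' z' hz'
        rw [he x' this.1]
        exact this.2
      have d3 : dist (f z') (f (s x)) < r x := by
        have := hOD x z hz
        rw [← hzz, he x this.1]
        exact this.2
      have d4 := dist_triangle4 (f (h t z')) (f (s x')) (f z') (f (s x))
      rw [dist_comm (f (s x')) (f z')] at d4
      rw [Metric.mem_ball]
      linarith
    have hγ : Continuous fun t : unitInterval => (e x).symm (f (h t z')) := by
      have hcf : Continuous fun t : unitInterval => f (h t z') := by
        simp_rw [hfc]
        exact (e x').continuousOn.comp_continuous hcz fun t => (hz' t t.2).1
      exact (e x).symm.continuousOn.comp_continuous hcf fun t => (hb x (hd t)).1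
    have heq : {t : unitInterval | h t z' = (e x).symm (f (h t z'))} =
        (fun t : unitInterval => h t z') ⁻¹' (e x).source := by
      ext t
      refine ⟨fun ht => ?_, fun ht => ?_⟩
      · rw [mem_preimage, show h t z' = (e x).symm (f (h t z')) from ht]
        exact (e x).map_target (hb x (hd t)).1
      · have ht' : h t z' ∈ (e x).source := ht
        rw [mem_ofPred_eq, he x ht', (e x).left_inv ht']
    have hclopen : IsClopen {t : unitInterval | h t z' = (e x).symm (f (h t z'))} :=
      ⟨isClosed_eq hcz hγ, heq ▸ (e x).open_source.preimage hcz⟩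
    have h0mem : (0 : unitInterval) ∈ {t : unitInterval | h t z' = (e x).symm (f (h t z'))} := by
      rw [heq, mem_preimage]
      have hm := (hb x (hd 0)).2
      rw [Set.Icc.coe_zero, h0] at hm ⊢
      have : pr z' ∈ (fun y => f (s y)) ⁻¹' U x := hm
      rwa [hU x] at this
    have h1mem : (1 : unitInterval) ∈ {t : unitInterval | h t z' = (e x).symm (f (h t z'))} := by
      rw [hclopen.eq_univ ⟨_, h0mem⟩]
      trivial
    have h1' : z' = (e x).symm (f z') := by simpa [h1] using h1mem
    have hzD := hOD x z hz
    rw [h1', ← hzz, he x hzD.1, (e x).left_inv hzD.1]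
  refine ⟨⋃ x, O x, isOpen_iUnion hOo, fun x => ?_, fun z hz t ht => ?_, ?_, fun z hz => ?_⟩
  · refine mem_iUnion.2 ⟨x, fun t _ => ?_⟩
    rw [hhs]
    refine ⟨hse x, ?_⟩
    rw [mem_preimage, ← he x (hse x)]
    exact Metric.mem_ball_self (hr x)
  · obtain ⟨x, hx⟩ := mem_iUnion.1 hz
    refine mem_iUnion.2 ⟨x, fun t' ht' => ?_⟩
    rw [hh]
    exact hx _ ⟨mul_nonneg ht'.1 ht.1, mul_le_one₀ ht'.2 ht.1 ht.2⟩
  · intro z hz z' hz' hzz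
    obtain ⟨x, hx⟩ := mem_iUnion.1 hz
    obtain ⟨x', hx'⟩ := mem_iUnion.1 hz'
    rcases le_total (r x') (r x) with hle | hle
    · exact key x x' z z' hx hx' hzz hle
    · exact (key x' x z' z hx' hx hzz.symm hle).symm
  · obtain ⟨x, hx⟩ := mem_iUnion.1 hz
    exact ⟨x, (hOD x z hx).1⟩

end Contraction

/-! ### From local diffeomorphisms to a diffeomorphism. -/

section GlobalDiffeo

variable {EX : Type*} [NormedAddCommGroup EX] [NormedSpace ℝ EX] {HX : Type*} [TopologicalSpace HX]
  {IX : ModelWithCorners ℝ EX HX} {X : Type*} [TopologicalSpace X] [ChartedSpace HX X]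
  {F : Type*} [NormedAddCommGroup F] [NormedSpace ℝ F]
  {M : Type*} [TopologicalSpace M] [ChartedSpace F M]

/-- An injective local diffeomorphism on an open set is a diffeomorphism onto its image. -/
theorem exists_isDiffeoOn_of_injOn [Nonempty X] {f : X → M} {O : Set X} (hO : IsOpen O)
    (hinj : InjOn f O)
    (hloc : ∀ z ∈ O, ∃ e : OpenPartialHomeomorph X M, z ∈ e.source ∧ IsDiffeoOn IX F f e) :
    ∃ Φ : OpenPartialHomeomorph X M, Φ.source = O ∧ (∀ z, Φ z = f z) ∧ IsDiffeoOn IX F f Φ := by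
  have hcont : ∀ z ∈ O, ContMDiffAt IX 𝓘(ℝ, F) ∞ f z := fun z hz => by
    obtain ⟨e, hze, he⟩ := hloc z hz
    exact (he.smooth.contMDiffAt (e.open_source.mem_nhds hze)).congr_of_eventuallyEq
      (Filter.eventuallyEq_of_mem (e.open_source.mem_nhds hze) he.eqOn)
  let P : PartialEquiv X M := hinj.bijOn_image.toPartialEquiv f O (f '' O)
  have hopen : IsOpenMap (P.source.domRestrict P) := by
    refine IsOpenMap.of_nhds_le fun z => ?_
    obtain ⟨e, hze, he⟩ := hloc z z.2
    have h1 : Filter.map (P.source.domRestrict P) (𝓝 z) = Filter.map f (𝓝 (z : X)) := by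
      rw [← hO.isOpenEmbedding_subtypeVal.map_nhds_eq z, Filter.map_map]
      rfl
    have h2 : Filter.map f (𝓝 (z : X)) = 𝓝 (f z) := by
      rw [Filter.map_congr (Filter.eventuallyEq_of_mem (e.open_source.mem_nhds hze) he.eqOn),
        e.map_nhds_eq hze, he.eqOn hze]
    rw [h1, h2]
    rfl
  let Φ : OpenPartialHomeomorph X M := OpenPartialHomeomorph.ofContinuousOpenRestrict P
    (fun z hz => (hcont z hz).continuousAt.continuousWithinAt) hopen hO
  refine ⟨Φ, rfl, fun z => rfl, fun z _ => rfl, fun z hz => (hcont z hz).contMDiffWithinAt, ?_⟩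
  intro y hy
  have hz : Φ.symm y ∈ O := Φ.map_target hy
  obtain ⟨e, hze, he⟩ := hloc _ hz
  have hey : e (Φ.symm y) = y := (he.eqOn hze).symm.trans (Φ.right_inv hy)
  have hyt : y ∈ e.target := hey ▸ e.map_source hze
  have hsy : e.symm y = Φ.symm y := by rw [← e.left_inv hze, hey]
  refine ((he.smooth_symm.contMDiffAt (e.open_target.mem_nhds hyt)).congr_of_eventuallyEq
    ?_).contMDiffWithinAt
  have hO' : ∀ᶠ y' in 𝓝 y, e.symm y' ∈ O :=
    (e.continuousAt_symm hyt).eventually (hsy ▸ hO.mem_nhds hz)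
  filter_upwards [hO', e.open_target.mem_nhds hyt] with y' hy' hyt'
  have : y' = Φ (e.symm y') := by
    change y' = f (e.symm y')
    rw [he.eqOn (e.map_target hyt'), e.right_inv hyt']
  conv_lhs => rw [this]
  exact Φ.left_inv hy'

end GlobalDiffeo

/-! ### Topology of the total space of a vector bundle. -/

section TotalSpace

variable {N : Type*} [TopologicalSpace N] {G : Type*} [NormedAddCommGroup G] [NormedSpace ℝ G]
  {ι : Type*} (Z : VectorBundleCore ℝ N G ι)

lemma t2Space_totalSpace [T2Space N] : T2Space (TotalSpace G Z.Fiber) := by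
  refine ⟨fun z z' hne => ?_⟩
  by_cases hp : z.proj = z'.proj
  · set e := Z.localTrivAt z.proj with he
    have hz : z ∈ e.source := (Z.mem_localTriv_source _ _).2 (Z.mem_baseSet_at _)
    have hz' : z' ∈ e.source := (Z.mem_localTriv_source _ _).2 (hp ▸ Z.mem_baseSet_at _)
    obtain ⟨u, v, hu, hv, hzu, hzv, huv⟩ := t2_separation (e.injOn.ne hz hz' hne)
    refine ⟨e.source ∩ e ⁻¹' u, e.source ∩ e ⁻¹' v,
      e.toOpenPartialHomeomorph.isOpen_inter_preimage hu,
      e.toOpenPartialHomeomorph.isOpen_inter_preimage hv, ⟨hz, hzu⟩, ⟨hz', hzv⟩, ?_⟩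
    exact (huv.preimage e).mono inter_subset_right inter_subset_right
  · obtain ⟨u, v, hu, hv, hzu, hzv, huv⟩ := t2_separation hp
    exact ⟨_, _, hu.preimage Z.continuous_proj, hv.preimage Z.continuous_proj, hzu, hzv,
      huv.preimage _⟩

lemma continuous_fibre_smul : Continuous fun p : ℝ × TotalSpace G Z.Fiber =>
    (⟨p.2.proj, p.1 • p.2.2⟩ : TotalSpace G Z.Fiber) := by
  rw [continuous_iff_continuousAt]
  rintro ⟨t, z⟩
  rw [FiberBundle.continuousAt_totalSpace]
  have hπ : Continuous fun p : ℝ × TotalSpace G Z.Fiber => p.2.proj :=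
    Z.continuous_proj.comp continuous_snd
  refine ⟨hπ.continuousAt, ?_⟩
  set e := trivializationAt G Z.Fiber z.proj with he
  have hb : z.proj ∈ e.baseSet := FiberBundle.mem_baseSet_trivializationAt' z.proj
  have h1 : ContinuousAt (fun p : ℝ × TotalSpace G Z.Fiber => p.1 • (e p.2).2) (t, z) := by
    refine continuousAt_fst.smul ?_
    have : ContinuousAt e z := e.continuousAt (e.mem_source.2 hb)
    exact continuous_snd.continuousAt.comp (this.comp continuousAt_snd)
  refine h1.congr ?_
  filter_upwards [(e.open_baseSet.preimage hπ).mem_nhds hb] with p hp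
  exact ((e.linear ℝ hp).map_smul p.1 p.2.2).symm

end TotalSpace

/-! ### The first-order equivalence. -/

section Uniqueness

open Module

set_option linter.unusedSectionVars false

lemma exists_continuousLinearEquiv_of_injective {V W : Type*} [NormedAddCommGroup V]
    [NormedSpace ℝ V] [NormedAddCommGroup W] [NormedSpace ℝ W] [FiniteDimensional ℝ V]
    [FiniteDimensional ℝ W] {A : V →L[ℝ] W} (hA : ∀ ζ, A ζ = 0 → ζ = 0)
    (hd : finrank ℝ V = finrank ℝ W) : ∃ L : V ≃L[ℝ] W, A = L := by
  have hinj : Function.Injective A.toLinearMap := (injective_iff_map_eq_zero A).2 hA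
  exact ⟨(A.toLinearMap.linearEquivOfInjective hinj hd).toContinuousLinearEquiv,
    ContinuousLinearMap.ext fun v => rfl⟩

universe u

variable {Y : Type*} [NormedAddCommGroup Y] [NormedSpace ℝ Y]
  {H : Type*} [TopologicalSpace H] {I : ModelWithCorners ℝ Y H} {N : Type u}
  [TopologicalSpace N] [ChartedSpace H N] [IsManifold I ∞ N]
  {F : Type*} [NormedAddCommGroup F] [NormedSpace ℝ F]
  {M : Type*} [TopologicalSpace M] [ChartedSpace F M] [IsManifold 𝓘(ℝ, F) ∞ M]
  {F' : Type*} [NormedAddCommGroup F'] [NormedSpace ℝ F']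
  {M' : Type*} [TopologicalSpace M'] [ChartedSpace F' M'] [IsManifold 𝓘(ℝ, F') ∞ M']
  {G : Type*} [NormedAddCommGroup G] [NormedSpace ℝ G]
  [FiniteDimensional ℝ Y] [FiniteDimensional ℝ F] [FiniteDimensional ℝ F']
  [FiniteDimensional ℝ G]

/-- The derivative along the zero section of a map that immerses both `N` and the fibres
transversally is invertible. -/
lemma exists_equiv_of_zeroProj_zeroVert {Z : VectorBundleCore ℝ N G N} [Z.IsContMDiff I ∞] {x : N}
    {A : Y × G →L[ℝ] F} {B : Y →L[ℝ] F} {j : G →L[ℝ] F}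
    (hA : A = B.comp (zeroProj I Z x) + j.comp (zeroVert I Z x))
    (hinj : ∀ w u, B w + j u = 0 → w = 0 ∧ u = 0)
    (hd : finrank ℝ F = finrank ℝ Y + finrank ℝ G) : ∃ L : (Y × G) ≃L[ℝ] F, A = L := by
  refine exists_continuousLinearEquiv_of_injective (fun ζ hζ => ?_)
    (by rw [Module.finrank_prod, hd])
  rw [hA] at hζ
  obtain ⟨h1, h2⟩ := hinj _ _ hζ
  -- Lifts show that the pair of components is onto, and a surjective endomorphism of a
  -- finite-dimensional space is injective.
  let P : Y × G →ₗ[ℝ] Y × G :=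
    (zeroProj I Z x).toLinearMap.prod (zeroVert I Z x).toLinearMap
  have hs : Function.Surjective P := fun ⟨w, u⟩ => by
    obtain ⟨ζ', e1, e2⟩ := exists_zeroProj_zeroVert (I := I) (Z := Z) x w u
    exact ⟨ζ', Prod.ext e1 e2⟩
  refine LinearMap.injective_iff_surjective.2 hs ?_
  rw [map_zero]
  exact Prod.ext h1 h2

/-- A map from the total space of a vector bundle whose restriction to the zero section is an
embedding and whose derivative is invertible there is a diffeomorphism near the zero section. -/
theorem exists_isOpen_injOn_zeroSection [T2Space N] [I.Boundaryless] [T2Space M]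
    [SecondCountableTopology M] {Z : VectorBundleCore ℝ N G N} [Z.IsContMDiff I ∞]
    {i : N → M} (hi : IsEmbedding i) {Φ : TotalSpace G Z.Fiber → M}
    (h0 : ∀ x, Φ (zeroSection G Z.Fiber x) = i x)
    (hs : ∀ x, SmoothNear (I.prod 𝓘(ℝ, G)) 𝓘(ℝ, F) Φ (zeroSection G Z.Fiber x))
    (hd : ∀ x, ∃ L : (Y × G) ≃L[ℝ] F,
      tderiv (I.prod 𝓘(ℝ, G)) F Φ (zeroSection G Z.Fiber x) = L) :
    ∃ O : Set (TotalSpace G Z.Fiber), IsOpen O ∧ (∀ x, zeroSection G Z.Fiber x ∈ O) ∧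
      (∀ z ∈ O, ∀ t ∈ Icc (0 : ℝ) 1, (⟨z.proj, t • z.2⟩ : TotalSpace G Z.Fiber) ∈ O) ∧
      InjOn Φ O ∧ ∀ z ∈ O, ∃ e : OpenPartialHomeomorph (TotalSpace G Z.Fiber) M, z ∈ e.source ∧
        IsDiffeoOn (I.prod 𝓘(ℝ, G)) F Φ e := by
  have : LocallyCompactSpace M := ChartedSpace.locallyCompactSpace F M
  have : T2Space (TotalSpace G Z.Fiber) := t2Space_totalSpace Z
  have : CompleteSpace (Y × G) := FiniteDimensional.complete ℝ _
  have hloc : ∀ x, ∃ e : OpenPartialHomeomorph (TotalSpace G Z.Fiber) M,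
      zeroSection G Z.Fiber x ∈ e.source ∧ IsDiffeoOn (I.prod 𝓘(ℝ, G)) F Φ e := fun x => by
    obtain ⟨L, hL⟩ := hd x
    exact (hs x).exists_isDiffeoOn hL
  choose e hse he using hloc
  have hmk : ∀ x : N, (⟨x, (0 : Z.Fiber x)⟩ : TotalSpace G Z.Fiber) = zeroSection G Z.Fiber x :=
    fun x => rfl
  obtain ⟨O, hO, hsO, hstar, hinj, hOe⟩ := exists_isOpen_injOn (f := Φ) (e := e)
    (s := zeroSection G Z.Fiber) (pr := fun z => z.proj)
    (h := fun t z => ⟨z.proj, t • z.2⟩)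
    (contMDiff_zeroSection ℝ Z.Fiber (IB := I) (n := ∞)).continuous
    (continuous_fibre_smul Z)
    (fun z => by rw [← hmk]; exact congrArg (TotalSpace.mk z.proj) (zero_smul ℝ z.2))
    (fun z => congrArg (TotalSpace.mk z.proj) (one_smul ℝ z.2))
    (fun t x => congrArg (TotalSpace.mk x) (smul_zero t))
    (fun t t' z => congrArg (TotalSpace.mk z.proj) (smul_smul t t' z.2))
    (by simpa only [h0] using hi) hse (fun x => (he x).eqOn)
  refine ⟨O, hO, hsO, hstar, hinj, fun z hz => ?_⟩
  obtain ⟨x, hx⟩ := hOe z hz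
  exact ⟨e x, hx, he x⟩

/-- Lagrangian coisotropic embeddings which induce the same form and the same endomorphism are
equivalent to first order. -/
theorem exists_first_order_equivalence [T2Space N] [SigmaCompactSpace N] [Nonempty N]
    [I.Boundaryless] [T2Space M] [SecondCountableTopology M] [T2Space M']
    [SecondCountableTopology M']
    {T : N → (Y →L[ℝ] Y)} {i₁ : N → M} {σ₁ : DiffForm 𝓘(ℝ, F) M 2}
    {S₁ : ∀ x : M, TangentSpace 𝓘(ℝ, F) x →L[ℝ] TangentSpace 𝓘(ℝ, F) x}
    (h₁ : IsCoisotropicImmersion I T i₁ σ₁ S₁) (he₁ : IsEmbedding i₁)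
    {i₂ : N → M'} {σ₂ : DiffForm 𝓘(ℝ, F') M' 2}
    {S₂ : ∀ x : M', TangentSpace 𝓘(ℝ, F') x →L[ℝ] TangentSpace 𝓘(ℝ, F') x}
    (h₂ : IsCoisotropicImmersion I T i₂ σ₂ S₂) (he₂ : IsEmbedding i₂)
    (hω : ∀ x w w', bilin (F := F) (σ₁ (i₁ x)) (tderiv I F i₁ x w) (tderiv I F i₁ x w') =
      bilin (F := F') (σ₂ (i₂ x)) (tderiv I F' i₂ x w) (tderiv I F' i₂ x w')) :
    ∃ ψ : OpenPartialHomeomorph M M',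
      IsTubularNeighborhood I 𝓘(ℝ, F) i₁ ψ.source ∧
      IsTubularNeighborhood I 𝓘(ℝ, F') i₂ ψ.target ∧
      ContMDiffOn 𝓘(ℝ, F) 𝓘(ℝ, F') ∞ ψ ψ.source ∧
      ContMDiffOn 𝓘(ℝ, F') 𝓘(ℝ, F) ∞ ψ.symm ψ.target ∧
      (∀ x, ψ (i₁ x) = i₂ x) ∧
      (∀ x, DiffForm.pullback 𝓘(ℝ, F) 𝓘(ℝ, F') ψ σ₂ (i₁ x) = σ₁ (i₁ x)) ∧
      (∀ (x : N) (ξ : TangentSpace 𝓘(ℝ, F) (i₁ x)),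
        mfderiv 𝓘(ℝ, F) 𝓘(ℝ, F') ψ (i₁ x) (S₁ (i₁ x) ξ)
          = S₂ (ψ (i₁ x)) (mfderiv 𝓘(ℝ, F) 𝓘(ℝ, F') ψ (i₁ x) ξ)) := by
  obtain ⟨x₀⟩ := ‹Nonempty N›
  have hdim : finrank ℝ Y ≤ finrank ℝ F :=
    LinearMap.finrank_le_finrank_of_injective (f := (tderiv I F i₁ x₀).toLinearMap)
      ((injective_iff_map_eq_zero _).2 fun w hw => (h₁.model x₀).injective (by simpa using hw))
  let k := finrank ℝ F - finrank ℝ Y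
  let G := EuclideanSpace ℝ (Fin k)
  have hG : finrank ℝ F = finrank ℝ Y + finrank ℝ G := by
    rw [finrank_euclideanSpace_fin, Nat.add_sub_cancel' hdim]
  have hG' : finrank ℝ F' = finrank ℝ Y + finrank ℝ G := by
    rw [← hG]
    exact ((h₁.model x₀).finrank_eq_finrank (h₂.model x₀) (hω x₀)).symm
  have : Nonempty N := ⟨x₀⟩
  obtain ⟨Z, hZ, Φ₁, Φ₂, hΦ⟩ := exists_tubular_map_pair (G := G) h₁ h₂ hω hG
  obtain ⟨O₁, o₁, z₁, s₁, i₁', l₁⟩ := exists_isOpen_injOn_zeroSection (I := I) he₁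
    (fun x => (hΦ x).1) (fun x => (hΦ x).2.2.1) (fun x => by
      obtain ⟨-, -, -, -, j₁, j₂, Θ, hj, d₁, -⟩ := hΦ x
      exact exists_equiv_of_zeroProj_zeroVert d₁
        (fun w u h => hj.injective₁ (h₁.model x) h) hG)
  obtain ⟨O₂, o₂, z₂, s₂, i₂', l₂⟩ := exists_isOpen_injOn_zeroSection (I := I) he₂
    (fun x => (hΦ x).2.1) (fun x => (hΦ x).2.2.2.1) (fun x => by
      obtain ⟨-, -, -, -, j₁, j₂, Θ, hj, -, d₂⟩ := hΦ x
      exact exists_equiv_of_zeroProj_zeroVert d₂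
        (fun w u h => hj.injective₂ (h₁.model x) (h₂.model x) (hω x) h) hG')
  have : Nonempty (TotalSpace G Z.Fiber) := ⟨zeroSection G Z.Fiber x₀⟩
  -- Both maps are restricted to the same set `O₁ ∩ O₂`, which is still star-shaped, so that they
  -- can be composed and both images are tubular neighbourhoods.
  obtain ⟨Ψ₁, so₁, v₁, dd₁⟩ := exists_isDiffeoOn_of_injOn (o₁.inter o₂)
    (i₁'.mono inter_subset_left) (fun z hz => l₁ z hz.1)
  obtain ⟨Ψ₂, so₂, v₂, dd₂⟩ := exists_isDiffeoOn_of_injOn (o₁.inter o₂)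
    (i₂'.mono inter_subset_right) (fun z hz => l₂ z hz.2)
  have hz : ∀ x, zeroSection G Z.Fiber x ∈ O₁ ∩ O₂ := fun x => ⟨z₁ x, z₂ x⟩
  let ψ : OpenPartialHomeomorph M M' := Ψ₁.symm.trans' Ψ₂ (so₁.trans so₂.symm)
  have hψ : ∀ z ∈ O₁ ∩ O₂, ψ (Φ₁ z) = Φ₂ z := fun z hz => by
    change Ψ₂ (Ψ₁.symm (Φ₁ z)) = Φ₂ z
    rw [← v₁ z, Ψ₁.left_inv (so₁.symm ▸ hz), v₂]
  have hψi : ∀ x, ψ (i₁ x) = i₂ x := fun x => by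
    rw [← (hΦ x).1, hψ _ (hz x), (hΦ x).2.1]
  have hmaps : MapsTo Ψ₁.symm Ψ₁.target Ψ₂.source := fun y hy =>
    so₂.symm ▸ so₁ ▸ Ψ₁.map_target hy
  have hmaps' : MapsTo Ψ₂.symm Ψ₂.target Ψ₁.source := fun y hy =>
    so₁.symm ▸ so₂ ▸ Ψ₂.map_target hy
  have hψs : ContMDiffOn 𝓘(ℝ, F) 𝓘(ℝ, F') ∞ ψ ψ.source :=
    dd₂.smooth.comp dd₁.smooth_symm hmaps
  have hψs' : ContMDiffOn 𝓘(ℝ, F') 𝓘(ℝ, F) ∞ ψ.symm ψ.target :=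
    dd₁.smooth.comp dd₂.smooth_symm hmaps'
  have hsrc : ∀ x, i₁ x ∈ ψ.source := fun x => by
    rw [← (hΦ x).1, ← v₁]
    exact Ψ₁.map_source (so₁.symm ▸ hz x)
  have hd : ∀ x ζ, tderiv 𝓘(ℝ, F) F' ψ (i₁ x) (tderiv (I.prod 𝓘(ℝ, G)) F Φ₁
      (zeroSection G Z.Fiber x) ζ) = tderiv (I.prod 𝓘(ℝ, G)) F' Φ₂ (zeroSection G Z.Fiber x) ζ := by
    intro x ζ
    have heq : (fun z => ψ (Φ₁ z)) =ᶠ[𝓝 (zeroSection G Z.Fiber x)] Φ₂ :=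
      Filter.eventuallyEq_of_mem ((o₁.inter o₂).mem_nhds (hz x)) hψ
    have hψd : MDifferentiableAt 𝓘(ℝ, F) 𝓘(ℝ, F') ψ (Φ₁ (zeroSection G Z.Fiber x)) := by
      rw [(hΦ x).1]
      exact (hψs.contMDiffAt (ψ.open_source.mem_nhds (hsrc x))).mdifferentiableAt (by simp)
    rw [← tderiv_congr heq, tderiv_comp hψd (hΦ x).2.2.1.mdifferentiableAt, (hΦ x).1]
    rfl
  -- In the splittings given by the adapted frame, the derivative of `ψ` keeps the components `(w,
  -- u)`; `form_match` and `endo_match` then give the two claims.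
  have hframe : ∀ x, ∃ j₁ j₂ Θ, IsAdaptedFrame (tderiv I F i₁ x) (bilin (F := F) (σ₁ (i₁ x)))
      (S₁ (i₁ x)) (tderiv I F' i₂ x) (bilin (F := F') (σ₂ (i₂ x))) (S₂ (i₂ x)) j₁ j₂ Θ ∧
      (∀ ξ, ∃ w u, ξ = tderiv I F i₁ x w + j₁ u) ∧ ∀ w (u : G),
        tderiv 𝓘(ℝ, F) F' ψ (i₁ x) (tderiv I F i₁ x w + j₁ u) = tderiv I F' i₂ x w + j₂ u := by
    intro x
    obtain ⟨-, -, -, -, j₁, j₂, Θ, hj, d₁, d₂⟩ := hΦ x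
    refine ⟨j₁, j₂, Θ, hj, fun ξ => ?_, fun w u => ?_⟩
    · obtain ⟨L, hL⟩ := exists_equiv_of_zeroProj_zeroVert (I := I) d₁
        (fun w u h => hj.injective₁ (h₁.model x) h) hG
      refine ⟨zeroProj I Z x (L.symm ξ), zeroVert I Z x (L.symm ξ), ?_⟩
      have h := DFunLike.congr_fun (d₁.symm.trans hL) (L.symm ξ)
      exact (h.trans (L.apply_symm_apply ξ)).symm
    · obtain ⟨ζ, e1, e2⟩ := exists_zeroProj_zeroVert (I := I) (Z := Z) x w u
      have h := hd x ζ
      rw [d₁, d₂] at h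
      simpa [e1, e2] using h
  refine ⟨ψ, ⟨k, N, Z, hZ, Ψ₁, fun x => ⟨so₁.symm ▸ hz x, (v₁ _).trans (hΦ x).1⟩, ?_, rfl,
    dd₁.smooth, dd₁.smooth_symm⟩, ⟨k, N, Z, hZ, Ψ₂,
    fun x => ⟨so₂.symm ▸ hz x, (v₂ _).trans (hΦ x).2.1⟩, ?_, rfl,
    dd₂.smooth, dd₂.smooth_symm⟩, hψs, hψs', hψi, fun x => ?_, fun x ξ => ?_⟩
  · rw [so₁]
    exact fun z hz t ht => ⟨s₁ z hz.1 t ht, s₂ z hz.2 t ht⟩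
  · rw [so₂]
    exact fun z hz t ht => ⟨s₁ z hz.1 t ht, s₂ z hz.2 t ht⟩
  · obtain ⟨j₁, j₂, Θ, hj, hsurj, hdψ⟩ := hframe x
    have key : ∀ ξ η : F, bilin (F := F') (σ₂ (ψ (i₁ x))) (tderiv 𝓘(ℝ, F) F' ψ (i₁ x) ξ)
        (tderiv 𝓘(ℝ, F) F' ψ (i₁ x) η) = bilin (F := F) (σ₁ (i₁ x)) ξ η := by
      intro ξ η
      obtain ⟨w, u, rfl⟩ := hsurj ξ
      obtain ⟨w', u', rfl⟩ := hsurj η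
      rw [hdψ, hdψ, hψi, hj.form_match (h₁.model x) (h₂.model x) (hω x)]
    refine ContinuousAlternatingMap.ext fun m => ?_
    have h := key (m 0) (m 1)
    have e1 : m = ![m 0, m 1] := by
      funext j
      fin_cases j <;> rfl
    have e2 : (fun j => mfderiv 𝓘(ℝ, F) 𝓘(ℝ, F') ψ (i₁ x) (m j)) =
        ![mfderiv 𝓘(ℝ, F) 𝓘(ℝ, F') ψ (i₁ x) (m 0), mfderiv 𝓘(ℝ, F) 𝓘(ℝ, F') ψ (i₁ x) (m 1)] := by
      funext j
      fin_cases j <;> rfl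
    exact (congrArg (σ₂ (ψ (i₁ x))) e2).trans (h.trans (congrArg (σ₁ (i₁ x)) e1.symm))
  · obtain ⟨j₁, j₂, Θ, hj, hsurj, hdψ⟩ := hframe x
    obtain ⟨w, u, hξ⟩ := hsurj ξ
    obtain ⟨w', u', e1, e2⟩ := hj.endo_match (h₁.model x) (h₂.model x) w u
    have h : tderiv 𝓘(ℝ, F) F' ψ (i₁ x) ((S₁ (i₁ x) : F →L[ℝ] F) ξ) =
        (S₂ (ψ (i₁ x)) : F' →L[ℝ] F') (tderiv 𝓘(ℝ, F) F' ψ (i₁ x) ξ) := by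
      have hS : (S₂ (ψ (i₁ x)) : F' →L[ℝ] F') = S₂ (i₂ x) := by
        rw [hψi x]
      have hdξ : tderiv 𝓘(ℝ, F) F' ψ (i₁ x) ξ = tderiv I F' i₂ x w + j₂ u :=
        (congrArg (tderiv 𝓘(ℝ, F) F' ψ (i₁ x)) hξ).trans (hdψ w u)
      have e3 : (S₁ (i₁ x) : F →L[ℝ] F) ξ = tderiv I F i₁ x w' + j₁ u' :=
        (congrArg (S₁ (i₁ x) : F →L[ℝ] F) hξ).trans e1
      rw [e3, hdψ, hdξ, hS]
      exact e2.symm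
    exact h

end Uniqueness

/-! ### Injectivity of the derivative of an immersion. -/

section Immersions

variable {Y : Type*} [NormedAddCommGroup Y] [NormedSpace ℝ Y]
  {H : Type*} [TopologicalSpace H] {I : ModelWithCorners ℝ Y H} {N : Type*}
  [TopologicalSpace N] [ChartedSpace H N]
  {F : Type*} [NormedAddCommGroup F] [NormedSpace ℝ F]
  {M : Type*} [TopologicalSpace M] [ChartedSpace F M]

/-- The derivative of an immersion is injective. -/
lemma injective_tderiv_of_isImmersionAt [IsManifold I ∞ N] [IsManifold 𝓘(ℝ, F) ∞ M]
    [I.Boundaryless] {f : N → M} {x : N} (h : Manifold.IsImmersionAt I 𝓘(ℝ, F) ∞ f x) :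
    Function.Injective (tderiv I F f x) := by
  set φ := h.domChart.extend I with hφ
  set χ := h.codChart.extend 𝓘(ℝ, F) with hχ
  -- A local left inverse from the normal form of an immersion: project to the first factor in the
  -- target chart and return through the source chart.
  let g : M → N := fun y => φ.symm (h.equiv.symm (χ y)).1
  have hx : x ∈ φ.source := by
    rw [hφ, h.domChart.extend_source]
    exact h.mem_domChart_source
  have hgf : ∀ y ∈ φ.source, h.equiv.symm (χ (f y)) = (φ y, 0) := fun y hy => by
    have := h.writtenInCharts (φ.map_source hy)
    simp only [Function.comp_apply] at this
    rw [← hφ, φ.left_inv hy] at this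
    rw [← hχ] at this
    rw [this, ContinuousLinearEquiv.symm_apply_apply]
  have hid : g ∘ f =ᶠ[𝓝 x] id := by
    have ho : IsOpen φ.source := h.domChart.isOpen_extend_source
    filter_upwards [ho.mem_nhds hx] with y hy
    change φ.symm (h.equiv.symm (χ (f y))).1 = y
    rw [hgf y hy]
    exact φ.left_inv hy
  have hg : MDifferentiableAt 𝓘(ℝ, F) I g (f x) := by
    have h1 : ContMDiffAt 𝓘(ℝ, F) 𝓘(ℝ, F) ∞ χ (f x) :=
      h.codChart.contMDiffAt_extend h.codChart_mem_maximalAtlas h.mem_codChart_source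
    have h2 : ContMDiffAt 𝓘(ℝ, F) 𝓘(ℝ, Y) ∞ (fun y => (h.equiv.symm (χ y)).1) (f x) :=
      ((ContinuousLinearMap.fst ℝ Y h.complement).comp
        (h.equiv.symm : F →L[ℝ] Y × h.complement)).contMDiff.contMDiffAt.comp (f x) h1
    have h3 : ContMDiffAt 𝓘(ℝ, Y) I ∞ φ.symm (h.equiv.symm (χ (f x))).1 := by
      rw [hgf x hx]
      have ho : IsOpen φ.target := by
        rw [hφ, h.domChart.extend_target, I.range_eq_univ, inter_univ]
        exact h.domChart.open_target.preimage I.continuous_symm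
      have := contMDiffOn_extend_symm (n := ∞) h.domChart_mem_maximalAtlas
      rw [I.image_eq, I.range_eq_univ, inter_univ] at this
      refine this.contMDiffAt ?_
      refine (h.domChart.open_target.preimage I.continuous_symm).mem_nhds ?_
      have := φ.map_source hx
      rw [hφ, h.domChart.extend_target] at this
      exact this.1
    exact (h3.comp (f x) h2).mdifferentiableAt (by simp)
  have hd := mfderiv_comp x hg (h.contMDiffAt.mdifferentiableAt (by simp))
  have hd' : mfderiv I I (g ∘ f) x = ContinuousLinearMap.id ℝ (TangentSpace I x) := by
    exact hid.mfderiv_eq.trans mfderiv_id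
  refine (injective_iff_map_eq_zero _).2 fun w hw => ?_
  have h1 := DFunLike.congr_fun (hd.symm.trans hd') w
  refine Eq.trans h1.symm ?_
  exact (congrArg (mfderiv 𝓘(ℝ, F) I g (f x)) hw).trans (map_zero _)

end Immersions

/-! ### The canonical vertical endomorphism of the tangent bundle. -/

section VerticalEndomorphism

open Module

set_option linter.unusedSectionVars false

variable {E : Type*} [NormedAddCommGroup E] [NormedSpace ℝ E] [FiniteDimensional ℝ E]
  {Q : Type*} [TopologicalSpace Q] [ChartedSpace E Q] [IsManifold 𝓘(ℝ, E) ∞ Q]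

lemma trivializationAt_mk_self (q : Q) (w : E) :
    (trivializationAt E (TangentSpace 𝓘(ℝ, E) : Q → Type _) q
      (⟨q, w⟩ : TangentBundle 𝓘(ℝ, E) Q)).2 = w :=
  congrArg Prod.snd ((tangentBundleCore 𝓘(ℝ, E) Q).localTrivAt_apply_mk q w)

lemma contMDiff_tangent_fibre (q : Q) : ContMDiff 𝓘(ℝ, E) 𝓘(ℝ, E).tangent ∞
    (fun w : E => (⟨q, w⟩ : TangentBundle 𝓘(ℝ, E) Q)) := by
  refine fun w => contMDiffAt_totalSpace.2 ⟨contMDiffAt_const, ?_⟩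
  exact contMDiffAt_id.congr_of_eventuallyEq (Filter.Eventually.of_forall fun w =>
    trivializationAt_mk_self q w)

lemma contMDiff_tangent_proj : ContMDiff 𝓘(ℝ, E).tangent 𝓘(ℝ, E) ∞
    (fun u : TangentBundle 𝓘(ℝ, E) Q => u.proj) :=
  contMDiff_proj _

/-- The fibre coordinate of the trivialization at `v.proj` is a left inverse of the fibre inclusion.
-/
lemma verticalLift_injective (v : TangentBundle 𝓘(ℝ, E) Q) :
    Function.Injective (verticalLift v) := by
  set e := trivializationAt E (TangentSpace 𝓘(ℝ, E) : Q → Type _) v.proj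
  have hv : v ∈ e.source := e.mem_source.2 (mem_baseSet_trivializationAt E _ v.proj)
  have hg : MDifferentiableAt 𝓘(ℝ, E).tangent 𝓘(ℝ, E)
      (fun u : TangentBundle 𝓘(ℝ, E) Q => (e u).2) v :=
    (contMDiffAt_snd.comp v ((e.contMDiffOn (IB := 𝓘(ℝ, E)) (n := ∞)).contMDiffAt
      (e.open_source.mem_nhds hv))).mdifferentiableAt (by simp)
  have hd := mfderiv_comp (M := E) (v.2 : E) hg
    ((contMDiff_tangent_fibre (E := E) v.proj).mdifferentiable (by simp) (v.2 : E))
  have hid : (fun u : TangentBundle 𝓘(ℝ, E) Q => (e u).2) ∘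
      (fun w : E => (⟨v.proj, w⟩ : TangentBundle 𝓘(ℝ, E) Q)) = id := by
    funext w
    exact trivializationAt_mk_self v.proj w
  rw [hid] at hd
  have hd' := (mfderiv_id (I := 𝓘(ℝ, E)) (M := E) (x := (v.2 : E))).symm.trans hd
  refine (injective_iff_map_eq_zero _).2 fun w hw => ?_
  refine (DFunLike.congr_fun hd' w).trans ?_
  exact (congrArg (mfderiv 𝓘(ℝ, E).tangent 𝓘(ℝ, E) _ v) hw).trans (map_zero _)

lemma mfderiv_proj_verticalLift (v : TangentBundle 𝓘(ℝ, E) Q) (w : TangentSpace 𝓘(ℝ, E) v.proj) :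
    mfderiv 𝓘(ℝ, E).tangent 𝓘(ℝ, E) (fun u : TangentBundle 𝓘(ℝ, E) Q => u.proj) v
      (verticalLift v w) = 0 := by
  have hd := mfderiv_comp (M := E) (v.2 : E) (contMDiff_tangent_proj.contMDiffAt.mdifferentiableAt (by simp))
    ((contMDiff_tangent_fibre (E := E) v.proj).mdifferentiable (by simp) (v.2 : E))
  have hc : (fun u : TangentBundle 𝓘(ℝ, E) Q => u.proj) ∘
      (fun w : E => (⟨v.proj, w⟩ : TangentBundle 𝓘(ℝ, E) Q)) = fun _ => v.proj := rfl
  rw [hc] at hd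
  exact (DFunLike.congr_fun ((mfderiv_const (M := E) (x := (v.2 : E))).symm.trans hd) w).symm

/-- A local section through `v` with constant fibre coordinate splits the derivative of the
projection. -/
lemma mfderiv_proj_surjective (v : TangentBundle 𝓘(ℝ, E) Q) : Function.Surjective
    (mfderiv 𝓘(ℝ, E).tangent 𝓘(ℝ, E) (fun u : TangentBundle 𝓘(ℝ, E) Q => u.proj) v) := by
  set e := trivializationAt E (TangentSpace 𝓘(ℝ, E) : Q → Type _) v.proj
  have hb : v.proj ∈ e.baseSet := mem_baseSet_trivializationAt E _ v.proj
  let s : Q → TangentBundle 𝓘(ℝ, E) Q := fun q => e.toOpenPartialHomeomorph.symm (q, (e v).2)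
  have hsv : s v.proj = v := e.symm_apply_mk_proj (e.mem_source.2 hb)
  have hs : MDifferentiableAt 𝓘(ℝ, E) 𝓘(ℝ, E).tangent s v.proj := by
    have ht : (v.proj, (e v).2) ∈ e.target := e.mem_target.2 hb
    have := (e.contMDiffOn_symm (n := ∞) (IB := 𝓘(ℝ, E))).contMDiffAt (e.open_target.mem_nhds ht)
    exact (this.comp v.proj (contMDiffAt_id.prodMk contMDiffAt_const)).mdifferentiableAt (by simp)
  have hp : MDifferentiableAt 𝓘(ℝ, E).tangent 𝓘(ℝ, E)
      (fun u : TangentBundle 𝓘(ℝ, E) Q => u.proj) (s v.proj) :=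
    contMDiff_tangent_proj.contMDiffAt.mdifferentiableAt (by simp)
  have hd := mfderiv_comp v.proj hp hs
  have hid : (fun u : TangentBundle 𝓘(ℝ, E) Q => u.proj) ∘ s =ᶠ[𝓝 v.proj] id := by
    filter_upwards [e.open_baseSet.mem_nhds hb] with q hq
    exact e.proj_symm_apply (e.mem_target.2 hq)
  rw [hid.mfderiv_eq, mfderiv_id, hsv] at hd
  exact fun w => ⟨mfderiv 𝓘(ℝ, E) 𝓘(ℝ, E).tangent s v.proj w, (DFunLike.congr_fun hd w).symm⟩

/-- The image of the vertical endomorphism is its kernel. -/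
lemma range_verticalEndo (v : TangentBundle 𝓘(ℝ, E) Q) (ξ : TangentSpace 𝓘(ℝ, E).tangent v) :
    (∃ η, verticalEndo v η = ξ) ↔ verticalEndo v ξ = 0 := by
  let P : E × E →ₗ[ℝ] E := (mfderiv 𝓘(ℝ, E).tangent 𝓘(ℝ, E)
    (fun u : TangentBundle 𝓘(ℝ, E) Q => u.proj) v : E × E →L[ℝ] E).toLinearMap
  let V : E →ₗ[ℝ] E × E := (verticalLift v : E →L[ℝ] E × E).toLinearMap
  -- Vertical lifts project to zero, and both spaces have dimension `finrank ℝ E`, so the inclusion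
  -- is an equality.
  have hPV : LinearMap.range V ≤ LinearMap.ker P := by
    rintro _ ⟨w, rfl⟩
    exact mfderiv_proj_verticalLift v w
  have hV : finrank ℝ (LinearMap.range V) = finrank ℝ E :=
    LinearMap.finrank_range_of_inj (verticalLift_injective v)
  have hP : finrank ℝ (LinearMap.ker P) = finrank ℝ E := by
    have h1 := P.finrank_range_add_finrank_ker
    have h2 : LinearMap.range P = ⊤ := LinearMap.range_eq_top.2 (mfderiv_proj_surjective v)
    rw [h2, finrank_top, Module.finrank_prod] at h1
    omega
  have heq : LinearMap.range V = LinearMap.ker P :=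
    Submodule.eq_of_le_of_finrank_eq hPV (hV.trans hP.symm)
  constructor
  · rintro ⟨η, rfl⟩
    exact (congrArg (verticalLift v) (mfderiv_proj_verticalLift v _)).trans (map_zero _)
  · intro h
    have h1 : P ξ = 0 := verticalLift_injective v (h.trans (map_zero _).symm)
    obtain ⟨w, hw⟩ : ξ ∈ LinearMap.range V := heq ▸ h1
    obtain ⟨η, rfl⟩ := mfderiv_proj_surjective v w
    exact ⟨η, hw⟩

end VerticalEndomorphism

/-! ### Lagrangian regularizations as coisotropic immersions. -/

section Regularizations

set_option linter.unusedSectionVars false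

variable {E : Type*} [NormedAddCommGroup E] [NormedSpace ℝ E] [FiniteDimensional ℝ E]
  {Q : Type*} [TopologicalSpace Q] [ChartedSpace E Q] [IsManifold 𝓘(ℝ, E) ∞ Q]
  {F : Type*} [NormedAddCommGroup F] [NormedSpace ℝ F] [FiniteDimensional ℝ F]
  {M : Type*} [TopologicalSpace M] [ChartedSpace F M] [IsManifold 𝓘(ℝ, F) ∞ M]
  {L : TangentBundle 𝓘(ℝ, E) Q → ℝ} {i : TangentBundle 𝓘(ℝ, E) Q → M}
  {σ : DiffForm 𝓘(ℝ, F) M 2}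
  {S : ∀ x : M, TangentSpace 𝓘(ℝ, F) x →L[ℝ] TangentSpace 𝓘(ℝ, F) x}

lemma IsLagrangianRegularization.isCoisotropicImmersion
    (h : IsLagrangianRegularization L i σ S) :
    IsCoisotropicImmersion 𝓘(ℝ, E).tangent
      (fun v => (verticalEndo v : (E × E) →L[ℝ] (E × E))) i σ S where
  smooth := h.regularization.embedding.isImmersion.contMDiff
  smooth_form := h.regularization.symplectic.smooth
  smooth_endo := h.tangentStructure.smooth
  model := fun v =>
    { injective :=
        injective_tderiv_of_isImmersionAt (h.regularization.embedding.isImmersion.isImmersionAt v)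
      skew := bilin_skew (F := F) (σ (i v))
      nondegenerate := h.regularization.symplectic.nondegenerate (i v)
      coisotropic := h.regularization.coisotropic v
      lagrangian := h.lagrangian (i v)
      range_eq_ker := h.tangentStructure.range_eq_ker (i v)
      intertwines := h.preserves v
      range_eq_ker' := range_verticalEndo v }

/-- The right side does not involve the embedding, so two regularizations induce the same bilinear
form on each tangent space of `TQ`. -/
lemma IsLagrangianRegularization.bilin_tderiv (h : IsLagrangianRegularization L i σ S)
    (v : TangentBundle 𝓘(ℝ, E) Q) (w w' : E × E) :
    bilin (F := F) (σ (i v)) (tderiv 𝓘(ℝ, E).tangent F i v w)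
      (tderiv 𝓘(ℝ, E).tangent F i v w') =
    (lagrangianForm L v : (E × E) [⋀^Fin 2]→L[ℝ] ℝ) ![w, w'] := by
  rw [← h.regularization.pullback_eq]
  refine congrArg (σ (i v)) ?_
  funext j
  fin_cases j <;> rfl

end Regularizations

end LagReg

end

theorem mainTheorem2
    {E : Type*} [NormedAddCommGroup E] [NormedSpace ℝ E] [FiniteDimensional ℝ E]
    {Q : Type*} [TopologicalSpace Q] [T2Space Q] [SecondCountableTopology Q] [Nonempty Q]
    [ChartedSpace E Q] [IsManifold 𝓘(ℝ, E) ∞ Q]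
    (L : TangentBundle 𝓘(ℝ, E) Q → ℝ) (hL : ContMDiff 𝓘(ℝ, E).tangent 𝓘(ℝ, ℝ) ∞ L)
    (r : ℕ) (D : ∀ q : Q, Submodule ℝ (TangentSpace 𝓘(ℝ, E) q))
    (hD : LagReg.IsRegularDistribution r D)
    (hK : ∀ v : TangentBundle 𝓘(ℝ, E) Q,
      LagReg.characteristic (LagReg.lagrangianForm L) v = LagReg.completeLift D v)
    {F₁ : Type*} [NormedAddCommGroup F₁] [NormedSpace ℝ F₁] [FiniteDimensional ℝ F₁]
    {M₁ : Type*} [TopologicalSpace M₁] [T2Space M₁] [SecondCountableTopology M₁]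
    [ChartedSpace F₁ M₁] [IsManifold 𝓘(ℝ, F₁) ∞ M₁]
    {F₂ : Type*} [NormedAddCommGroup F₂] [NormedSpace ℝ F₂] [FiniteDimensional ℝ F₂]
    {M₂ : Type*} [TopologicalSpace M₂] [T2Space M₂] [SecondCountableTopology M₂]
    [ChartedSpace F₂ M₂] [IsManifold 𝓘(ℝ, F₂) ∞ M₂]
    (i₁ : TangentBundle 𝓘(ℝ, E) Q → M₁) (σ₁ : LagReg.DiffForm 𝓘(ℝ, F₁) M₁ 2)
    (S₁ : ∀ x : M₁, TangentSpace 𝓘(ℝ, F₁) x →L[ℝ] TangentSpace 𝓘(ℝ, F₁) x)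
    (h₁ : LagReg.IsLagrangianRegularization L i₁ σ₁ S₁)
    (i₂ : TangentBundle 𝓘(ℝ, E) Q → M₂) (σ₂ : LagReg.DiffForm 𝓘(ℝ, F₂) M₂ 2)
    (S₂ : ∀ x : M₂, TangentSpace 𝓘(ℝ, F₂) x →L[ℝ] TangentSpace 𝓘(ℝ, F₂) x)
    (h₂ : LagReg.IsLagrangianRegularization L i₂ σ₂ S₂) :
    ∃ ψ : OpenPartialHomeomorph M₁ M₂,
      LagReg.IsTubularNeighborhood 𝓘(ℝ, E).tangent 𝓘(ℝ, F₁) i₁ ψ.source ∧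
      LagReg.IsTubularNeighborhood 𝓘(ℝ, E).tangent 𝓘(ℝ, F₂) i₂ ψ.target ∧
      ContMDiffOn 𝓘(ℝ, F₁) 𝓘(ℝ, F₂) ∞ ψ ψ.source ∧
      ContMDiffOn 𝓘(ℝ, F₂) 𝓘(ℝ, F₁) ∞ ψ.symm ψ.target ∧
      (∀ v : TangentBundle 𝓘(ℝ, E) Q, ψ (i₁ v) = i₂ v) ∧
      (∀ v : TangentBundle 𝓘(ℝ, E) Q,
        LagReg.DiffForm.pullback 𝓘(ℝ, F₁) 𝓘(ℝ, F₂) ψ σ₂ (i₁ v) = σ₁ (i₁ v)) ∧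
      (∀ (v : TangentBundle 𝓘(ℝ, E) Q) (ξ : TangentSpace 𝓘(ℝ, F₁) (i₁ v)),
        mfderiv 𝓘(ℝ, F₁) 𝓘(ℝ, F₂) ψ (i₁ v) (S₁ (i₁ v) ξ)
          = S₂ (ψ (i₁ v)) (mfderiv 𝓘(ℝ, F₁) 𝓘(ℝ, F₂) ψ (i₁ v) ξ)) := by
  have he₁ := h₁.regularization.embedding.isEmbedding
  have he₂ := h₂.regularization.embedding.isEmbedding
  -- Separation and second countability of `TQ` are inherited from `M₁` through the embedding; with
  -- local compactness they give the σ-compactness needed for partitions of unity.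
  have : T2Space (TangentBundle 𝓘(ℝ, E) Q) := he₁.t2Space
  have : SecondCountableTopology (TangentBundle 𝓘(ℝ, E) Q) := he₁.secondCountableTopology
  have : LocallyCompactSpace (ModelProd E E) := 𝓘(ℝ, E).tangent.locallyCompactSpace
  have : LocallyCompactSpace (TangentBundle 𝓘(ℝ, E) Q) :=
    ChartedSpace.locallyCompactSpace (ModelProd E E) _
  have : Nonempty (TangentBundle 𝓘(ℝ, E) Q) := ‹Nonempty Q›.map fun q => ⟨q, 0⟩
  exact LagReg.exists_first_order_equivalence h₁.isCoisotropicImmersion he₁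
    h₂.isCoisotropicImmersion he₂
    fun v w w' => (h₁.bilin_tderiv v w w').trans (h₂.bilin_tderiv v w w').symm
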